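/- **Setting.** Let $t=2^{L}$ with $L=\log t\ge 0$ (logarithms are to base 2) and $n\ge 0$. There are $t$ processes $0,\dots,t-1$, which have to perform the units of work $1,\dots,n$. The system is synchronous, with rounds $1,2,\dots$; in one round an active process performs one unit of work, or sends one message, or waits for a reply. A message arrives in the round in which it is sent. Processes may crash, any number of them, at arbitrary times; in the round in which a process crashes it may or may not complete its work of that round, and an arbitrary subset of its messages of that round is sent. A process is *retired* if it has crashed or terminated. **Groups and views.** For $1\le h\le \log t$ the processes are partitioned into level-$h$ groups of $s_h=2^{\log t-h+1}$ consecutive processes, the first one being $\{0,\dots,s_h-1\}$; $G^i_h$ is the level-$h$ group of process $i$, and $G_0$ stands for the work itself. Each process $i$ maintains a *view* $(F_i,\mathrm{point}_i,\mathrm{round}_i)$: a set $F_i$ of processes known to be retired, a pointer $\mathrm{point}_i[G]$ and a round number $\mathrm{round}_i[G]$ for each group $G$ and for $G_0$. Initially $F_i=\emptyset$, $\mathrm{point}_i[G_0]=1$, $\mathrm{point}_i[G]$ is the lowest-numbered process of $G\setminus\{i\}$, and all $\mathrm{round}_i$ are $0$. The *reduced view* of $i$ is $\mathrm{point}_i[G_0]-1+|F_i|$.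 The $i$-*successor* of a process in a group is the next process of the group, in cyclic order, that is not in $\{i\}\cup F_i$. Whenever $i$ sends a message "to $\mathrm{point}_i[G^i_h]$" and this process is in $\{i\}\cup F_i$, its $i$-successor is meant instead; if $G^i_h\setminus\{i\}\subseteq F_i$, then no message is sent and no round is used. **Protocol C, active process $i$.** For $h=\log t,\dots,1$ in turn, process $i$ repeats the following until it receives a reply or $G^i_h\setminus\{i\}\subseteq F_i$: it sends "Are you alive?" to $\mathrm{point}_i[G^i_h]$ and waits for a reply during the next round; if there is none, it adds the polled process to $F_i$, then, if $h<\log t$, sends an ordinary message to $\mathrm{point}_i[G^i_{h+1}]$ in the following round, sets $\mathrm{round}_i[G^i_{h+1}]$ to the current round and advances $\mathrm{point}_i[G^i_{h+1}]$ to its $i$-successor, and in any case advances $\mathrm{point}_i[G^i_h]$ to its $i$-successor (if there is one). After level $1$, as long as $\mathrm{point}_i[G_0]\le n$, it performs the unit of work $\mathrm{point}_i[G_0]$, increases $\mathrm{point}_i[G_0]$ by one and sets $\mathrm{round}_i[G_0]$ to the current round, and in the next round sends an ordinary message to $\mathrm{point}_i[G^i_1]$, sets $\mathrm{round}_i[G^i_1]$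 to the current round and advances $\mathrm{point}_i[G^i_1]$ to its $i$-successor. When $\mathrm{point}_i[G_0]=n+1$ at level $0$, it terminates. **Other rules.** An ordinary message carries the sender's view, including the updates that belong to this message. The receiver adds the sender's $F$ to its own and, for every $G$ (including $G_0$) for which the received round number is larger than its own, takes over the received round number and pointer. A non-retired process answers an "Are you alive?" message in the round after it was sent; inactive processes send nothing else. Process $0$ is active from round $1$. With $K=5t+2\log t$ put $$D(i,m)=\begin{cases}K(n+t-m)\,2^{\,n+t-1-m}&\text{if } m\ge 1,\\ K(t-i)(n+t)\,2^{\,n+t-1}&\text{if } m=0.\end{cases}$$ A process $i\neq 0$ that has received no ordinary message becomes active at the beginning of round $D(i,0)$. An inactive process $i$ that last received an ordinary message in round $r$, and then had reduced view $m$, becomes active at the beginning of round $r+D(i,m)$. **Theorem.** In every execution of Protocol C, (a) at most $n+2t$ units of real work are performed in total (counted with multiplicity); (b) at most $n+8t\log t$ messages are sent in total ("Are you alive?" messages, replies and ordinary messages); (c) by the beginning of round $t(5t+2\log t)(n+t)2^{n+t}$, and at all later times, all processes are retired. -/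

import Mathlib

/-!
A synchronous message-passing system of `t = 2 ^ L` processes subject to crash failures, in which
the processes have to perform the units of work `1, …, n`, and the protocol that does so by
recursive failure detection. `L` is `log t` throughout. Rounds are numbered `1, 2, …`.
-/

namespace ProtocolC

/-- The `t = 2 ^ L` processes `0, …, t - 1`. -/
abbrev Proc (L : ℕ) : Type := Fin (2 ^ L)

/-! ### Groups and the cyclic order -/

/-- The size `s_h = 2 ^ (log t - h + 1)` of the groups of level `h`, `1 ≤ h ≤ log t`. -/
def groupSize (L h : ℕ) : ℕ := 2 ^ (L - h + 1)

/-- The number of the level-`h` group of `i`: group number `k` of level `h` consists of the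
processes `s_h * k, …, s_h * k + (s_h - 1)`. -/
def groupIdx {L : ℕ} (h : ℕ) (i : Proc L) : ℕ := (i : ℕ) / groupSize L h

/-- The process that comes `k` places after `p` in the cyclic order on the level-`h` group of `p`.
(For `1 ≤ h ≤ L` the value is less than `2 ^ L`, so that `Fin.ofNat` does not change it.) -/
def rotate {L : ℕ} (h : ℕ) (p : Proc L) (k : ℕ) : Proc L :=
  Fin.ofNat (2 ^ L)
    (groupSize L h * ((p : ℕ) / groupSize L h) + ((p : ℕ) % groupSize L h + k) % groupSize L h)

/-- The `i`-successor of `p` in its level-`h` group, where `F` is the set of processes that `i`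
knows to be retired: the first process after `p` in the cyclic order that is not in `{i} ∪ F`.
It is `p` itself if `p` is the only process of the group outside `{i} ∪ F`, and `none` if there
is no such process. -/
def successor {L : ℕ} (i : Proc L) (F : Finset (Proc L)) (h : ℕ) (p : Proc L) :
    Option (Proc L) :=
  ((List.range (groupSize L h)).map fun k => rotate h p (k + 1)).find?
    fun q => decide (q ≠ i ∧ q ∉ F)

/-! ### Views -/

/-- The view `(F_i, point_i, round_i)` of a process. The group number `k` of level `h ≥ 1` has the
entries `point h k` and `round h k`; the entries of `G_0`, the actual work, are `workPoint` and
`workRound`. -/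
structure View (L : ℕ) where
  faulty : Finset (Proc L)
  workPoint : ℕ
  workRound : ℕ
  point : ℕ → ℕ → Proc L
  round : ℕ → ℕ → ℕ

/-- The initial view of `i`: the pointer into a group `G` is the lowest-numbered process of
`G - {i}`. -/
def initView {L : ℕ} (i : Proc L) : View L where
  faulty := ∅
  workPoint := 1
  workRound := 0
  point h k :=
    if (i : ℕ) = groupSize L h * k then Fin.ofNat (2 ^ L) (groupSize L h * k + 1)
    else Fin.ofNat (2 ^ L) (groupSize L h * k)
  round _ _ := 0

/-- The number of units of work known to be done plus the number of processes known to be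
retired. -/
def View.reduced {L : ℕ} (v : View L) : ℕ := v.workPoint - 1 + v.faulty.card

/-- The view `v` updated by the information in a received view `w`: all failures known to either
are known, and each pointer is taken from the view whose information about it is more recent. -/
def View.merge {L : ℕ} (v w : View L) : View L where
  faulty := v.faulty ∪ w.faulty
  workPoint := if v.workRound < w.workRound then w.workPoint else v.workPoint
  workRound := max v.workRound w.workRound
  point h k := if v.round h k < w.round h k then w.point h k else v.point h k
  round h k := max (v.round h k) (w.round h k)

/-- Process `i` with view `v` learns that `q` is retired. -/
def View.addFaulty {L : ℕ} (v : View L) (q : Proc L) : View L :=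
  { v with faulty := insert q v.faulty }

/-- `point_i[G^i_h] := successor(p)`; no change if there is no successor. -/
def View.advance {L : ℕ} (v : View L) (i : Proc L) (h : ℕ) (p : Proc L) : View L :=
  { v with point := fun h' k =>
      if h' = h ∧ k = groupIdx h i then (successor i v.faulty h p).getD (v.point h' k)
      else v.point h' k }

/-- `round_i[G^i_h] := r`. -/
def View.setRound {L : ℕ} (v : View L) (i : Proc L) (h r : ℕ) : View L :=
  { v with round := fun h' k => if h' = h ∧ k = groupIdx h i then r else v.round h' k }

/-- The process of `G^i_h` to which `i` sends its next message at level `h`: the process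
`point_i[G^i_h]` or, if this process is `i` or already known by `i` to be retired, its
`i`-successor; `none` if all processes of `G^i_h` other than `i` are known by `i` to be
retired. -/
def View.target {L : ℕ} (v : View L) (i : Proc L) (h : ℕ) : Option (Proc L) :=
  let p := v.point h (groupIdx h i)
  if p ≠ i ∧ p ∉ v.faulty then some p else successor i v.faulty h p

/-! ### Deadlines -/

/-- `K = 5 t + 2 log t`. -/
def waitBound (L : ℕ) : ℕ := 5 * 2 ^ L + 2 * L

/-- `D(i, m)`, the number of rounds that process `i` waits, from the round in which it obtained the
reduced view `m`, until it becomes active. (The reduced view is at most `n + t - 1`.) -/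
def waitTime {L : ℕ} (n : ℕ) (i : Proc L) (m : ℕ) : ℕ :=
  if 1 ≤ m then waitBound L * (n + 2 ^ L - m) * 2 ^ (n + 2 ^ L - 1 - m)
  else waitBound L * (2 ^ L - (i : ℕ)) * (n + 2 ^ L) * 2 ^ (n + 2 ^ L - 1)

/-! ### Local states and the code of a process -/

/-- The control state of a process at the beginning of a round. -/
inductive Ctrl (L : ℕ) where
  /-- Inactive; becomes active at the beginning of round `deadline` unless it receives an ordinary
  message before. -/
  | inactive (deadline : ℕ)
  /-- Active, about to send an "Are you alive?" message to `q` at level `h`. -/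
  | poll (h : ℕ) (q : Proc L)
  /-- Active, waiting in this round for the reply of `q`, polled at level `h`. -/
  | await (h : ℕ) (q : Proc L)
  /-- Active, about to send to `q`, a process of its level-`h` group, an ordinary message that
  reports the unit of (real or fault-detection) work it has just done at level `h - 1`. -/
  | report (h : ℕ) (q : Proc L)
  /-- Active, about to perform the unit of work `u`. -/
  | work (u : ℕ)
  /-- Terminated. -/
  | halted

/-- Where active process `i` with view `v` continues when it enters level `h`, `h = log t, …, 0`
(or goes through the loop of this level again): it polls if there is somebody to poll at this
level, and goes down otherwise; at level `0` it performs the next unit of work, or halts if all the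
work is done. -/
def enter {L : ℕ} (n : ℕ) (i : Proc L) (v : View L) : ℕ → Ctrl L
  | 0 => if v.workPoint ≤ n then Ctrl.work v.workPoint else Ctrl.halted
  | h + 1 =>
    match v.target i (h + 1) with
    | some q => Ctrl.poll (h + 1) q
    | none => enter n i v h

/-- After a failure has been detected at level `h` (and reported, if `h ≠ log t`), the pointer
into `G^i_h` is moved to its successor and the loop of level `h` continues; it ends if
`G^i_h - F_i = {i}`. -/
def resume {L : ℕ} (n : ℕ) (i : Proc L) (v : View L) (h : ℕ) : View L × Ctrl L :=
  let v' := v.advance i h (v.point h (groupIdx h i))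
  (v', enter n i v' h)

/-- The view of process `i` after it has sent, in round `r`, an ordinary message to `q` at level
`h`. -/
def afterReport {L : ℕ} (r : ℕ) (i : Proc L) (v : View L) (h : ℕ) (q : Proc L) : View L :=
  (v.setRound i h r).advance i h q

/-- One round `r` of the code of process `i`, apart from the handling of incoming ordinary
messages: the view and control state after the round. `replied q` tells whether a reply from `q` to
an "Are you alive?" message arrived in this round. -/
def execute {L : ℕ} (n r : ℕ) (i : Proc L) (replied : Proc L → Bool) (v : View L) :
    Ctrl L → View L × Ctrl L
  | .inactive d => (v, .inactive d)
  | .poll h q => (v, .await h q)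
  | .await h q =>
    if replied q then (v, enter n i v (h - 1))
    else
      let v' := v.addFaulty q
      if h = L then resume n i v' h
      else
        match v'.target i (h + 1) with
        | some p => (v', .report (h + 1) p)
        | none => resume n i v' h
  | .report h q =>
    let v' := afterReport r i v h q
    if h = 1 then (v', enter n i v' 0) else resume n i v' (h - 1)
  | .work u =>
    let v' := { v with workPoint := u + 1, workRound := r }
    if 1 ≤ L then
      match v'.target i 1 with
      | some p => (v', .report 1 p)
      | none => (v', enter n i v' 0)
    else (v', enter n i v' 0)
  | .halted => (v, .halted)

/-- The local state of a process at the beginning of a round; `polledBy` is the set of processes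
whose "Are you alive?" message it received in the previous round and has to answer now. -/
structure LocalState (L : ℕ) where
  view : View L
  ctrl : Ctrl L
  polledBy : Finset (Proc L)

/-- A process that is inactive until its deadline becomes active at the beginning of that round,
and starts with fault detection at level `log t`. -/
def wake {L : ℕ} (n r : ℕ) (i : Proc L) (s : LocalState L) : LocalState L :=
  match s.ctrl with
  | .inactive d => if d ≤ r then { s with ctrl := enter n i s.view L } else s
  | _ => s

/-! ### Messages -/

/-- An ordinary message carries the view of its sender, including the unit of work it reports and
the fact that it has been sent. -/
inductive Msg (L : ℕ) where
  | areYouAlive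
  | reply
  | ordinary (v : View L)

/-- The messages that process `i` in state `s` (after `wake`) sends to `q` in round `r` if it does
not crash: a non-retired process answers every "Are you alive?" message in the round after it was
sent; everything else is sent by active processes. -/
def outbox {L : ℕ} (r : ℕ) (i : Proc L) (s : LocalState L) (q : Proc L) : List (Msg L) :=
  match s.ctrl with
  | .halted => []
  | .poll _ p =>
    (if q ∈ s.polledBy then [.reply] else []) ++ (if q = p then [.areYouAlive] else [])
  | .report h p =>
    (if q ∈ s.polledBy then [.reply] else []) ++
      (if q = p then [.ordinary (afterReport r i s.view h p)] else [])
  | _ => if q ∈ s.polledBy then [.reply] else []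

/-! ### Crashes and executions -/

/-- A crash pattern. Process `i` crashes in round `crashRound i` (in round `0` if it is faulty from
the start; never if this is `⊤`). In its crash round it still sends the messages to exactly those
recipients `q` for which `lastSend i q` holds, and completes the unit of work that it performs in
that round, if any, exactly if `lastWork i` holds. Any number of processes may crash. -/
structure Crashes (L : ℕ) where
  crashRound : Proc L → ℕ∞
  lastSend : Proc L → Proc L → Bool
  lastWork : Proc L → Bool

/-- The local states of all processes. For crashed processes they have no meaning: a crashed process
does not act any more, see `sent` and `Performs`. -/
abbrev Config (L : ℕ) : Type := Proc L → LocalState L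

/-- Initially process `0` is active, and process `i ≠ 0` waits until round `D(i, 0)`. -/
def initConfig (L n : ℕ) : Config L := fun i =>
  { view := initView i
    ctrl := if (i : ℕ) = 0 then enter n i (initView i) L else .inactive (waitTime n i 0)
    polledBy := ∅ }

/-- The messages that `i` actually sends to `q` in round `r`, where `c` is the configuration at the
beginning of the round. -/
def sent {L : ℕ} (n : ℕ) (A : Crashes L) (r : ℕ) (c : Config L) (i q : Proc L) : List (Msg L) :=
  if (r : ℕ∞) < A.crashRound i ∨ ((r : ℕ∞) = A.crashRound i ∧ A.lastSend i q) then
    outbox r i (wake n r i (c i)) q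
  else []

/-- Process `i` performs the unit of work `u` in round `r`, where `c` is the configuration at the
beginning of the round. -/
def Performs {L : ℕ} (n : ℕ) (A : Crashes L) (r : ℕ) (c : Config L) (i : Proc L) (u : ℕ) : Prop :=
  (wake n r i (c i)).ctrl = .work u ∧
    ((r : ℕ∞) < A.crashRound i ∨ ((r : ℕ∞) = A.crashRound i ∧ A.lastWork i))

def Msg.isPoll {L : ℕ} : Msg L → Bool
  | .areYouAlive => true
  | _ => false

def Msg.isReply {L : ℕ} : Msg L → Bool
  | .reply => true
  | _ => false

/-- The view carried by an ordinary message. -/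
def Msg.view? {L : ℕ} : Msg L → Option (View L)
  | .ordinary v => some v
  | _ => none

/-- The effect of receiving, in round `r`, ordinary messages that carry the views `ws`: the view is
updated, and an inactive process starts to wait anew, according to its new reduced view. -/
def receive {L : ℕ} (n r : ℕ) (i : Proc L) (ws : List (View L)) (x : View L × Ctrl L) :
    View L × Ctrl L :=
  let v := ws.foldl View.merge x.1
  match x.2 with
  | .inactive d => (v, .inactive (if ws.isEmpty then d else r + waitTime n i v.reduced))
  | a => (v, a)

/-- One round `r`: from the configuration at its beginning to the one at its end. Messages arrive in
the round in which they are sent. -/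
def step {L : ℕ} (n : ℕ) (A : Crashes L) (r : ℕ) (c : Config L) : Config L := fun i =>
  let s := wake n r i (c i)
  let views := (List.finRange (2 ^ L)).flatMap fun j => (sent n A r c j i).filterMap Msg.view?
  let replied : Proc L → Bool := fun j => (sent n A r c j i).any Msg.isReply
  let x := receive n r i views (execute n r i replied s.view s.ctrl)
  { view := x.1
    ctrl := x.2
    polledBy := Finset.univ.filter fun j => (sent n A r c j i).any Msg.isPoll = true }

/-- The execution with crash pattern `A`: the configuration at the beginning of round `r`, where
the first round is round `1`. -/
def execution {L : ℕ} (n : ℕ) (A : Crashes L) : ℕ → Config L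
  | 0 => initConfig L n
  | 1 => initConfig L n
  | r + 2 => step n A (r + 1) (execution n A (r + 1))

/-- All performances of units of real work: process `i` performs unit `u` in round `r`. -/
def workDone {L : ℕ} (n : ℕ) (A : Crashes L) : Set (ℕ × Proc L × ℕ) :=
  {e | 1 ≤ e.1 ∧ Performs n A e.1 (execution n A e.1) e.2.1 e.2.2}

/-- All messages sent, with their round, sender and recipient. (A process sends no two identical
messages to the same recipient in the same round.) -/
def messagesSent {L : ℕ} (n : ℕ) (A : Crashes L) : Set (ℕ × Proc L × Proc L × Msg L) :=
  {e | 1 ≤ e.1 ∧ e.2.2.2 ∈ sent n A e.1 (execution n A e.1) e.2.1 e.2.2.1}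

/-- Process `i` has crashed or terminated by the beginning of round `r`. -/
def Retired {L : ℕ} (n : ℕ) (A : Crashes L) (r : ℕ) (i : Proc L) : Prop :=
  A.crashRound i < (r : ℕ∞) ∨ (execution n A r i).ctrl = .halted

end ProtocolC

/-! Three facts carry the theorem: at most one process is active at a time, the active process knows
at least as much as every other process that is not retired, and reports of units that are later
repeated go to different recipients.

Timing. By `span_step`, one more known unit or failure more than halves the waiting time, and a
further `K` rounds are gained. Hence the recipient of a report can wait out its deadline, and still
have a full `span` for its own activity, before any less informed process wakes. `Core` makes this
an invariant: the waiting processes form a chain in which more knowledge means an earlier deadline,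
with gaps of at least `span`, and the `potential` of the active process bounds how long it can be
busy, up to a slack of `K` rounds. As `potential` always exceeds `K`, nobody wakes while another
process is active. The initial deadlines are multiples of `span L n 0`, so everything is over by
`horizon`, half the bound of the theorem.

Pointers. A message can be lost with its recipient, and two pointers with the same round number may
differ, because failure detection moves a pointer without a new round number. The invariant
`Pointers` compares the pointers into one group by arcs of its cyclic order: a newer pointer has
passed only processes that are not waiting or have newer information. `Passed` says what failure
detection at a level achieves: every report of that level of which the process has not heard went to
a process that it knows to be retired. It follows that if two reports of one level go to the same
process `p`, whoever is active in the group after the first report knows of that report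
(`mem_history_of_report_twice`).

Counting. Detecting a failure at level `l` is treated like a unit of work at level `l`, real work
having level `0`. A performance is the last one of its unit within the group, or is followed by the
crash of the performer before the report is made, or is reported to some `p`. In the last case, if
the unit is repeated, `p` gets no later report of this level: otherwise the repeating process would
have known that the unit was done (`Performed.report_recipient_ne`). So real work is charged to `n`
units, `t` crashes and `t` recipients. Polls, replies and reports are charged in the same way at
each of the `log t` levels, which gives `4 t log t`, `t log t` and `n + 3 t log t`. -/

namespace ProtocolC

/-! ### Cyclic distances -/

/-- The number of steps from `a` to `b` on a cycle of length `s`. -/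
def cycDist (s a b : ℕ) : ℕ := if a ≤ b then b - a else b + s - a

theorem cycDist_self (s a : ℕ) : cycDist s a a = 0 := by simp [cycDist]

/-- Arcs are half-open. Wherever `b` lies, the arc from `a` to `c` is covered by the arcs from `a`
to `b` and from `b` to `c`; the comparison of pointers consists of such cuts. -/
theorem cycDist_tri {s a b c x : ℕ} (ha : a < s) (hb : b < s) (hc : c < s) (hx : x < s)
    (h : cycDist s a x < cycDist s a c) :
    cycDist s a x < cycDist s a b ∨ cycDist s b x < cycDist s b c := by
  unfold cycDist at *; split_ifs at * <;> omega

/-- Equal end points stand here for a full turn, which the distance `0` cannot express. -/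
theorem cycDist_tri_full {s a b c x : ℕ} (ha : a < s) (hb : b < s) (hc : c < s) (hx : x < s)
    (h : cycDist s a x < cycDist s a c ∨ c = a) :
    (cycDist s a x < cycDist s a b ∨ b = a) ∨ cycDist s b x < cycDist s b c := by
  unfold cycDist at *; split_ifs at * <;> omega

theorem cycDist_extend {s y z p x : ℕ} (hy : y < s) (hz : z < s) (hp : p < s) (_ : x < s)
    (h : cycDist s y z ≤ cycDist s y p) (h' : cycDist s z x ≤ cycDist s z p) :
    cycDist s y x ≤ cycDist s y p := by
  unfold cycDist at *; split_ifs at * <;> omega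

theorem cycDist_extend_lt {s y z p x : ℕ} (hy : y < s) (hz : z < s) (hp : p < s) (_ : x < s)
    (h : cycDist s y z ≤ cycDist s y p) (h' : cycDist s z x < cycDist s z p) :
    cycDist s y x < cycDist s y p := by
  unfold cycDist at *; split_ifs at * <;> omega

theorem cycDist_cover {s p x y : ℕ} (hp : p < s) (hx : x < s) (hy : y < s) :
    (cycDist s p x < cycDist s p y ∨ y = p) ∨ cycDist s y x < cycDist s y p := by
  unfold cycDist at *; split_ifs at * <;> omega

theorem cycDist_inj {s p x y : ℕ} (hp : p < s) (hx : x < s) (hy : y < s)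
    (h : cycDist s p x = cycDist s p y) : x = y := by
  unfold cycDist at *; split_ifs at * <;> omega

theorem cycDist_lt {s p x : ℕ} (hp : p < s) (hx : x < s) : cycDist s p x < s := by
  unfold cycDist; split_ifs <;> omega

theorem add_cycDist_mod {s p x : ℕ} (hp : p < s) (hx : x < s) : (p + cycDist s p x) % s = x := by
  unfold cycDist; split_ifs with h
  · rw [show p + (x - p) = x by omega, Nat.mod_eq_of_lt hx]
  · rw [show p + (x + s - p) = x + s by omega, Nat.add_mod_right, Nat.mod_eq_of_lt hx]

variable {L : ℕ}

theorem groupSize_pos (L h : ℕ) : 0 < groupSize L h := Nat.two_pow_pos _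

/-- The place of a process in its level-`h` group. -/
def pos (h : ℕ) (p : Proc L) : ℕ := (p : ℕ) % groupSize L h

theorem pos_lt (h : ℕ) (p : Proc L) : pos h p < groupSize L h := Nat.mod_lt _ (groupSize_pos L h)

theorem eq_of_pos_eq {h : ℕ} {p q : Proc L} (hg : groupIdx h p = groupIdx h q)
    (hp : pos h p = pos h q) : p = q := by
  apply Fin.ext
  rw [← Nat.div_add_mod (p : ℕ) (groupSize L h), ← Nat.div_add_mod (q : ℕ) (groupSize L h)]
  unfold groupIdx at hg
  unfold pos at hp
  rw [hg, hp]

/-- The number of steps from `p` to `q` in the cyclic order of a level-`h` group. -/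
def cd (h : ℕ) (p q : Proc L) : ℕ := cycDist (groupSize L h) (pos h p) (pos h q)

theorem cd_self (h : ℕ) (p : Proc L) : cd h p p = 0 := cycDist_self _ _

theorem cd_tri {h : ℕ} {a c x : Proc L} (b : Proc L) (hx : cd h a x < cd h a c) :
    cd h a x < cd h a b ∨ cd h b x < cd h b c :=
  cycDist_tri (pos_lt h _) (pos_lt h _) (pos_lt h _) (pos_lt h _) hx

theorem cd_tri_full {h : ℕ} {a b c x : Proc L} (hg : groupIdx h b = groupIdx h a)
    (hx : cd h a x < cd h a c ∨ c = a) :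
    (cd h a x < cd h a b ∨ b = a) ∨ cd h b x < cd h b c := by
  rcases cycDist_tri_full (s := groupSize L h) (a := pos h a) (b := pos h b) (c := pos h c)
    (x := pos h x) (pos_lt h _) (pos_lt h _) (pos_lt h _) (pos_lt h _)
    (hx.imp id fun e => by rw [e]) with (h1 | h1) | h1
  · exact Or.inl (Or.inl h1)
  · exact Or.inl (Or.inr (eq_of_pos_eq hg h1))
  · exact Or.inr h1

theorem cd_extend {h : ℕ} {y z p x : Proc L} (h1 : cd h y z ≤ cd h y p)
    (h2 : cd h z x ≤ cd h z p) : cd h y x ≤ cd h y p :=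
  cycDist_extend (pos_lt h _) (pos_lt h _) (pos_lt h _) (pos_lt h _) h1 h2

theorem cd_extend_lt {h : ℕ} {y z p x : Proc L} (h1 : cd h y z ≤ cd h y p)
    (h2 : cd h z x < cd h z p) : cd h y x < cd h y p :=
  cycDist_extend_lt (pos_lt h _) (pos_lt h _) (pos_lt h _) (pos_lt h _) h1 h2

theorem cd_cover {h : ℕ} {p y : Proc L} (x : Proc L) (hg : groupIdx h y = groupIdx h p) :
    (cd h p x < cd h p y ∨ y = p) ∨ cd h y x < cd h y p := by
  rcases cycDist_cover (pos_lt h p) (pos_lt h x) (pos_lt h y) with (h1 | h1) | h1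
  · exact Or.inl (Or.inl h1)
  · exact Or.inl (Or.inr (eq_of_pos_eq hg h1))
  · exact Or.inr h1

theorem cd_inj {h : ℕ} {p x y : Proc L} (hg : groupIdx h x = groupIdx h y)
    (he : cd h p x = cd h p y) : x = y :=
  eq_of_pos_eq hg (cycDist_inj (pos_lt h _) (pos_lt h _) (pos_lt h _) he)

theorem groupSize_dvd {h : ℕ} (h1 : 1 ≤ h) (hL : h ≤ L) : groupSize L h ∣ 2 ^ L :=
  pow_dvd_pow 2 (by omega)

theorem rotate_val {h : ℕ} (h1 : 1 ≤ h) (hL : h ≤ L) (p : Proc L) (k : ℕ) :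
    (rotate h p k : ℕ) = groupSize L h * groupIdx h p + (pos h p + k) % groupSize L h := by
  unfold rotate groupIdx pos
  simp only [Fin.ofNat]
  apply Nat.mod_eq_of_lt
  obtain ⟨c, hc⟩ := groupSize_dvd (L := L) h1 hL
  have hm := Nat.mod_lt ((p : ℕ) % groupSize L h + k) (groupSize_pos L h)
  have hp : (p : ℕ) / groupSize L h < c :=
    Nat.div_lt_of_lt_mul (hc ▸ p.isLt)
  have := Nat.mul_le_mul_left (groupSize L h) (Nat.succ_le_of_lt hp)
  rw [Nat.mul_succ, ← hc] at this
  omega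

theorem groupIdx_rotate {h : ℕ} (h1 : 1 ≤ h) (hL : h ≤ L) (p : Proc L) (k : ℕ) :
    groupIdx h (rotate h p k) = groupIdx h p := by
  conv_lhs => unfold groupIdx
  rw [rotate_val h1 hL, Nat.mul_add_div (groupSize_pos L h),
    Nat.div_eq_of_lt (Nat.mod_lt _ (groupSize_pos L h)), Nat.add_zero]

theorem pos_rotate {h : ℕ} (h1 : 1 ≤ h) (hL : h ≤ L) (p : Proc L) (k : ℕ) :
    pos h (rotate h p k) = (pos h p + k) % groupSize L h := by
  conv_lhs => unfold pos
  rw [rotate_val h1 hL, Nat.mul_add_mod, Nat.mod_mod]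

theorem rotate_cd {h : ℕ} (h1 : 1 ≤ h) (hL : h ≤ L) {p x : Proc L}
    (hg : groupIdx h x = groupIdx h p) : rotate h p (cd h p x) = x := by
  apply eq_of_pos_eq (h := h)
  · rw [groupIdx_rotate h1 hL, hg]
  · rw [pos_rotate h1 hL]
    exact add_cycDist_mod (pos_lt h _) (pos_lt h _)

theorem cd_rotate {h : ℕ} (h1 : 1 ≤ h) (hL : h ≤ L) (p : Proc L) {k : ℕ}
    (hk : k < groupSize L h) : cd h p (rotate h p k) = k := by
  have hp := pos_lt h p
  unfold cd
  rw [pos_rotate h1 hL]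
  rcases Nat.lt_or_ge (pos h p + k) (groupSize L h) with hlt | hge
  · rw [Nat.mod_eq_of_lt hlt]
    unfold cycDist; split_ifs <;> omega
  · rw [Nat.mod_eq_sub_mod hge, Nat.mod_eq_of_lt (by omega)]
    unfold cycDist; split_ifs <;> omega

theorem rotate_groupSize {h : ℕ} (h1 : 1 ≤ h) (hL : h ≤ L) (p : Proc L) :
    rotate h p (groupSize L h) = p := by
  apply eq_of_pos_eq (groupIdx_rotate h1 hL _ _)
  rw [pos_rotate h1 hL, Nat.add_mod_right, Nat.mod_eq_of_lt (pos_lt h p)]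

theorem cd_pos {h : ℕ} {p x : Proc L} (hg : groupIdx h x = groupIdx h p) (hx : x ≠ p) :
    0 < cd h p x := by
  rcases Nat.eq_zero_or_pos (cd h p x) with h0 | h0
  · exact absurd (cd_inj hg (h0.trans (cd_self h p).symm)) hx
  · exact h0

theorem cd_lt (h : ℕ) (p x : Proc L) : cd h p x < groupSize L h :=
  cycDist_lt (pos_lt h _) (pos_lt h _)

/-! ### Successors and targets -/

theorem successor_some {i : Proc L} {F : Finset (Proc L)} {h : ℕ} {p q : Proc L} (h1 : 1 ≤ h)
    (hL : h ≤ L) (hs : successor i F h p = some q) :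
    groupIdx h q = groupIdx h p ∧ (q ≠ i ∧ q ∉ F) ∧
      ∀ x, groupIdx h x = groupIdx h p → x ≠ p → cd h p x < cd h p q ∨ q = p → x = i ∨ x ∈ F := by
  unfold successor at hs
  rw [List.find?_map, Option.map_eq_some_iff] at hs
  obtain ⟨k, hk, rfl⟩ := hs
  rw [List.find?_range_eq_some] at hk
  obtain ⟨hok, hk, hmin⟩ := hk
  have hk' := List.mem_range.1 hk
  refine ⟨groupIdx_rotate h1 hL _ _, by simpa using hok, fun x hg hx hlt => ?_⟩
  have hx0 := cd_pos hg hx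
  have hlt' : cd h p x < k + 1 := by
    -- If the search succeeds only at its last place, it has made a full turn and found `p` itself;
    -- then the bound holds for every `x` of the group.
    rcases Nat.lt_or_ge (k + 1) (groupSize L h) with hk1 | hk1
    · rcases hlt with hlt | hlt
      · rwa [cd_rotate h1 hL p hk1] at hlt
      · have := cd_rotate h1 hL p hk1
        rw [hlt, cd_self] at this
        omega
    · exact lt_of_lt_of_le (cd_lt h p x) hk1
  have := hmin (cd h p x - 1) (by omega)
  simp only [Function.comp, show cd h p x - 1 + 1 = cd h p x by omega, rotate_cd h1 hL hg] at this
  simp only [Bool.not_eq_true', decide_eq_false_iff_not, not_and_or, not_not] at this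
  exact this

theorem successor_none {i : Proc L} {F : Finset (Proc L)} {h : ℕ} {p : Proc L} (h1 : 1 ≤ h)
    (hL : h ≤ L) (hs : successor i F h p = none) {x : Proc L}
    (hg : groupIdx h x = groupIdx h p) : x = i ∨ x ∈ F := by
  unfold successor at hs
  rw [List.find?_eq_none] at hs
  have : ∃ k < groupSize L h, rotate h p (k + 1) = x := by
    by_cases hx : x = p
    · refine ⟨groupSize L h - 1, by have := groupSize_pos L h; omega, ?_⟩
      rw [Nat.sub_add_cancel (groupSize_pos L h), rotate_groupSize h1 hL, hx]
    · have hx0 := cd_pos hg hx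
      have := cd_lt h p x
      exact ⟨cd h p x - 1, by omega, by
        rw [show cd h p x - 1 + 1 = cd h p x by omega, rotate_cd h1 hL hg]⟩
  obtain ⟨k, hk, rfl⟩ := this
  have := hs _ (List.mem_map_of_mem (List.mem_range.2 hk))
  rw [decide_eq_true_eq, not_and_or, not_not, not_not] at this
  exact this

/-- All pointers point into their groups. -/
def View.PointsOK (v : View L) : Prop :=
  ∀ h, 1 ≤ h → h ≤ L → ∀ x : Proc L, groupIdx h (v.point h (groupIdx h x)) = groupIdx h x

/-- Either the pointer is itself the target and the arc between them is empty, or the arc consists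
of the pointer, which is excluded, and of what the successor search skips. -/
theorem View.PointsOK.target_some {v : View L} (hv : v.PointsOK) {i q : Proc L} {h : ℕ}
    (h1 : 1 ≤ h) (hL : h ≤ L) (ht : v.target i h = some q) :
    groupIdx h q = groupIdx h i ∧ q ≠ i ∧ q ∉ v.faulty ∧
      ∀ x, groupIdx h x = groupIdx h i →
        cd h (v.point h (groupIdx h i)) x < cd h (v.point h (groupIdx h i)) q →
          x = i ∨ x ∈ v.faulty := by
  have hp := hv h h1 hL i
  simp only [View.target] at ht
  split_ifs at ht with hc
  · cases ht
    refine ⟨hp, hc.1, hc.2, fun x _ hlt => ?_⟩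
    rw [cd_self] at hlt
    omega
  · obtain ⟨hg, hok, hall⟩ := successor_some h1 hL ht
    refine ⟨hg.trans hp, hok.1, hok.2, fun x hx hlt => ?_⟩
    by_cases hxp : x = v.point h (groupIdx h i)
    · rw [hxp]; tauto
    · exact hall x (hx.trans hp.symm) hxp (Or.inl hlt)

theorem View.PointsOK.target_none {v : View L} (hv : v.PointsOK) {i : Proc L} {h : ℕ}
    (h1 : 1 ≤ h) (hL : h ≤ L) (ht : v.target i h = none) {x : Proc L}
    (hx : groupIdx h x = groupIdx h i) : x = i ∨ x ∈ v.faulty := by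
  simp only [View.target] at ht
  split_ifs at ht with hc
  exact successor_none h1 hL ht (hx.trans (hv h h1 hL i).symm)

/-! ### The effect of moving pointers -/

theorem View.advance_point_of_ne (v : View L) (i : Proc L) (h : ℕ) (p : Proc L) {h' k : ℕ}
    (hne : ¬(h' = h ∧ k = groupIdx h i)) : (v.advance i h p).point h' k = v.point h' k := by
  simp only [View.advance, if_neg hne]

theorem View.PointsOK.advance {v : View L} (hv : v.PointsOK) {i : Proc L} {h : ℕ} {p : Proc L}
    (hp : groupIdx h p = groupIdx h i) : (v.advance i h p).PointsOK := by
  intro h' h1 hL x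
  by_cases hne : h' = h ∧ groupIdx h' x = groupIdx h i
  · obtain ⟨rfl, hx⟩ := hne
    simp only [View.advance, hx, and_self, if_true]
    rcases hs : successor i v.faulty h' p with _ | q
    · exact hv h' h1 hL i
    · exact (successor_some h1 hL hs).1.trans hp
  · rw [View.advance_point_of_ne _ _ _ _ hne]
    exact hv h' h1 hL x

/-- Moving the pointer into `G^i_h` away from a process that cannot be polled skips only processes
that cannot be polled. -/
theorem View.PointsOK.advance_skip {v : View L} (hv : v.PointsOK) {i : Proc L} {h : ℕ}
    (h1 : 1 ≤ h) (hL : h ≤ L)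
    (hp : v.point h (groupIdx h i) = i ∨ v.point h (groupIdx h i) ∈ v.faulty) {x : Proc L}
    (hx : groupIdx h x = groupIdx h i)
    (hlt : cd h (v.point h (groupIdx h i)) x < cd h (v.point h (groupIdx h i))
      ((v.advance i h (v.point h (groupIdx h i))).point h (groupIdx h i))) :
    x = i ∨ x ∈ v.faulty := by
  by_cases hxp : x = v.point h (groupIdx h i)
  · rw [hxp]; exact hp
  simp only [View.advance, and_self, if_true] at hlt
  rcases hs : successor i v.faulty h (v.point h (groupIdx h i)) with _ | q
  · exact successor_none h1 hL hs (hx.trans (hv h h1 hL i).symm)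
  · rw [hs, Option.getD_some] at hlt
    exact (successor_some h1 hL hs).2.2 x (hx.trans (hv h h1 hL i).symm) hxp (Or.inl hlt)

/-- Moving the pointer into `G^i_h` past a process `q` that can be polled. -/
theorem View.advance_past {v : View L} {i q : Proc L} {h : ℕ} (h1 : 1 ≤ h) (hL : h ≤ L)
    (hg : groupIdx h q = groupIdx h i) (hq : q ≠ i ∧ q ∉ v.faulty) :
    groupIdx h ((v.advance i h q).point h (groupIdx h i)) = groupIdx h i ∧
    (v.advance i h q).point h (groupIdx h i) ≠ i ∧
    (v.advance i h q).point h (groupIdx h i) ∉ v.faulty ∧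
    ∀ x, groupIdx h x = groupIdx h i →
      cd h q x < cd h q ((v.advance i h q).point h (groupIdx h i)) ∨
        (v.advance i h q).point h (groupIdx h i) = q →
      x = q ∨ x = i ∨ x ∈ v.faulty := by
  simp only [View.advance, and_self, if_true]
  rcases hs : successor i v.faulty h q with _ | z
  · rcases successor_none h1 hL hs rfl with h0 | h0
    · exact absurd h0 hq.1
    · exact absurd h0 hq.2
  · obtain ⟨hz, hok, hall⟩ := successor_some h1 hL hs
    refine ⟨hz.trans hg, hok.1, hok.2, fun x hx hlt => ?_⟩
    by_cases hxq : x = q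
    · exact Or.inl hxq
    · exact Or.inr (hall x (hx.trans hg.symm) hxq hlt)

/-! ### Initial pointers and the structure of the groups -/

theorem groupIdx_of_val {h k m : ℕ} {p : Proc L} (hp : (p : ℕ) = groupSize L h * k + m)
    (hm : m < groupSize L h) : groupIdx h p = k := by
  unfold groupIdx
  rw [hp, Nat.mul_add_div (groupSize_pos L h), Nat.div_eq_of_lt hm, Nat.add_zero]

theorem initView_pointsOK (i : Proc L) : (initView i).PointsOK := by
  intro h h1 hL x
  have hs := groupSize_pos L h
  obtain ⟨c, hc⟩ := groupSize_dvd (L := L) h1 hL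
  -- A group has a second member, to which the pointer of its first member is set.
  have h2 : 2 ≤ groupSize L h := by
    unfold groupSize
    calc 2 = 2 ^ 1 := rfl
      _ ≤ _ := Nat.pow_le_pow_right (by norm_num) (by omega)
  have hx : groupIdx h x < c := Nat.div_lt_of_lt_mul (hc ▸ x.isLt)
  have hle := Nat.mul_le_mul_left (groupSize L h) (Nat.succ_le_of_lt hx)
  rw [Nat.mul_succ, ← hc] at hle
  simp only [initView]
  split_ifs
  · exact groupIdx_of_val (m := 1) (Nat.mod_eq_of_lt (by omega)) (by omega)
  · exact groupIdx_of_val (m := 0) (Nat.mod_eq_of_lt (by omega)) (by omega)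

theorem groupIdx_level_one (hL : 1 ≤ L) (x : Proc L) : groupIdx 1 x = 0 := by
  unfold groupIdx groupSize
  rw [Nat.sub_add_cancel hL]
  exact Nat.div_eq_of_lt x.isLt

/-- A group splits into two groups of the next level, with consecutive numbers; their parity is used
later to tell the halves apart. -/
theorem groupIdx_succ_div {h : ℕ} (hL : h + 1 ≤ L) (x : Proc L) :
    groupIdx (h + 1) x / 2 = groupIdx h x := by
  unfold groupIdx groupSize
  rw [Nat.div_div_eq_div_mul, ← pow_succ]
  congr 2
  omega

/-- A group of level `L` has just two elements. -/
theorem eq_of_groupIdx_top {x y z : Proc L} (hy : groupIdx L y = groupIdx L x)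
    (hz : groupIdx L z = groupIdx L x) (hyx : y ≠ x) (hzx : z ≠ x) : y = z := by
  apply Fin.ext
  rw [Ne, Fin.ext_iff] at hyx hzx
  simp only [groupIdx, groupSize, Nat.sub_self, zero_add, pow_one] at hy hz
  omega

/-! ### Views ordered by knowledge -/

/-- `w` knows everything that `v` knows (pointers apart). -/
def View.Le (v w : View L) : Prop :=
  v.faulty ⊆ w.faulty ∧ v.workPoint ≤ w.workPoint ∧ v.workRound ≤ w.workRound ∧
    (v.workRound = w.workRound → v.workPoint = w.workPoint) ∧ ∀ h k, v.round h k ≤ w.round h k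

theorem View.Le.refl (v : View L) : v.Le v :=
  ⟨Finset.Subset.refl _, le_rfl, le_rfl, fun _ => rfl, fun _ _ => le_rfl⟩

theorem View.Le.trans {u v w : View L} (h1 : u.Le v) (h2 : v.Le w) : u.Le w := by
  obtain ⟨a1, b1, c1, d1, e1⟩ := h1
  obtain ⟨a2, b2, c2, d2, e2⟩ := h2
  refine ⟨a1.trans a2, b1.trans b2, c1.trans c2, fun h => ?_, fun h k => (e1 h k).trans (e2 h k)⟩
  rw [d1 (by omega), d2 (by omega)]

/-- Merging with a larger view gives that view, except for the pointers into groups: on equal round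
numbers the own pointer is kept, and the two may differ. This is why `View.Le` ignores these
pointers and they need an invariant of their own. -/
theorem View.Le.merge_faulty {v w : View L} (h : v.Le w) : (v.merge w).faulty = w.faulty :=
  Finset.union_eq_right.2 h.1

theorem View.Le.merge_workPoint {v w : View L} (h : v.Le w) :
    (v.merge w).workPoint = w.workPoint := by
  obtain ⟨-, -, c, d, -⟩ := h
  simp only [View.merge]
  split_ifs with hlt
  · rfl
  -- The round numbers are equal, which is the case for which `View.Le` demands equal work pointers.
  · exact d (by omega)

theorem View.Le.merge_workRound {v w : View L} (h : v.Le w) :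
    (v.merge w).workRound = w.workRound := max_eq_right h.2.2.1

theorem View.Le.merge_round {v w : View L} (h : v.Le w) (g k : ℕ) :
    (v.merge w).round g k = w.round g k := max_eq_right (h.2.2.2.2 g k)

theorem View.Le.merge_reduced {v w : View L} (h : v.Le w) : (v.merge w).reduced = w.reduced := by
  simp only [View.reduced, h.merge_faulty, h.merge_workPoint]

theorem View.Le.merge_le {v w : View L} (h : v.Le w) : (v.merge w).Le w :=
  ⟨h.merge_faulty.le, h.merge_workPoint.le, h.merge_workRound.le, fun _ => h.merge_workPoint,
    fun g k => (h.merge_round g k).le⟩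

theorem View.Le.le_merge {v w : View L} (h : v.Le w) : w.Le (v.merge w) :=
  ⟨h.merge_faulty.ge, h.merge_workPoint.ge, h.merge_workRound.ge, fun _ => h.merge_workPoint.symm,
    fun g k => (h.merge_round g k).ge⟩

theorem View.PointsOK.merge {v w : View L} (hv : v.PointsOK) (hw : w.PointsOK) :
    (v.merge w).PointsOK := by
  intro h h1 hL x
  simp only [View.merge]
  split_ifs
  · exact hw h h1 hL x
  · exact hv h h1 hL x

/-- All round numbers in the view are less than `r`. -/
def View.Before (v : View L) (r : ℕ) : Prop := v.workRound < r ∧ ∀ h k, v.round h k < r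

theorem View.Before.mono {v : View L} {r r' : ℕ} (h : v.Before r) (hr : r ≤ r') : v.Before r' :=
  ⟨h.1.trans_le hr, fun g k => (h.2 g k).trans_le hr⟩

/-- What a process knows about the units of real work is consistent. -/
def View.WorkOK (n : ℕ) (v : View L) : Prop := 1 ≤ v.workPoint ∧ v.workPoint ≤ n + 1

theorem View.reduced_lt {n : ℕ} {v : View L} {i : Proc L} (hw : v.WorkOK n) (hi : i ∉ v.faulty) :
    v.reduced < n + 2 ^ L := by
  have : v.faulty.card < Fintype.card (Proc L) :=
    Finset.card_lt_univ_of_notMem hi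
  rw [Fintype.card_fin] at this
  unfold View.reduced
  have := hw.1
  have := hw.2
  omega

/-! ### Waiting times -/

/-- The waiting time that belongs to the reduced view `m` (of a process that has received an
ordinary message). -/
def span (L n m : ℕ) : ℕ := waitBound L * (n + 2 ^ L - m) * 2 ^ (n + 2 ^ L - 1 - m)

/-- The rounds that polling may take after a report: two for a reply at each level, two for each
failure, and a constant. -/
theorem waitBound_ge (L : ℕ) : 2 * L + 2 * 2 ^ L + 3 ≤ waitBound L := by
  have := Nat.one_le_two_pow (n := L)
  unfold waitBound
  omega

theorem waitBound_le_span {n m : ℕ} (hm : m < n + 2 ^ L) : waitBound L ≤ span L n m := by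
  unfold span
  have h1 : 1 ≤ n + 2 ^ L - m := by omega
  have h2 := Nat.one_le_two_pow (n := n + 2 ^ L - 1 - m)
  calc waitBound L = waitBound L * 1 * 1 := by ring
    _ ≤ _ := Nat.mul_le_mul (Nat.mul_le_mul_left _ h1) h2

/-- The reason for the form of the waiting times: the power of two supplies the factor `2`, the
linear factor the additional `waitBound L`. One copy of the smaller span is for the recipient of a
report to wait, the other for its own activity. -/
theorem span_step {n m : ℕ} (hm : m < n + 2 ^ L) :
    2 * span L n (m + 1) + waitBound L ≤ span L n m := by
  obtain ⟨k, hk⟩ : ∃ k, n + 2 ^ L = m + 1 + k := ⟨n + 2 ^ L - (m + 1), by omega⟩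
  unfold span
  rw [hk, show m + 1 + k - (m + 1) = k by omega, show m + 1 + k - 1 - (m + 1) = k - 1 by omega,
    show m + 1 + k - m = k + 1 by omega, show m + 1 + k - 1 - m = k by omega]
  rcases k with _ | k
  · simp
  · rw [Nat.add_sub_cancel, pow_succ]
    have := Nat.one_le_two_pow (n := k)
    nlinarith [Nat.zero_le (waitBound L * (k + 1) * 2 ^ k), Nat.zero_le (waitBound L),
      Nat.mul_le_mul_left (waitBound L) this]

theorem waitTime_of_pos {n m : ℕ} (i : Proc L) (hm : 1 ≤ m) : waitTime n i m = span L n m := by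
  unfold waitTime span
  rw [if_pos hm]

/-- At the start all reduced views are `0`, so the factor `2 ^ L - i` has to separate the deadlines.
-/
theorem waitTime_zero (n : ℕ) (i : Proc L) : waitTime n i 0 = (2 ^ L - (i : ℕ)) * span L n 0 := by
  unfold waitTime span
  rw [if_neg (by omega)]
  simp only [Nat.sub_zero]
  ring

/-! ### Control states -/

/-- The control state of an active process. -/
def Ctrl.IsActive : Ctrl L → Prop
  | .inactive _ => False
  | .halted => False
  | _ => True

/-- The level at which an active process continues: the current failure detection loop, or `0` for
real work. -/
def Ctrl.level : Ctrl L → ℕ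
  | .poll h _ => h
  | .await h _ => h
  | .report h _ => h - 1
  | _ => 0

/-- A bound for the number of rounds until everything an active process may cause is over. -/
def potential (n : ℕ) (v : View L) : Ctrl L → ℕ
  -- Two rounds for the reply at each remaining level and two for each process not known to be
  -- retired; `span` pays for what follows.
  | .poll h _ => 2 * h + 2 * (2 ^ L - v.faulty.card) + 2 + span L n v.reduced
  | .await h _ => 2 * h + 2 * (2 ^ L - v.faulty.card) + 1 + span L n v.reduced
  -- The reduced view counts the unit about to be reported, so `reduced - 1` belongs to the time
  -- before it; this span is at least twice the one given to the recipient.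
  | .report _ _ => 1 + span L n (v.reduced - 1)
  | .work _ => 2 + span L n v.reduced
  | _ => 0

/-- The relation between the view of a process and its control state. -/
def Ctrl.OK (n : ℕ) (i : Proc L) (v : View L) : Ctrl L → Prop
  | .poll h q => 1 ≤ h ∧ h ≤ L ∧ v.target i h = some q
  | .await h q => 1 ≤ h ∧ h ≤ L ∧ v.target i h = some q
  | .report h q => 1 ≤ h ∧ h ≤ L ∧ v.target i h = some q ∧ 1 ≤ v.reduced ∧
      -- The pointer of the level below moves only after the report, so it still stands at a process
      -- that is not to be polled. For `h = 1` the unit was real work and there is no such pointer.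
      (2 ≤ h → v.point (h - 1) (groupIdx (h - 1) i) = i ∨
        v.point (h - 1) (groupIdx (h - 1) i) ∈ v.faulty)
  | .work u => u = v.workPoint ∧ u ≤ n
  | _ => True

section enter

variable {n : ℕ} {i : Proc L} {v : View L}

theorem enter_active_or_halted (h : ℕ) : (enter n i v h).IsActive ∨ enter n i v h = .halted := by
  induction h with
  | zero =>
    unfold enter
    split_ifs
    · exact Or.inl trivial
    · exact Or.inr rfl
  | succ h ih =>
    unfold enter
    split
    · exact Or.inl trivial
    · exact ih

theorem enter_ok {h : ℕ} (hL : h ≤ L) : (enter n i v h).OK n i v := by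
  induction h with
  | zero =>
    unfold enter
    split_ifs with hw
    · exact ⟨rfl, hw⟩
    · exact trivial
  | succ h ih =>
    unfold enter
    split
    · exact ⟨by omega, hL, by assumption⟩
    · exact ih (by omega)

theorem enter_level_le (h : ℕ) : (enter n i v h).level ≤ h := by
  induction h with
  | zero =>
    unfold enter
    split_ifs <;> exact le_rfl
  | succ h ih =>
    unfold enter
    split
    · exact le_rfl
    · exact ih.trans (by omega)

theorem enter_skipped {h g : ℕ} (hg : (enter n i v h).level < g) (hgh : g ≤ h) :
    v.target i g = none := by
  induction h with
  | zero => omega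
  | succ h ih =>
    unfold enter at hg
    split at hg
    · simp only [Ctrl.level] at hg
      omega
    · rename_i hn
      rcases Nat.lt_or_ge h g with hlt | hge
      · rwa [show g = h + 1 by omega]
      · exact ih hg hge

theorem enter_potential {h : ℕ} (hh : (enter n i v h).IsActive) :
    potential n v (enter n i v h) ≤ 2 * h + 2 * (2 ^ L - v.faulty.card) + 2 + span L n v.reduced ∧
    (h = 0 → potential n v (enter n i v h) = 2 + span L n v.reduced) := by
  induction h with
  | zero =>
    rw [enter] at hh ⊢
    split_ifs at hh ⊢
    · refine ⟨?_, fun _ => rfl⟩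
      simp only [potential]
      omega
    · exact absurd hh id
  | succ h ih =>
    rw [enter] at hh ⊢
    split at hh
    · refine ⟨le_rfl, fun h0 => by omega⟩
    · have := ih hh
      exact ⟨by omega, fun h0 => by omega⟩

/-- `enter` never leads to `await` or `report`. -/
theorem enter_cases (h : ℕ) : (∃ g q, enter n i v h = .poll g q) ∨ (∃ u, enter n i v h = .work u) ∨
    enter n i v h = .halted := by
  induction h with
  | zero =>
    unfold enter
    split_ifs
    · exact Or.inr (Or.inl ⟨_, rfl⟩)
    · exact Or.inr (Or.inr rfl)
  | succ h ih =>
    unfold enter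
    split
    · exact Or.inl ⟨_, _, rfl⟩
    · exact ih

end enter

/-! ### One round of an active process -/

/-- The invariants that concern the view of a single process `i` at the beginning of round `r`. -/
structure View.Good (n r : ℕ) (i : Proc L) (v : View L) : Prop where
  before : v.Before r
  work : v.WorkOK n
  points : v.PointsOK
  self : i ∉ v.faulty

theorem View.Good.reduced_lt {n r : ℕ} {i : Proc L} {v : View L} (h : v.Good n r i) :
    v.reduced < n + 2 ^ L := View.reduced_lt h.work h.self

theorem View.Good.mono {n r r' : ℕ} {i : Proc L} {v : View L} (h : v.Good n r i) (hr : r ≤ r') :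
    v.Good n r' i := ⟨h.before.mono hr, h.work, h.points, h.self⟩

theorem View.Good.advance {n r : ℕ} {i : Proc L} {v : View L} (hv : v.Good n r i) {h : ℕ}
    {p : Proc L} (hp : groupIdx h p = groupIdx h i) : (v.advance i h p).Good n r i :=
  ⟨hv.before, hv.work, hv.points.advance hp, hv.self⟩

theorem View.Good.afterReport {n r : ℕ} {i : Proc L} {v : View L} (hv : v.Good n r i) {h : ℕ}
    {q : Proc L} (hq : groupIdx h q = groupIdx h i) :
    (ProtocolC.afterReport r i v h q).Good n (r + 1) i := by
  change ((v.setRound i h r).advance i h q).Good n (r + 1) i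
  refine View.Good.advance (v := v.setRound i h r) ⟨⟨hv.before.1.trans (Nat.lt_succ_self r), fun g k => ?_⟩, hv.work,
    hv.points, hv.self⟩ hq
  have := hv.before.2 g k
  simp only [View.setRound]
  split_ifs <;> omega

theorem View.Good.addFaulty {n r : ℕ} {i q : Proc L} {v : View L} (hv : v.Good n r i)
    (hq : q ≠ i) : (v.addFaulty q).Good n r i :=
  ⟨hv.before, hv.work, hv.points, by
    simp only [View.addFaulty, Finset.mem_insert, not_or]
    exact ⟨hq.symm, hv.self⟩⟩

theorem View.advance_le (v : View L) (i : Proc L) (h : ℕ) (p : Proc L) : v.Le (v.advance i h p) :=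
  View.Le.refl v

theorem View.le_addFaulty (v : View L) (q : Proc L) : v.Le (v.addFaulty q) :=
  ⟨Finset.subset_insert _ _, le_rfl, le_rfl, fun _ => rfl, fun _ _ => le_rfl⟩

theorem View.le_afterReport {v : View L} {r : ℕ} (hv : v.Before r) (i : Proc L) (h : ℕ)
    (q : Proc L) : v.Le (afterReport r i v h q) := by
  refine ⟨Finset.Subset.refl _, le_rfl, le_rfl, fun _ => rfl, fun g k => ?_⟩
  simp only [ProtocolC.afterReport, View.advance, View.setRound]
  split_ifs
  · exact (hv.2 g k).le
  · exact le_rfl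

/-- The effect of performing the unit of work `u` in round `r`. -/
def View.workDone (v : View L) (r u : ℕ) : View L := { v with workPoint := u + 1, workRound := r }

theorem View.le_workDone {v : View L} {r : ℕ} (hv : v.Before r) :
    v.Le (v.workDone r v.workPoint) :=
  ⟨Finset.Subset.refl _, Nat.le_succ _, hv.1.le, fun h => absurd h hv.1.ne, fun _ _ => le_rfl⟩

theorem View.Good.workDone {n r : ℕ} {i : Proc L} {v : View L} (hv : v.Good n r i)
    (hu : v.workPoint ≤ n) : (v.workDone r v.workPoint).Good n (r + 1) i :=
  ⟨⟨Nat.lt_succ_self r, (hv.before.mono (Nat.le_succ r)).2⟩,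
    ⟨Nat.le_add_left _ _, Nat.succ_le_succ hu⟩, hv.points, hv.self⟩

theorem View.reduced_addFaulty {v : View L} {q : Proc L} (hq : q ∉ v.faulty) :
    (v.addFaulty q).reduced = v.reduced + 1 := by
  simp only [View.reduced, View.addFaulty, Finset.card_insert_of_notMem hq]
  omega

theorem View.card_addFaulty {v : View L} {q : Proc L} (hq : q ∉ v.faulty) :
    (v.addFaulty q).faulty.card = v.faulty.card + 1 := Finset.card_insert_of_notMem hq

theorem View.reduced_workDone {n : ℕ} {v : View L} (hv : v.WorkOK n) (r : ℕ) :
    (v.workDone r v.workPoint).reduced = v.reduced + 1 := by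
  have := hv.1
  simp only [View.reduced, View.workDone]
  omega

/-- What one round of the code does with the state of an active process. -/
structure ExecSpec (n r : ℕ) (i : Proc L) (replied : Proc L → Bool) (v : View L) (a : Ctrl L)
    (x : View L × Ctrl L) : Prop where
  good : x.1.Good n (r + 1) i
  active : x.2.IsActive ∨ x.2 = .halted
  ok : x.2.OK n i x.1
  le : v.Le x.1
  new_faulty : ∀ z ∈ x.1.faulty, z ∈ v.faulty ∨ ∃ h, a = .await h z ∧ replied z = false
  level_le : x.2.level ≤ a.level
  potential_lt : x.2.IsActive → (∀ h q, a ≠ .report h q) →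
    potential n x.1 x.2 + 1 ≤ potential n v a
  await_of : ∀ h q, x.2 = .await h q → a = .poll h q

/-- What one round does with the state of an active process that sends an ordinary message. -/
structure ReportSpec (n r : ℕ) (i : Proc L) (v : View L) (h : ℕ) (q : Proc L)
    (x : View L × Ctrl L) : Prop where
  le : (afterReport r i v h q).Le x.1
  potential_le : x.2.IsActive →
    potential n x.1 x.2 ≤ 2 * L + 2 * 2 ^ L + 2 + span L n v.reduced

theorem potential_await (n : ℕ) (v : View L) (h : ℕ) (q : Proc L) :
    potential n v (.await h q) = 2 * h + 2 * (2 ^ L - v.faulty.card) + 1 + span L n v.reduced := rfl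

theorem potential_report (n : ℕ) (v : View L) (h : ℕ) (q : Proc L) :
    potential n v (.report h q) = 1 + span L n (v.reduced - 1) := rfl

theorem resume_ok {n r : ℕ} {i : Proc L} {v : View L} (hv : v.Good n r i) {h : ℕ} (h1 : 1 ≤ h)
    (hL : h ≤ L) : (resume n i v h).1.Good n r i ∧
      ((resume n i v h).2.IsActive ∨ (resume n i v h).2 = .halted) ∧
      (resume n i v h).2.OK n i (resume n i v h).1 ∧ v.Le (resume n i v h).1 ∧
      (resume n i v h).1.faulty = v.faulty ∧ (resume n i v h).2.level ≤ h ∧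
      ((resume n i v h).2.IsActive → potential n (resume n i v h).1 (resume n i v h).2 ≤
        2 * h + 2 * (2 ^ L - v.faulty.card) + 2 + span L n v.reduced) ∧
      ∀ g q, (resume n i v h).2 ≠ .await g q := by
  refine ⟨hv.advance (hv.points h h1 hL i), enter_active_or_halted h, enter_ok hL,
    View.advance_le _ _ _ _, rfl, enter_level_le h, fun ha => (enter_potential ha).1,
    fun g q hgq => ?_⟩
  rcases enter_cases (n := n) (i := i) (v := (resume n i v h).1) h with ⟨_, _, h0⟩ | ⟨_, h0⟩ | h0 <;>
    · rw [show (resume n i v h).2 = enter n i (resume n i v h).1 h from rfl, h0] at hgq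
      cases hgq

theorem enter_ne_await {n : ℕ} {i : Proc L} {v : View L} {h g : ℕ} {q : Proc L} :
    enter n i v h ≠ .await g q := by
  intro hgq
  rcases enter_cases (n := n) (i := i) (v := v) h with ⟨_, _, h0⟩ | ⟨_, h0⟩ | h0 <;>
    · rw [h0] at hgq
      cases hgq

theorem report_spec {n r : ℕ} {i : Proc L} {replied : Proc L → Bool} {v : View L}
    (hv : v.Good n r i) {h : ℕ} {q : Proc L} (hok : (Ctrl.report h q).OK n i v) :
    ExecSpec n r i replied v (.report h q) (execute n r i replied v (.report h q)) ∧
    ReportSpec n r i v h q (execute n r i replied v (.report h q)) := by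
  obtain ⟨h1, hL, ht, hred, -⟩ := hok
  obtain ⟨hq, -⟩ := hv.points.target_some h1 hL ht
  have hg := hv.afterReport hq (r := r)
  have hle := View.le_afterReport hv.before i h q
  simp only [execute]
  have hb : 2 ^ L - (afterReport r i v h q).faulty.card ≤ 2 ^ L := Nat.sub_le _ _
  split_ifs with h0
  · subst h0
    refine ⟨⟨hg, enter_active_or_halted (i := i) 0, enter_ok (Nat.zero_le _), hle, fun z hz => Or.inl hz,
      enter_level_le (i := i) 0, fun _ h2 => absurd rfl (h2 _ _), fun g p h2 => ?_⟩,
      ⟨View.Le.refl _, fun ha => ?_⟩⟩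
    · exact absurd h2 enter_ne_await
    · have := (enter_potential ha).1
      rw [show (afterReport r i v 1 q).reduced = v.reduced from rfl] at this
      exact this.trans (by omega)
  · obtain ⟨a1, a2, a3, a4, a5, a6, a7, a8⟩ := resume_ok hg (h := h - 1) (by omega) (by omega)
    refine ⟨⟨a1, a2, a3, hle.trans a4, fun z hz => Or.inl ?_, a6,
      fun _ h2 => absurd rfl (h2 _ _), fun g p h2 => absurd h2 (a8 g p)⟩,
      ⟨a4, fun ha => (a7 ha).trans ?_⟩⟩
    · rw [a5] at hz
      exact hz
    · rw [show (afterReport r i v h q).reduced = v.reduced from rfl]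
      omega

theorem work_spec {n r : ℕ} {i : Proc L} {replied : Proc L → Bool} {v : View L}
    (hv : v.Good n r i) {u : ℕ} (hok : (Ctrl.work u).OK n i v) :
    ExecSpec n r i replied v (.work u) (execute n r i replied v (.work u)) := by
  obtain ⟨rfl, hn⟩ := hok
  have hg := hv.workDone (r := r) hn
  have hle := View.le_workDone hv.before
  have hred := View.reduced_workDone hv.work r
  have hs := span_step hv.reduced_lt
  have hK := waitBound_ge L
  have key : ExecSpec n r i replied v (.work v.workPoint)
      (v.workDone r v.workPoint, enter n i (v.workDone r v.workPoint) 0) := by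
    refine ⟨hg, enter_active_or_halted (i := i) 0, enter_ok (Nat.zero_le _), hle, fun z hz => Or.inl hz,
      enter_level_le (i := i) 0, fun ha _ => ?_, fun g p h2 => absurd h2 enter_ne_await⟩
    rw [(enter_potential ha).2 rfl, hred]
    simp only [potential]
    omega
  simp only [execute]
  rw [show ({ v with workPoint := v.workPoint + 1, workRound := r } : View L) =
    v.workDone r v.workPoint from rfl]
  split_ifs with hL1
  · split
    · rename_i p hp
      refine ⟨hg, Or.inl trivial, ⟨le_rfl, hL1, hp, (Nat.le_add_left 1 _).trans hred.ge, fun h2 => by omega⟩, hle,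
        fun z hz => Or.inl hz, le_rfl, fun _ _ => ?_, fun g p h2 => by cases h2⟩
      simp only [potential, hred, Nat.add_sub_cancel]
      omega
    · exact key
  · exact key

theorem poll_spec {n r : ℕ} {i : Proc L} {replied : Proc L → Bool} {v : View L}
    (hv : v.Good n r i) {h : ℕ} {q : Proc L} (hok : (Ctrl.poll h q).OK n i v) :
    ExecSpec n r i replied v (.poll h q) (execute n r i replied v (.poll h q)) := by
  refine ⟨hv.mono (Nat.le_succ r), Or.inl trivial, hok, View.Le.refl _, fun z hz => Or.inl hz,
    le_rfl, fun _ _ => ?_, fun g p h2 => ?_⟩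
  · simp only [execute, potential]
    omega
  · simp only [execute, Ctrl.await.injEq] at h2
    rw [h2.1, h2.2]

theorem await_spec {n r : ℕ} {i : Proc L} {replied : Proc L → Bool} {v : View L}
    (hv : v.Good n r i) {h : ℕ} {q : Proc L} (hok : (Ctrl.await h q).OK n i v) :
    ExecSpec n r i replied v (.await h q) (execute n r i replied v (.await h q)) := by
  obtain ⟨h1, hL, ht⟩ := hok
  obtain ⟨hqg, hqi, hqF, hbef⟩ := hv.points.target_some h1 hL ht
  have hv' := (hv.addFaulty hqi).mono (Nat.le_succ r)
  have hred := View.reduced_addFaulty hqF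
  have hcard := View.card_addFaulty hqF
  have hs := span_step hv.reduced_lt
  have hK := waitBound_ge L
  -- The pointer stood at `q`, which is now known to be retired, or at a process that was skipped to
  -- reach `q`.
  have hpt : v.point h (groupIdx h i) = i ∨ v.point h (groupIdx h i) ∈ (v.addFaulty q).faulty := by
    simp only [View.target] at ht
    split_ifs at ht with hc
    · right
      cases ht
      exact Finset.mem_insert_self _ _
    · simp only [View.addFaulty, Finset.mem_insert]
      tauto
  have hcl : (v.addFaulty q).faulty.card < 2 ^ L := by
    have := Finset.card_lt_univ_of_notMem hv'.self
    rwa [Fintype.card_fin] at this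
  simp only [execute]
  split_ifs with hr h0
  · refine ⟨hv.mono (Nat.le_succ r), enter_active_or_halted _, enter_ok (by omega),
      View.Le.refl _, fun z hz => Or.inl hz, (enter_level_le _).trans (Nat.sub_le _ _),
      fun ha _ => ?_, fun g p h2 => absurd h2 enter_ne_await⟩
    have := (enter_potential ha).1
    rw [potential_await]
    dsimp only
    omega
  all_goals
    have hnew : ∀ z ∈ (v.addFaulty q).faulty,
        z ∈ v.faulty ∨ ∃ g, Ctrl.await h q = .await g z ∧ replied z = false := by
      intro z hz
      rcases Finset.mem_insert.1 hz with rfl | hz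
      · exact Or.inr ⟨h, rfl, by simpa using hr⟩
      · exact Or.inl hz
    have key : ExecSpec n r i replied v (.await h q) (resume n i (v.addFaulty q) h) := by
      obtain ⟨a1, a2, a3, a4, a5, a6, a7, a8⟩ := resume_ok (n := n) hv' h1 hL
      refine ⟨a1, a2, a3, (View.le_addFaulty v q).trans a4, fun z hz => hnew z (a5 ▸ hz), a6,
        fun ha _ => ?_, fun g p h2 => absurd h2 (a8 g p)⟩
      have := a7 ha
      rw [hred, hcard] at this
      rw [potential_await]
      omega
  · exact key
  · split
    · rename_i p hp
      refine ⟨hv', Or.inl trivial, ⟨by omega, by omega, hp, (Nat.le_add_left 1 _).trans hred.ge, fun _ => hpt⟩,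
        View.le_addFaulty v q, hnew, le_rfl, fun _ _ => ?_, fun g p h2 => by cases h2⟩
      simp only [potential, hred, Nat.add_sub_cancel]
      omega
    · exact key

theorem execute_spec {n r : ℕ} {i : Proc L} {replied : Proc L → Bool} {v : View L} {a : Ctrl L}
    (hv : v.Good n r i) (ha : a.IsActive) (hok : a.OK n i v) :
    ExecSpec n r i replied v a (execute n r i replied v a) := by
  cases a with
  | inactive d => exact absurd ha id
  | halted => exact absurd ha id
  | poll h q => exact poll_spec hv hok
  | await h q => exact await_spec hv hok
  | report h q => exact (report_spec hv hok).1
  | work u => exact work_spec hv hok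

/-! ### One round of the system -/

/-- The configuration after the processes whose deadline has come have become active. -/
def wakeAll (n r : ℕ) (c : Config L) : Config L := fun i => wake n r i (c i)

/-- What `i` sends to `q` in round `r` is not prevented by a crash. -/
def Sends (A : Crashes L) (r : ℕ) (i q : Proc L) : Prop :=
  (r : ℕ∞) < A.crashRound i ∨ ((r : ℕ∞) = A.crashRound i ∧ A.lastSend i q = true)

/-- In round `r`, `s` sends to `q` an ordinary message that belongs to level `h`. -/
def Reports (A : Crashes L) (r : ℕ) (c : Config L) (h : ℕ) (s q : Proc L) : Prop :=
  (c s).ctrl = .report h q ∧ Sends A r s q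

/-- Process `i` is not retired at the beginning of round `r`. -/
def Alive (A : Crashes L) (r : ℕ) (c : Config L) (i : Proc L) : Prop :=
  (r : ℕ∞) ≤ A.crashRound i ∧ (c i).ctrl ≠ .halted

/-- Process `i` is not retired and waits for its deadline `d`. -/
def Waits (A : Crashes L) (r : ℕ) (c : Config L) (i : Proc L) (d : ℕ) : Prop :=
  (r : ℕ∞) ≤ A.crashRound i ∧ (c i).ctrl = .inactive d

/-- Process `i` is active at the beginning of round `r`. -/
def Active (A : Crashes L) (r : ℕ) (c : Config L) (i : Proc L) : Prop :=
  (r : ℕ∞) ≤ A.crashRound i ∧ (c i).ctrl.IsActive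

/-- Process `i` gets a reply from `q` in round `r`. -/
def replied (n : ℕ) (A : Crashes L) (r : ℕ) (c : Config L) (i q : Proc L) : Bool :=
  (sent n A r c q i).any Msg.isReply

/-- The views that `i` receives in round `r`. -/
def inViews (n : ℕ) (A : Crashes L) (r : ℕ) (c : Config L) (i : Proc L) : List (View L) :=
  (List.finRange (2 ^ L)).flatMap fun j => (sent n A r c j i).filterMap Msg.view?

/-- The causal histories after a round: `H i` is the set of the rounds of the ordinary messages
which `i` has sent or about which it may have learnt. -/
def nextHist (A : Crashes L) (r : ℕ) (c : Config L) (H : Proc L → Set ℕ) (i : Proc L) : Set ℕ :=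
  {a | a ∈ H i ∨ (a = r ∧ ∃ h q, (c i).ctrl = .report h q) ∨
    ∃ s h, Reports A r c h s i ∧ (a ∈ H s ∨ a = r)}

section

variable {n r : ℕ} {A : Crashes L} {c : Config L} {H : Proc L → Set ℕ}

theorem Sends.le {i q : Proc L} (h : Sends A r i q) : (r : ℕ∞) ≤ A.crashRound i :=
  h.elim le_of_lt fun h => h.1.le

theorem Active.alive {i : Proc L} (h : Active A r c i) : Alive A r c i :=
  ⟨h.1, fun h0 => by have := h.2; rw [h0] at this; exact this⟩

theorem Waits.alive {i : Proc L} {d : ℕ} (h : Waits A r c i d) : Alive A r c i :=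
  ⟨h.1, fun h0 => by have := h.2; rw [h0] at this; cases this⟩

theorem Waits.not_active {i : Proc L} {d : ℕ} (h : Waits A r c i d) : ¬Active A r c i := fun h0 => by
  have := h0.2
  rw [h.2] at this
  exact this

theorem Alive.active_or_waits {i : Proc L} (h : Alive A r c i) :
    Active A r c i ∨ ∃ d, Waits A r c i d := by
  cases hc : (c i).ctrl with
  | inactive d => exact Or.inr ⟨d, h.1, hc⟩
  | halted => exact absurd hc h.2
  | _ => exact Or.inl ⟨h.1, by rw [hc]; trivial⟩

theorem Reports.active {h : ℕ} {s q : Proc L} (hr : Reports A r c h s q) : Active A r c s :=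
  ⟨hr.2.le, by rw [hr.1]; trivial⟩

theorem wakeAll_view (i : Proc L) : (wakeAll n r c i).view = (c i).view := by
  unfold wakeAll wake
  split
  · split_ifs <;> rfl
  · rfl

theorem wakeAll_polledBy (i : Proc L) : (wakeAll n r c i).polledBy = (c i).polledBy := by
  unfold wakeAll wake
  split
  · split_ifs <;> rfl
  · rfl

theorem wakeAll_ctrl (i : Proc L) : ((wakeAll n r c i).ctrl = (c i).ctrl ∧
      ∀ d, (c i).ctrl = .inactive d → r < d) ∨
    ∃ d, d ≤ r ∧ (c i).ctrl = .inactive d ∧ (wakeAll n r c i).ctrl = enter n i (c i).view L := by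
  unfold wakeAll wake
  split
  · rename_i d hd
    split_ifs with h
    · exact Or.inr ⟨d, h, hd, rfl⟩
    · refine Or.inl ⟨rfl, fun d' hd' => ?_⟩
      rw [hd] at hd'
      cases hd'
      omega
  · rename_i hd
    exact Or.inl ⟨rfl, fun d' hd' => absurd hd' (hd d')⟩

theorem lt_of_waits_wakeAll {i : Proc L} {d : ℕ} (h : Waits A r (wakeAll n r c) i d) : r < d := by
  rcases wakeAll_ctrl (n := n) (r := r) (c := c) i with ⟨h1, h2⟩ | ⟨d', -, -, h3⟩
  · exact h2 d (h1 ▸ h.2)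
  · rcases enter_active_or_halted (n := n) (i := i) (v := (c i).view) L with h4 | h4
    · rw [← h3, h.2] at h4
      exact absurd h4 id
    · rw [← h3, h.2] at h4
      cases h4

theorem sent_eq (i q : Proc L) [Decidable (Sends A r i q)] : sent n A r c i q =
    if Sends A r i q then outbox r i (wakeAll n r c i) q else [] := by
  unfold sent Sends
  congr

theorem mem_outbox {i q : Proc L} {s : LocalState L} {m : Msg L} : m ∈ outbox r i s q ↔
    (m = .reply ∧ s.ctrl ≠ .halted ∧ q ∈ s.polledBy) ∨
    (m = .areYouAlive ∧ ∃ h, s.ctrl = .poll h q) ∨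
    ∃ h, s.ctrl = .report h q ∧ m = .ordinary (afterReport r i s.view h q) := by
  unfold outbox
  split <;> rename_i hc
  · simp [hc]
  · rename_i h p
    simp only [List.mem_append, List.mem_ite_nil_right, List.mem_singleton, hc]
    constructor
    · rintro (⟨h1, h2⟩ | ⟨rfl, h2⟩)
      · exact Or.inl ⟨h2, by simp, h1⟩
      · exact Or.inr (Or.inl ⟨h2, h, rfl⟩)
    · rintro (⟨h1, -, h2⟩ | ⟨h1, g, h2⟩ | ⟨g, h2, -⟩)
      · exact Or.inl ⟨h2, h1⟩
      · cases h2
        exact Or.inr ⟨rfl, h1⟩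
      · cases h2
  · rename_i h p
    simp only [List.mem_append, List.mem_ite_nil_right, List.mem_singleton, hc]
    constructor
    · rintro (⟨h1, h2⟩ | ⟨rfl, h2⟩)
      · exact Or.inl ⟨h2, by simp, h1⟩
      · exact Or.inr (Or.inr ⟨h, rfl, h2⟩)
    · rintro (⟨h1, -, h2⟩ | ⟨h1, g, h2⟩ | ⟨g, h2, h3⟩)
      · exact Or.inl ⟨h2, h1⟩
      · cases h2
      · cases h2
        exact Or.inr ⟨rfl, h3⟩
  · rename_i hh hp
    simp only [List.mem_ite_nil_right, List.mem_singleton]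
    constructor
    · rintro ⟨h1, h2⟩
      exact Or.inl ⟨h2, fun h0 => hh h0, h1⟩
    · rintro (⟨h1, -, h2⟩ | ⟨h1, g, h2⟩ | ⟨g, h2, h3⟩)
      · exact ⟨h2, h1⟩
      · exact absurd h2 (hp g q)
      · exact absurd h2 (hc g q)

theorem mem_sent {i q : Proc L} {m : Msg L} : m ∈ sent n A r c i q ↔ Sends A r i q ∧
    ((m = .reply ∧ (wakeAll n r c i).ctrl ≠ .halted ∧ q ∈ (c i).polledBy) ∨
    (m = .areYouAlive ∧ ∃ h, (wakeAll n r c i).ctrl = .poll h q) ∨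
    ∃ h, (wakeAll n r c i).ctrl = .report h q ∧ m = .ordinary (afterReport r i (c i).view h q)) := by
  classical
  rw [sent_eq, List.mem_ite_nil_right, mem_outbox, wakeAll_polledBy, wakeAll_view]

theorem replied_iff {i q : Proc L} : replied n A r c i q = true ↔
    Sends A r q i ∧ (wakeAll n r c q).ctrl ≠ .halted ∧ i ∈ (c q).polledBy := by
  unfold replied
  rw [List.any_eq_true]
  constructor
  · rintro ⟨m, hm, hr⟩
    obtain ⟨h1, ⟨-, h2⟩ | ⟨rfl, -⟩ | ⟨h, -, rfl⟩⟩ := mem_sent.1 hm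
    · exact ⟨h1, h2⟩
    · cases hr
    · cases hr
  · rintro ⟨h1, h2⟩
    exact ⟨.reply, mem_sent.2 ⟨h1, Or.inl ⟨rfl, h2⟩⟩, rfl⟩

theorem isPoll_any_sent {i q : Proc L} : (sent n A r c i q).any Msg.isPoll = true ↔
    Sends A r i q ∧ ∃ h, (wakeAll n r c i).ctrl = .poll h q := by
  rw [List.any_eq_true]
  constructor
  · rintro ⟨m, hm, hr⟩
    obtain ⟨h1, ⟨rfl, -⟩ | ⟨-, h2⟩ | ⟨h, -, rfl⟩⟩ := mem_sent.1 hm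
    · cases hr
    · exact ⟨h1, h2⟩
    · cases hr
  · rintro ⟨h1, h2⟩
    exact ⟨.areYouAlive, mem_sent.2 ⟨h1, Or.inr (Or.inl ⟨rfl, h2⟩)⟩, rfl⟩

theorem filterMap_view_sent_nil {i q : Proc L} (h : ∀ g, ¬Reports A r (wakeAll n r c) g i q) :
    (sent n A r c i q).filterMap Msg.view? = [] := by
  rw [List.filterMap_eq_nil_iff]
  intro m hm
  obtain ⟨h1, ⟨rfl, -⟩ | ⟨rfl, -⟩ | ⟨g, h2, rfl⟩⟩ := mem_sent.1 hm
  · rfl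
  · rfl
  · exact absurd ⟨h2, h1⟩ (h g)

theorem filterMap_view_sent {h : ℕ} {i q : Proc L} (hr : Reports A r (wakeAll n r c) h i q) :
    (sent n A r c i q).filterMap Msg.view? = [afterReport r i (c i).view h q] := by
  classical
  rw [sent_eq, if_pos hr.2]
  unfold outbox
  rw [hr.1, wakeAll_view]
  simp only [if_true, List.filterMap_append]
  split_ifs <;> rfl

theorem inViews_nil {q : Proc L} (h : ∀ g s, ¬Reports A r (wakeAll n r c) g s q) :
    inViews n A r c q = [] := by
  unfold inViews
  rw [List.flatMap_eq_nil_iff]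
  exact fun s _ => filterMap_view_sent_nil fun g => h g s

theorem flatMap_eq_of_unique {α β : Type*} {l : List α} {f : α → List β} {a : α} (hl : l.Nodup)
    (ha : a ∈ l) (hf : ∀ b ∈ l, b ≠ a → f b = []) : l.flatMap f = f a := by
  induction l with
  | nil => cases ha
  | cons x l ih =>
    rw [List.flatMap_cons]
    rw [List.nodup_cons] at hl
    by_cases hx : x = a
    · subst hx
      rw [List.flatMap_eq_nil_iff.2, List.append_nil]
      intro b hb
      exact hf b (List.mem_cons_of_mem _ hb) fun e => hl.1 (e ▸ hb)
    · rw [hf x List.mem_cons_self hx, List.nil_append]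
      refine ih hl.2 ?_ fun b hb => hf b (List.mem_cons_of_mem _ hb)
      rcases List.mem_cons.1 ha with h | h
      · exact absurd h.symm hx
      · exact h

theorem inViews_single {h : ℕ} {s q : Proc L} (hr : Reports A r (wakeAll n r c) h s q)
    (hu : ∀ g j, Reports A r (wakeAll n r c) g j q → j = s) :
    inViews n A r c q = [afterReport r s (c s).view h q] := by
  unfold inViews
  rw [flatMap_eq_of_unique (List.nodup_finRange _) (List.mem_finRange s) fun b _ hb =>
    filterMap_view_sent_nil fun g hg => hb (hu g b hg), filterMap_view_sent hr]

theorem step_eq (i : Proc L) :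
    ((step n A r c i).view, (step n A r c i).ctrl) = receive n r i (inViews n A r c i)
      (execute n r i (replied n A r c i) (c i).view (wakeAll n r c i).ctrl) := by
  rw [← wakeAll_view (n := n) (r := r) (c := c)]
  rfl

theorem receive_nil (i : Proc L) (x : View L × Ctrl L) : receive n r i [] x = x := by
  obtain ⟨v, a⟩ := x
  cases a <;> rfl

/-- A process to which no ordinary message is sent just executes its code. -/
theorem step_no_message {i : Proc L} (h : ∀ g s, ¬Reports A r (wakeAll n r c) g s i) :
    ((step n A r c i).view, (step n A r c i).ctrl) =
      execute n r i (replied n A r c i) (c i).view (wakeAll n r c i).ctrl := by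
  rw [step_eq, inViews_nil h, receive_nil]

theorem nextHist_no_message {i : Proc L} (h : ∀ g s, ¬Reports A r c g s i)
    (h' : ∀ g q, (c i).ctrl ≠ .report g q) : nextHist A r c H i = H i := by
  ext a
  simp only [nextHist, Set.mem_ofPred_eq]
  constructor
  · rintro (h0 | ⟨-, g, q, h0⟩ | ⟨s, g, h0, -⟩)
    · exact h0
    · exact absurd h0 (h' g q)
    · exact absurd h0 (h g s)
  · exact Or.inl

theorem step_halted {i : Proc L} (h : (wakeAll n r c i).ctrl = .halted) :
    (step n A r c i).ctrl = .halted := by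
  have := step_eq (n := n) (A := A) (r := r) (c := c) i
  rw [h] at this
  exact (Prod.ext_iff.1 this).2

theorem wakeAll_halted {i : Proc L} (h : (c i).ctrl = .halted) :
    (wakeAll n r c i).ctrl = .halted := by
  rcases wakeAll_ctrl (n := n) (r := r) (c := c) i with ⟨h1, -⟩ | ⟨d, -, h2, -⟩
  · rw [h1, h]
  · rw [h] at h2
    cases h2

theorem lt_crash_of_alive_succ {i : Proc L} {c' : Config L} (h : Alive A (r + 1) c' i) :
    (r : ℕ∞) < A.crashRound i :=
  lt_of_lt_of_le (by exact_mod_cast Nat.lt_succ_self r) h.1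

theorem Alive.of_step {i : Proc L} (h : Alive A (r + 1) (step n A r c) i) :
    Alive A r (wakeAll n r c) i :=
  ⟨(lt_crash_of_alive_succ h).le, fun h0 => h.2 (step_halted h0)⟩

theorem Alive.of_wakeAll {i : Proc L} (h : Alive A r (wakeAll n r c) i) : Alive A r c i :=
  ⟨h.1, fun h0 => h.2 (wakeAll_halted h0)⟩

theorem step_waits {i : Proc L} {d : ℕ} (hw : Waits A r (wakeAll n r c) i d)
    (h : ∀ g s, ¬Reports A r (wakeAll n r c) g s i) :
    (step n A r c i).view = (c i).view ∧ (step n A r c i).ctrl = .inactive d := by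
  have := step_no_message h
  rw [hw.2] at this
  exact Prod.ext_iff.1 this

theorem step_receives {h d : ℕ} {s q : Proc L} (hw : Waits A r (wakeAll n r c) q d)
    (hr : Reports A r (wakeAll n r c) h s q)
    (hu : ∀ g j, Reports A r (wakeAll n r c) g j q → j = s) :
    (step n A r c q).view = (c q).view.merge (afterReport r s (c s).view h q) ∧
    (step n A r c q).ctrl = .inactive
      (r + waitTime n q ((c q).view.merge (afterReport r s (c s).view h q)).reduced) := by
  have := step_eq (n := n) (A := A) (r := r) (c := c) q
  rw [hw.2, inViews_single hr hu] at this
  exact Prod.ext_iff.1 this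

end

/-! ### The knowledge of the processes and their deadlines -/

/-- The round by which everything is over. -/
def horizon (L n : ℕ) : ℕ := 2 ^ L * span L n 0

/-- Process `j` with deadline `d` knows more than `k` with deadline `e`, and becomes active long
before it. -/
def Precedes (n : ℕ) (c : Config L) (H : Proc L → Set ℕ) (j : Proc L) (d : ℕ) (k : Proc L)
    (e : ℕ) : Prop :=
  d + span L n (c j).view.reduced ≤ e ∧ (c k).view.Le (c j).view ∧ H k ⊆ H j

/-- At most one process is active, it knows more than the others, and the others wait long
enough. -/
structure Core (n : ℕ) (A : Crashes L) (r : ℕ) (c : Config L) (H : Proc L → Set ℕ) : Prop where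
  good : ∀ i, Alive A r c i → (c i).view.Good n r i
  ok : ∀ i, Active A r c i → (c i).ctrl.OK n i (c i).view
  -- The poll has arrived; hence a missing reply proves retirement.
  polled : ∀ i h q, Alive A r c i → (c i).ctrl = .await h q → i ∈ (c q).polledBy
  sound : ∀ i q, Alive A r c i → q ∈ (c i).view.faulty → ¬Alive A r c q
  hist : ∀ i a, Alive A r c i → a ∈ H i → a < r
  single : ∀ i j, Active A r c i → Active A r c j → i = j
  below : ∀ i j, Active A r c i → Alive A r c j → (c j).view.Le (c i).view ∧ H j ⊆ H i
  -- The process with the earlier deadline knows more, and the gap leaves room for its activity.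
  chain : ∀ j d k e, Waits A r c j d → Waits A r c k e → j ≠ k →
    Precedes n c H j d k e ∨ Precedes n c H k e j d
  deadline : ∀ j d, Waits A r c j d → r ≤ d
  time : ∀ i k d, Active A r c i → Waits A r c k d →
    r + potential n (c i).view (c i).ctrl ≤ d + waitBound L
  -- No slack is needed here: a recipient deadline plus its span amounts to two small spans, which
  -- `span_step` bounds with `waitBound L` to spare.
  waits_end : ∀ j d, Waits A r c j d → d + span L n (c j).view.reduced ≤ horizon L n
  active_end : ∀ i, Active A r c i →
    r + potential n (c i).view (c i).ctrl ≤ horizon L n + waitBound L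

/-- The slack in `Core.time` is smaller than the potential, so a deadline cannot fall due while a
process is active. -/
theorem waitBound_lt_potential {n : ℕ} {v : View L} {a : Ctrl L} (ha : a.IsActive)
    (hv : v.reduced < n + 2 ^ L) : waitBound L < potential n v a := by
  have h1 := waitBound_le_span hv
  have h2 : waitBound L ≤ span L n (v.reduced - 1) := waitBound_le_span (by omega)
  cases a with
  | inactive d => exact absurd ha id
  | halted => exact absurd ha id
  | _ => simp only [potential]; omega

section

variable {n r : ℕ} {A : Crashes L} {c : Config L} {H : Proc L → Set ℕ}

theorem Waits.of_wakeAll {i : Proc L} {d : ℕ} (h : Waits A r (wakeAll n r c) i d) :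
    Waits A r c i d := by
  refine ⟨h.1, ?_⟩
  rcases wakeAll_ctrl (n := n) (r := r) (c := c) i with ⟨h1, -⟩ | ⟨d', -, -, h3⟩
  · rw [← h1, h.2]
  · rcases enter_active_or_halted (n := n) (i := i) (v := (c i).view) L with h4 | h4
    · rw [← h3, h.2] at h4
      exact absurd h4 id
    · rw [← h3, h.2] at h4
      cases h4

theorem Core.active_wakeAll (hc : Core n A r c H) {i : Proc L}
    (h : Active A r (wakeAll n r c) i) :
    (Active A r c i ∧ (wakeAll n r c i).ctrl = (c i).ctrl) ∨
      (Waits A r c i r ∧ (wakeAll n r c i).ctrl = enter n i (c i).view L) := by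
  rcases wakeAll_ctrl (n := n) (r := r) (c := c) i with ⟨h1, -⟩ | ⟨d, h1, h2, h3⟩
  · exact Or.inl ⟨⟨h.1, h1 ▸ h.2⟩, h1⟩
  · have hw : Waits A r c i d := ⟨h.1, h2⟩
    have := hc.deadline i d hw
    obtain rfl : d = r := by omega
    exact Or.inr ⟨hw, h3⟩

theorem Core.not_waits_of_active (hc : Core n A r c H) {i j : Proc L} (hi : Active A r c i)
    (hj : Waits A r c j r) : False := by
  have h1 := hc.time i j r hi hj
  have h2 := waitBound_lt_potential hi.2 (hc.good i hi.alive).reduced_lt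
  omega

theorem Core.span_pos (hc : Core n A r c H) {i : Proc L} (hi : Alive A r c i) :
    0 < span L n (c i).view.reduced := by
  have h1 := waitBound_le_span (hc.good i hi).reduced_lt
  have h2 := waitBound_ge L
  omega

/-- In the opposite order, the deadline `e` would lie a positive span before the present round. -/
theorem Core.precedes_of_due (hc : Core n A r c H) {j k : Proc L} {e : ℕ} (hj : Waits A r c j r)
    (hk : Waits A r c k e) (hne : j ≠ k) : Precedes n c H j r k e := by
  rcases hc.chain j r k e hj hk hne with h | h
  · exact h
  · have h1 := hc.deadline k e hk
    have h2 := hc.span_pos hk.alive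
    have h3 := h.1
    omega

theorem Core.wake (hc : Core n A r c H) : Core n A r (wakeAll n r c) H where
  good i hi := by
    rw [wakeAll_view]
    exact hc.good i hi.of_wakeAll
  ok i hi := by
    rw [wakeAll_view]
    rcases hc.active_wakeAll hi with ⟨h1, h2⟩ | ⟨h1, h2⟩
    · rw [h2]
      exact hc.ok i h1
    · rw [h2]
      exact enter_ok le_rfl
  polled i h q hi hq := by
    rw [wakeAll_polledBy]
    rcases hc.active_wakeAll (i := i) ⟨hi.1, by rw [hq]; trivial⟩ with ⟨h1, h2⟩ | ⟨h1, h2⟩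
    · exact hc.polled i h q h1.alive (by rw [← h2, hq])
    · rw [hq] at h2
      exact absurd h2.symm enter_ne_await
  sound i q hi hq hq' := by
    rw [wakeAll_view] at hq
    exact hc.sound i q hi.of_wakeAll hq hq'.of_wakeAll
  hist i a hi ha := hc.hist i a hi.of_wakeAll ha
  single i j hi hj := by
    rcases hc.active_wakeAll hi with ⟨h1, -⟩ | ⟨h1, -⟩ <;>
      rcases hc.active_wakeAll hj with ⟨h2, -⟩ | ⟨h2, -⟩
    · exact hc.single i j h1 h2
    · exact (hc.not_waits_of_active h1 h2).elim
    · exact (hc.not_waits_of_active h2 h1).elim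
    · by_contra hne
      have h3 := (hc.precedes_of_due h1 h2 hne).1
      have h4 := hc.span_pos h1.alive
      omega
  below i j hi hj := by
    rw [wakeAll_view, wakeAll_view]
    rcases hc.active_wakeAll hi with ⟨h1, -⟩ | ⟨h1, -⟩
    · exact hc.below i j h1 hj.of_wakeAll
    · by_cases hij : i = j
      · subst hij
        exact ⟨View.Le.refl _, Set.Subset.rfl⟩
      · rcases hj.of_wakeAll.active_or_waits with h2 | ⟨d, h2⟩
        · exact (hc.not_waits_of_active h2 h1).elim
        · exact (hc.precedes_of_due h1 h2 hij).2
  chain j d k e hj hk hne := by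
    have := hc.chain j d k e hj.of_wakeAll hk.of_wakeAll hne
    unfold Precedes at *
    rwa [wakeAll_view, wakeAll_view]
  deadline j d hj := hc.deadline j d hj.of_wakeAll
  time i k d hi hk := by
    rw [wakeAll_view]
    rcases hc.active_wakeAll hi with ⟨h1, h2⟩ | ⟨h1, h2⟩
    · rw [h2]
      exact hc.time i k d h1 hk.of_wakeAll
    · have ha := hi.2
      rw [h2] at ha ⊢
      have h3 := (enter_potential ha).1
      have hne : i ≠ k := by
        rintro rfl
        exact hk.not_active hi
      have h4 := (hc.precedes_of_due h1 hk.of_wakeAll hne).1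
      have h5 := waitBound_ge L
      omega
  waits_end j d hj := by
    rw [wakeAll_view]
    exact hc.waits_end j d hj.of_wakeAll
  active_end i hi := by
    rw [wakeAll_view]
    rcases hc.active_wakeAll hi with ⟨h1, h2⟩ | ⟨h1, h2⟩
    · rw [h2]
      exact hc.active_end i h1
    · have ha := hi.2
      rw [h2] at ha ⊢
      have h3 := (enter_potential ha).1
      have h4 := hc.waits_end i r h1
      have h5 := waitBound_ge L
      omega

/-! ### Preservation by a round -/

/-- Only the active process sends ordinary messages, and its target is never itself. -/
theorem Core.no_message_to_active (hc : Core n A r (wakeAll n r c) H) {i : Proc L}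
    (hi : Active A r (wakeAll n r c) i) : ∀ g s, ¬Reports A r (wakeAll n r c) g s i := by
  intro g s hs
  obtain rfl := hc.single s i hs.active hi
  have hok := hc.ok s hi
  rw [hs.1] at hok
  exact ((hc.good s hi.alive).points.target_some hok.1 hok.2.1 hok.2.2.1).2.1 rfl

theorem Core.step_active (hc : Core n A r (wakeAll n r c) H) {i : Proc L}
    (hi : Active A r (wakeAll n r c) i) :
    ((step n A r c i).view, (step n A r c i).ctrl) =
      execute n r i (replied n A r c i) (c i).view (wakeAll n r c i).ctrl ∧
    ExecSpec n r i (replied n A r c i) (c i).view (wakeAll n r c i).ctrl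
      ((step n A r c i).view, (step n A r c i).ctrl) := by
  have h1 := step_no_message (hc.no_message_to_active hi)
  refine ⟨h1, ?_⟩
  rw [h1]
  have h2 := hc.good i hi.alive
  have h3 := hc.ok i hi
  rw [wakeAll_view] at h2 h3
  exact execute_spec h2 hi.2 h3

theorem Core.step_report (hc : Core n A r (wakeAll n r c) H) {i : Proc L}
    (hi : Active A r (wakeAll n r c) i) {h : ℕ} {q : Proc L}
    (hr : (wakeAll n r c i).ctrl = .report h q) :
    ReportSpec n r i (c i).view h q ((step n A r c i).view, (step n A r c i).ctrl) ∧
      1 ≤ (c i).view.reduced ∧ 2 * span L n (c i).view.reduced + waitBound L ≤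
        span L n ((c i).view.reduced - 1) := by
  have h1 := step_no_message (hc.no_message_to_active hi)
  have h2 := hc.good i hi.alive
  have h3 := hc.ok i hi
  rw [wakeAll_view] at h2 h3
  rw [hr] at h1 h3
  rw [h1]
  have h4 := span_step (L := L) (n := n) (m := (c i).view.reduced - 1)
    (by have := h2.reduced_lt; omega)
  have h5 : 1 ≤ (c i).view.reduced := h3.2.2.2.1
  rw [Nat.sub_add_cancel h5] at h4
  exact ⟨(report_spec h2 h3).2, h5, h4⟩

/-- A process that waits after a round waited before it; it may have received one message. -/
theorem Core.waits_of_step (hc : Core n A r (wakeAll n r c) H) {j : Proc L} {d' : ℕ}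
    (hj : Waits A (r + 1) (step n A r c) j d') : ∃ d, Waits A r (wakeAll n r c) j d ∧
      ((d' = d ∧ (step n A r c j).view = (c j).view ∧ nextHist A r (wakeAll n r c) H j = H j ∧
        ∀ g s, ¬Reports A r (wakeAll n r c) g s j) ∨
      ∃ g s, Reports A r (wakeAll n r c) g s j ∧
        (c j).view.Le (afterReport r s (c s).view g j) ∧
        (step n A r c j).view = (c j).view.merge (afterReport r s (c s).view g j) ∧
        (step n A r c j).view.reduced = (c s).view.reduced ∧
        d' = r + span L n (c s).view.reduced ∧
        nextHist A r (wakeAll n r c) H j = insert r (H s)) := by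
  have hS := hj.alive.of_step
  rcases hS.active_or_waits with ha | ⟨d, hw⟩
  · have := (hc.step_active ha).2.active
    rw [hj.2] at this
    rcases this with h | h
    · exact absurd h id
    · cases h
  · refine ⟨d, hw, ?_⟩
    by_cases hr : ∃ g s, Reports A r (wakeAll n r c) g s j
    · right
      obtain ⟨g, s, hr⟩ := hr
      have hu : ∀ g' i, Reports A r (wakeAll n r c) g' i j → i = s :=
        fun g' i h => hc.single i s h.active hr.active
      obtain ⟨h1, h2⟩ := step_receives hw hr hu
      obtain ⟨hle, hH⟩ := hc.below s j hr.active hw.alive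
      rw [wakeAll_view, wakeAll_view] at hle
      have hg := hc.good s hr.active.alive
      rw [wakeAll_view] at hg
      have hle' := hle.trans (View.le_afterReport hg.before s g j)
      obtain ⟨-, hpos, -⟩ := hc.step_report hr.active hr.1
      have hred : ((c j).view.merge (afterReport r s (c s).view g j)).reduced =
        (c s).view.reduced := hle'.merge_reduced
      refine ⟨g, s, hr, hle', h1, by rw [h1, hred], ?_, ?_⟩
      · rw [hj.2, hred, waitTime_of_pos j hpos] at h2
        cases h2
        rfl
      · ext a
        simp only [nextHist, Set.mem_ofPred_eq, Set.mem_insert_iff]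
        constructor
        · rintro (h0 | ⟨-, g, q, h0⟩ | ⟨s', g, h0, h3⟩)
          · exact Or.inr (hH h0)
          · rw [hw.2] at h0
            cases h0
          · rw [hu g s' h0] at h3
            exact h3.symm
        · exact fun h0 => Or.inr (Or.inr ⟨s, g, hr, h0.symm⟩)
    · left
      have hr' : ∀ g s, ¬Reports A r (wakeAll n r c) g s j := fun g s h => hr ⟨g, s, h⟩
      obtain ⟨h1, h2⟩ := step_waits hw hr'
      refine ⟨?_, h1, nextHist_no_message hr' fun g q h => ?_, hr'⟩
      · rw [hj.2] at h2
        cases h2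
        rfl
      · rw [hw.2] at h
        cases h

theorem Active.of_step {i : Proc L}
    (hi : Active A (r + 1) (step n A r c) i) : Active A r (wakeAll n r c) i := by
  rcases hi.alive.of_step.active_or_waits with ha | ⟨d, hw⟩
  · exact ha
  · have := step_eq (n := n) (A := A) (r := r) (c := c) i
    rw [hw.2] at this
    have h2 := (Prod.ext_iff.1 this).2
    have h3 := hi.2
    simp only [receive, execute] at h2
    rw [h2] at h3
    exact absurd h3 id

theorem subset_nextHist (i : Proc L) : H i ⊆ nextHist A r c H i := fun _ => Or.inl

theorem mem_nextHist_of_report {i : Proc L} {h : ℕ} {q : Proc L}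
    (hr : (c i).ctrl = .report h q) : r ∈ nextHist A r c H i := Or.inr (Or.inl ⟨rfl, h, q, hr⟩)

theorem Core.step (hc : Core n A r (wakeAll n r c) H) :
    Core n A (r + 1) (step n A r c) (nextHist A r (wakeAll n r c) H) := by
  have hsame : ∀ {g s j g' s' j'}, Reports A r (wakeAll n r c) g s j →
      Reports A r (wakeAll n r c) g' s' j' → s = s' ∧ g = g' ∧ j = j' := by
    intro g s j g' s' j' h h'
    obtain rfl := hc.single s s' h.active h'.active
    have := h.1.symm.trans h'.1
    cases this
    exact ⟨rfl, rfl, rfl⟩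
  have hK := waitBound_ge L
  -- Each round uses up at least one unit of potential. A report is treated separately: it passes
  -- from the span of the old reduced view to that of the new one, less than half as long.
  have htime : ∀ {i}, Active A (r + 1) (ProtocolC.step n A r c) i → ∀ {b},
      r + potential n (c i).view (wakeAll n r c i).ctrl ≤ b + waitBound L →
      r + 1 + potential n (ProtocolC.step n A r c i).view (ProtocolC.step n A r c i).ctrl ≤
        b + waitBound L := by
    intro i hi b hb
    have ha := Active.of_step hi
    obtain ⟨-, hex⟩ := hc.step_active ha
    by_cases hr : ∃ h q, (wakeAll n r c i).ctrl = .report h q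
    · obtain ⟨h, q, hr⟩ := hr
      obtain ⟨h1, h2, h3⟩ := hc.step_report ha hr
      have h4 := h1.potential_le hi.2
      rw [hr, potential_report] at hb
      dsimp only at h4
      omega
    · have := hex.potential_lt hi.2 fun h q e => hr ⟨h, q, e⟩
      dsimp only at this
      omega
  refine ⟨?_, ?_, ?_, ?_, ?_, ?_, ?_, ?_, ?_, ?_, ?_, ?_⟩
  · intro i hi
    rcases hi.active_or_waits with ha | ⟨d, hw⟩
    · exact (hc.step_active (Active.of_step ha)).2.good
    · have hg := hc.good i hi.of_step
      rw [wakeAll_view] at hg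
      obtain ⟨e, he, ⟨-, hv, -, -⟩ | ⟨g, s, hr, hle, hv, -⟩⟩ := hc.waits_of_step hw
      · rw [hv]
        exact hg.mono (Nat.le_succ r)
      · have hgs := hc.good s hr.active.alive
        have hok := hc.ok s hr.active
        rw [hr.1] at hok
        rw [wakeAll_view] at hgs hok
        have hgw := hgs.afterReport (r := r) (hgs.points.target_some hok.1 hok.2.1 hok.2.2.1).1
        rw [hv]
        refine ⟨⟨?_, fun g k => ?_⟩, ?_, hg.points.merge hgw.points, ?_⟩
        · rw [hle.merge_workRound]
          exact hgw.before.1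
        · rw [hle.merge_round]
          exact hgw.before.2 g k
        · unfold View.WorkOK
          rw [hle.merge_workPoint]
          exact hgw.work
        · rw [hle.merge_faulty]
          intro h0
          refine hc.sound s i hr.active.alive ?_ hi.of_step
          rw [wakeAll_view]
          exact h0
  · intro i hi
    exact (hc.step_active (Active.of_step hi)).2.ok
  · intro i h q hi hq
    have ha := Active.of_step (i := i) ⟨hi.1, by rw [hq]; trivial⟩
    have := (hc.step_active ha).2.await_of h q hq
    simp only [ProtocolC.step, Finset.mem_filter, Finset.mem_univ, true_and]
    rw [isPoll_any_sent]
    exact ⟨Or.inl (lt_crash_of_alive_succ hi), h, this⟩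
  · intro i q hi hq hq'
    have hS := hc.sound i q hi.of_step
    rw [wakeAll_view] at hS
    rcases hi.active_or_waits with ha | ⟨d, hw⟩
    · rcases (hc.step_active (Active.of_step ha)).2.new_faulty q hq with h0 | ⟨h, h0, h1⟩
      · exact hS h0 hq'.of_step
      · have h2 := hc.polled i h q hi.of_step h0
        rw [wakeAll_polledBy] at h2
        -- Had `q` survived the round, it would have answered.
        have h3 : replied n A r c i q = true :=
          replied_iff.2 ⟨Or.inl (lt_crash_of_alive_succ hq'), hq'.of_step.2, h2⟩
        rw [h1] at h3
        cases h3
    · obtain ⟨e, he, ⟨-, hv, -, -⟩ | ⟨g, s, hr, hle, hv, -⟩⟩ := hc.waits_of_step hw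
      · rw [hv] at hq
        exact hS hq hq'.of_step
      · rw [hv, hle.merge_faulty] at hq
        refine hc.sound s q hr.active.alive ?_ hq'.of_step
        rw [wakeAll_view]
        exact hq
  · intro i a hi ha
    rcases ha with h0 | ⟨rfl, -⟩ | ⟨s, h, hr, h0 | rfl⟩
    · exact (hc.hist i a hi.of_step h0).trans (Nat.lt_succ_self r)
    · exact Nat.lt_succ_self _
    · exact (hc.hist s a hr.active.alive h0).trans (Nat.lt_succ_self r)
    · exact Nat.lt_succ_self _
  · exact fun i j hi hj => hc.single i j (Active.of_step hi) (Active.of_step hj)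
  · intro i j hi hj
    have ha := Active.of_step hi
    obtain ⟨-, hex⟩ := hc.step_active ha
    rcases hj.active_or_waits with hj' | ⟨d, hw⟩
    · obtain rfl := hc.single i j ha (Active.of_step hj')
      exact ⟨View.Le.refl _, Set.Subset.rfl⟩
    · obtain ⟨hle0, hH⟩ := hc.below i j ha hj.of_step
      rw [wakeAll_view, wakeAll_view] at hle0
      obtain ⟨e, he, ⟨-, hv, hH', -⟩ | ⟨g, s, hr, hle, hv, -, -, hH'⟩⟩ := hc.waits_of_step hw
      · rw [hv, hH']
        exact ⟨hle0.trans hex.le, hH.trans (subset_nextHist i)⟩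
      · obtain rfl := hc.single s i hr.active ha
        rw [hv, hH']
        refine ⟨hle.merge_le.trans (hc.step_report ha hr.1).1.le, ?_⟩
        exact Set.insert_subset (mem_nextHist_of_report hr.1) (subset_nextHist s)
  -- The recipient of the report comes before every process that received none: by `time`, the
  -- deadline of such a process is at least two spans of the new reduced view away, and the
  -- recipient uses only one for waiting.
  · have key : ∀ j d k e, Waits A (r + 1) (ProtocolC.step n A r c) k e → ∀ g s,
        (∀ g s, ¬Reports A r (wakeAll n r c) g s k) →
        Reports A r (wakeAll n r c) g s j → d = r + span L n (c s).view.reduced →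
        (ProtocolC.step n A r c j).view.reduced = (c s).view.reduced →
        (c j).view.Le (afterReport r s (c s).view g j) →
        (ProtocolC.step n A r c j).view = (c j).view.merge (afterReport r s (c s).view g j) →
        nextHist A r (wakeAll n r c) H j = insert r (H s) →
        Precedes n (ProtocolC.step n A r c) (nextHist A r (wakeAll n r c) H) j d k e := by
      intro j d k e hk g s hn hr hd hred hle hv hH
      obtain ⟨e', he', ⟨rfl, hvk, hHk, -⟩ | ⟨g', s', hr', -⟩⟩ := hc.waits_of_step hk
      · obtain ⟨hle0, hH0⟩ := hc.below s k hr.active he'.alive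
        have ht := hc.time s k e hr.active he'
        obtain ⟨-, h2, h3⟩ := hc.step_report hr.active hr.1
        rw [hr.1] at ht
        rw [wakeAll_view] at ht hle0
        rw [wakeAll_view] at hle0
        have hgs := hc.good s hr.active.alive
        rw [wakeAll_view] at hgs
        simp only [potential] at ht
        refine ⟨by rw [hred, hd]; omega, ?_, ?_⟩
        · rw [hvk, hv]
          exact hle0.trans ((View.le_afterReport hgs.before s g j).trans hle.le_merge)
        · rw [hHk, hH]
          exact hH0.trans (Set.subset_insert _ _)
      · exact absurd hr' (hn g' s')
    intro j d k e hj hk hne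
    obtain ⟨dj, hdj, ⟨rfl, hvj, hHj, hnj⟩ | ⟨g, s, hr, hle, hv, hred, hd, hH⟩⟩ := hc.waits_of_step hj
    · obtain ⟨dk, hdk, ⟨rfl, hvk, hHk, -⟩ | ⟨g, s, hr, hle, hv, hred, hd, hH⟩⟩ :=
        hc.waits_of_step hk
      · have := hc.chain j d k e hdj hdk hne
        unfold Precedes at *
        rwa [hvj, hvk, hHj, hHk, ← wakeAll_view (n := n) (r := r) (c := c) j,
          ← wakeAll_view (n := n) (r := r) (c := c) k]
      · exact Or.inr (key k e j d hj g s hnj hr hd hred hle hv hH)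
    · refine Or.inl (key j d k e hk g s (fun g' s' hr' => ?_) hr hd hred hle hv hH)
      exact hne (hsame hr hr').2.2
  · intro j d hj
    obtain ⟨e, he, ⟨rfl, -⟩ | ⟨g, s, hr, -, -, -, hd, -⟩⟩ := hc.waits_of_step hj
    · exact lt_of_waits_wakeAll he
    · have := hc.span_pos hr.active.alive
      rw [wakeAll_view] at this
      omega
  · intro i k d hi hk
    have ha := Active.of_step hi
    obtain ⟨e, he, ⟨rfl, -⟩ | ⟨g, s, hr, -, -, -, hd, -⟩⟩ := hc.waits_of_step hk
    · have := hc.time i k d ha he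
      rw [wakeAll_view] at this
      exact htime hi this
    · obtain rfl := hc.single s i hr.active ha
      have := (hc.step_report ha hr.1).1.potential_le hi.2
      simp only at this
      omega
  · intro j d hj
    obtain ⟨e, he, ⟨rfl, hv, -⟩ | ⟨g, s, hr, -, -, hred, hd, -⟩⟩ := hc.waits_of_step hj
    · have := hc.waits_end j d he
      rwa [hv, ← wakeAll_view (n := n) (r := r) (c := c) j]
    · have h1 := hc.active_end s hr.active
      obtain ⟨-, h2, h3⟩ := hc.step_report hr.active hr.1
      rw [hr.1, wakeAll_view] at h1
      simp only [potential] at h1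
      rw [hred]
      omega
  · intro i hi
    have := hc.active_end i (Active.of_step hi)
    rw [wakeAll_view] at this
    exact htime hi this

end

/-! ### The invariant holds in all rounds -/

/-- The causal histories at the beginning of round `r`. -/
def history (n : ℕ) (A : Crashes L) : ℕ → Proc L → Set ℕ
  | 0 => fun _ => ∅
  | 1 => fun _ => ∅
  | r + 2 => nextHist A (r + 1) (wakeAll n (r + 1) (execution n A (r + 1))) (history n A (r + 1))

theorem initView_le (i j : Proc L) : (initView i).Le (initView j) :=
  ⟨Finset.Subset.refl _, le_rfl, le_rfl, fun _ => rfl, fun _ _ => le_rfl⟩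

theorem initConfig_waits {n r d : ℕ} {A : Crashes L} {i : Proc L}
    (h : Waits A r (initConfig L n) i d) : (i : ℕ) ≠ 0 ∧ d = (2 ^ L - (i : ℕ)) * span L n 0 := by
  have h2 := h.2
  unfold initConfig at h2
  simp only at h2
  split_ifs at h2 with h0
  · rcases enter_active_or_halted (n := n) (i := i) (v := initView i) L with h4 | h4
    · rw [h2] at h4
      exact absurd h4 id
    · rw [h2] at h4
      cases h4
  · rw [waitTime_zero] at h2
    cases h2
    exact ⟨h0, rfl⟩

theorem initConfig_active {n r : ℕ} {A : Crashes L} {i : Proc L}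
    (h : Active A r (initConfig L n) i) : (i : ℕ) = 0 ∧
      (initConfig L n i).ctrl = enter n i (initView i) L := by
  have h2 := h.2
  by_cases h0 : (i : ℕ) = 0
  · exact ⟨h0, by simp [initConfig, h0]⟩
  · simp [initConfig, h0, Ctrl.IsActive] at h2

theorem core_init (n : ℕ) (A : Crashes L) : Core n A 1 (initConfig L n) fun _ => ∅ := by
  have hred : ∀ i : Proc L, (initConfig L n i).view.reduced = 0 := fun i => rfl
  have hN : 0 < n + 2 ^ L := by have := Nat.one_le_two_pow (n := L); omega
  have hs := waitBound_le_span (L := L) (n := n) (m := 0) hN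
  have hK := waitBound_ge L
  have hpot : ∀ i, Active A 1 (initConfig L n) i → 1 + potential n (initConfig L n i).view
      (initConfig L n i).ctrl ≤ span L n 0 + waitBound L := by
    intro i hi
    have h1 := hi.2
    rw [(initConfig_active hi).2] at h1 ⊢
    have h2 := (enter_potential h1).1
    rw [show (initView i).reduced = 0 from rfl] at h2
    have h3 : potential n (initConfig L n i).view (enter n i (initView i) L) ≤ _ := h2
    omega
  have hmul : ∀ {i : Proc L} {k : ℕ}, (i : ℕ) ≤ k → span L n 0 ≤ (2 ^ L - (i : ℕ)) * span L n 0 :=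
    fun {i k} _ => Nat.le_mul_of_pos_left _ (by have := i.isLt; omega)
  -- Initial deadlines of different processes are at least one `span L n 0` apart, higher numbers
  -- first.
  have hkey : ∀ j k : Proc L, (k : ℕ) < j →
      (2 ^ L - (j : ℕ)) * span L n 0 + span L n 0 ≤ (2 ^ L - (k : ℕ)) * span L n 0 := by
    intro j k hjk
    have := j.isLt
    calc (2 ^ L - (j : ℕ)) * span L n 0 + span L n 0 = (2 ^ L - (j : ℕ) + 1) * span L n 0 := by ring
      _ ≤ _ := Nat.mul_le_mul_right _ (by omega)
  refine ⟨?_, ?_, ?_, ?_, ?_, ?_, ?_, ?_, ?_, ?_, ?_, ?_⟩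
  · exact fun i _ => ⟨⟨Nat.one_pos, fun _ _ => Nat.one_pos⟩, ⟨le_rfl, Nat.le_add_left _ _⟩,
      initView_pointsOK i, Finset.notMem_empty i⟩
  · intro i hi
    rw [(initConfig_active hi).2]
    exact enter_ok le_rfl
  · intro i h q hi hq
    have := (initConfig_active (i := i) (A := A) (r := 1) (n := n)
      ⟨hi.1, by rw [hq]; trivial⟩).2
    rw [hq] at this
    exact absurd this.symm enter_ne_await
  · exact fun i q _ hq => absurd hq (Finset.notMem_empty q)
  · exact fun i a _ ha => absurd ha (Set.notMem_empty a)
  · exact fun i j hi hj => Fin.ext ((initConfig_active hi).1.trans (initConfig_active hj).1.symm)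
  · exact fun i j _ _ => ⟨initView_le j i, Set.Subset.rfl⟩
  · intro j d k e hj hk hne
    obtain ⟨-, rfl⟩ := initConfig_waits hj
    obtain ⟨-, rfl⟩ := initConfig_waits hk
    unfold Precedes
    rw [hred, hred]
    rcases lt_or_gt_of_ne fun h => hne (Fin.ext h) with h | h
    · exact Or.inr ⟨hkey k j h, initView_le _ _, Set.Subset.rfl⟩
    · exact Or.inl ⟨hkey j k h, initView_le _ _, Set.Subset.rfl⟩
  · intro j d hj
    obtain ⟨-, rfl⟩ := initConfig_waits hj
    have := hmul (i := j) le_rfl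
    omega
  · intro i k d hi hk
    obtain ⟨-, rfl⟩ := initConfig_waits hk
    have h1 := hmul (i := k) le_rfl
    have h2 := hpot i hi
    omega
  · intro j d hj
    obtain ⟨h0, rfl⟩ := initConfig_waits hj
    rw [hred]
    have := hkey j ⟨0, Nat.two_pow_pos L⟩ (Nat.pos_of_ne_zero h0)
    unfold horizon
    simpa using this
  · intro i hi
    have h2 := hpot i hi
    have h1 : span L n 0 ≤ horizon L n := Nat.le_mul_of_pos_left _ (Nat.two_pow_pos L)
    omega

theorem execution_succ {n r : ℕ} {A : Crashes L} (hr : 1 ≤ r) :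
    execution n A (r + 1) = step n A r (execution n A r) := by
  obtain ⟨k, rfl⟩ : ∃ k, r = k + 1 := ⟨r - 1, by omega⟩
  rfl

/-- The configuration in round `r` when the processes whose deadline has come are active. -/
def config (n : ℕ) (A : Crashes L) (r : ℕ) : Config L := wakeAll n r (execution n A r)

theorem history_succ {n r : ℕ} {A : Crashes L} (hr : 1 ≤ r) :
    history n A (r + 1) = nextHist A r (config n A r) (history n A r) := by
  obtain ⟨k, rfl⟩ : ∃ k, r = k + 1 := ⟨r - 1, by omega⟩
  rfl

theorem core_execution (n : ℕ) (A : Crashes L) {r : ℕ} (hr : 1 ≤ r) :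
    Core n A r (execution n A r) (history n A r) := by
  induction r, hr using Nat.le_induction with
  | base => exact core_init n A
  | succ r hr ih =>
    rw [execution_succ hr, history_succ hr]
    exact ih.wake.step

theorem core_config (n : ℕ) (A : Crashes L) {r : ℕ} (hr : 1 ≤ r) :
    Core n A r (config n A r) (history n A r) := (core_execution n A hr).wake

theorem not_alive_of_horizon_le {n r : ℕ} {A : Crashes L} (hr : 1 ≤ r) (h : horizon L n ≤ r)
    (i : Proc L) : ¬Alive A r (config n A r) i := by
  intro hi
  have hc := core_config n A hr
  rcases hi.active_or_waits with ha | ⟨d, hw⟩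
  · have h1 := hc.active_end i ha
    have h2 := waitBound_lt_potential ha.2 (hc.good i hi).reduced_lt
    omega
  · have h1 := hc.waits_end i d hw
    have h2 := hc.deadline i d hw
    have h3 := hc.span_pos hi
    omega

/-- All processes are retired in the end. -/
theorem retired_of_horizon_lt {n r : ℕ} {A : Crashes L} (h : horizon L n < r) (i : Proc L)
    (hr : 2 ≤ r) : Retired n A r i := by
  obtain ⟨k, rfl⟩ : ∃ k, r = k + 1 := ⟨r - 1, by omega⟩
  have hk : 1 ≤ k := by omega
  by_contra hn
  unfold Retired at hn
  rw [not_or, not_lt] at hn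
  have h1 : Alive A (k + 1) (step n A k (execution n A k)) i := ⟨hn.1, by
    rw [← execution_succ hk]
    exact hn.2⟩
  exact not_alive_of_horizon_le hk (by omega) i h1.of_step

/-! ### Pointers into a group -/

/-- The pointers of the processes into group `k` of level `h`, compared with each other and with
the ordinary messages that have been sent to members of the group: `R a p` means that such a message
was sent to `p` in round `a`. `Al` and `Wt` are the processes that are not retired and those among
them that are inactive. -/
structure Pointers (h k : ℕ) (Al Wt : Proc L → Prop) (V : Proc L → View L) (H : Proc L → Set ℕ)
    (R : ℕ → Proc L → Prop) : Prop where
  -- Pointers of the same age come from a common place, and since then have passed nobody who is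
  -- waiting, apart possibly from their owner.
  shared : ∀ ρ, ∃ b, ∀ j, Al j → (V j).round h k = ρ → ∀ x, groupIdx h x = k → Wt x →
    cd h b x < cd h b ((V j).point h k) → x = j
  -- On the way from an older pointer to a newer one, every waiting process has newer information on
  -- the group than the owner of the older pointer.
  older : ∀ j l, Al j → Al l → (V j).round h k < (V l).round h k → ∀ x, groupIdx h x = k → Wt x →
    (V x).round h k ≤ (V j).round h k →
    ¬cd h ((V j).point h k) x < cd h ((V j).point h k) ((V l).point h k)
  -- If `j` has not heard of a message to `p`, then polling from its pointer it reaches `p` before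
  -- any waiting process whose information is no newer. Hence, when such a process replies, the
  -- retirement of `p` has been noticed.
  missed : ∀ j a p, Al j → R a p → a ∉ H j → p ∈ (V j).faulty ∨
    ∀ x, groupIdx h x = k → Wt x → (V x).round h k ≤ (V j).round h k →
      ¬cd h ((V j).point h k) x ≤ cd h ((V j).point h k) p
  -- Waiting processes passed by the pointer since the message to `p` have heard of that message;
  -- equality of pointer and `p` stands for a full turn.
  known : ∀ j a p, Al j → R a p → a ∈ H j → ∀ x, groupIdx h x = k → Wt x →
    cd h p x < cd h p ((V j).point h k) ∨ (V j).point h k = p → a ∈ H x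
  -- Causal histories may branch when messages are lost, but up to a common message they agree.
  prefix_closed : ∀ j l ρ a, Al j → Al l → ρ ∈ H j → ρ ∈ H l → a ≤ ρ → a ∈ H j → a ∈ H l
  stamp : ∀ j, Al j → (V j).round h k = 0 ∨ (V j).round h k ∈ H j
  -- Together with `stamp`, the round number is an upper bound, taken from the history, for the
  -- messages to the group; `prefix_closed` then compares histories by round numbers.
  le_stamp : ∀ j a p, Al j → R a p → a ∈ H j → a ≤ (V j).round h k
  got : ∀ a p, R a p → Al p → a ∈ H p

/-- `s` has finished the failure detection of level `h` in its group, number `k`. -/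
structure Passed (h k : ℕ) (Al Wt : Proc L → Prop) (V : Proc L → View L) (H : Proc L → Set ℕ)
    (R : ℕ → Proc L → Prop) (s : Proc L) : Prop where
  -- What `s` has not heard of was lost with recipients it knows to be retired.
  lost : ∀ a p, R a p → a ∉ H s → p ∈ (V s).faulty
  -- The property `older` in advance, for a pointer that is to be moved to the target of `s`.
  ahead : ∀ τ, (V s).target s h = some τ → ∀ j, Al j → j ≠ τ → ∀ x, groupIdx h x = k → Wt x →
    (V x).round h k ≤ (V j).round h k →
    ¬cd h ((V j).point h k) x < cd h ((V j).point h k) τ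

section

variable {h k : ℕ} {Al Wt Al' Wt' : Proc L → Prop} {V V' : Proc L → View L}
  {H H' : Proc L → Set ℕ} {R R' : ℕ → Proc L → Prop} {s q : Proc L} {r : ℕ}

/-- All conditions speak only of processes that are not retired, so crashes preserve them and the
data of retired processes may be changed at will. -/
theorem Pointers.shrink (hP : Pointers h k Al Wt V H R) (hA : ∀ j, Al' j → Al j)
    (hW : ∀ j, Wt' j → Wt j ∧ Al' j) (hV : ∀ j, Al' j → V' j = V j) (hH : ∀ j, Al' j → H' j = H j)
    (hR : ∀ a p, R' a p ↔ R a p) : Pointers h k Al' Wt' V' H' R' where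
  shared ρ := by
    obtain ⟨b, hb⟩ := hP.shared ρ
    refine ⟨b, fun j hj hρ x hx hw hlt => ?_⟩
    rw [hV j hj] at hρ hlt
    exact hb j (hA j hj) hρ x hx (hW x hw).1 hlt
  older j l hj hl hlt x hx hw hle := by
    rw [hV j hj, hV l hl] at *
    rw [hV x (hW x hw).2] at hle
    exact hP.older j l (hA j hj) (hA l hl) hlt x hx (hW x hw).1 hle
  missed j a p hj hr ha := by
    rw [hV j hj]
    rw [hH j hj] at ha
    refine (hP.missed j a p (hA j hj) ((hR a p).1 hr) ha).imp id fun h0 x hx hw hle => ?_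
    rw [hV x (hW x hw).2] at hle
    exact h0 x hx (hW x hw).1 hle
  known j a p hj hr ha x hx hw hlt := by
    rw [hV j hj] at hlt
    rw [hH j hj] at ha
    rw [hH x (hW x hw).2]
    exact hP.known j a p (hA j hj) ((hR a p).1 hr) ha x hx (hW x hw).1 hlt
  prefix_closed j l ρ a hj hl := by
    rw [hH j hj, hH l hl]
    exact hP.prefix_closed j l ρ a (hA j hj) (hA l hl)
  stamp j hj := by
    rw [hV j hj, hH j hj]
    exact hP.stamp j (hA j hj)
  le_stamp j a p hj hr ha := by
    rw [hV j hj]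
    rw [hH j hj] at ha
    exact hP.le_stamp j a p (hA j hj) ((hR a p).1 hr) ha
  got a p hr hp := by
    rw [hH p hp]
    exact hP.got a p ((hR a p).1 hr) (hA p hp)

theorem Passed.shrink (hP : Passed h k Al Wt V H R s) (hA : ∀ j, Al' j → Al j)
    (hW : ∀ j, Wt' j → Wt j ∧ Al' j) (hV : ∀ j, Al' j → V' j = V j) (hH : ∀ j, Al' j → H' j = H j)
    (hR : ∀ a p, R' a p ↔ R a p) (hs : Al' s) : Passed h k Al' Wt' V' H' R' s where
  lost a p hr ha := by
    rw [hV s hs]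
    rw [hH s hs] at ha
    exact hP.lost a p ((hR a p).1 hr) ha
  ahead τ ht j hj hne x hx hw hle := by
    rw [hV s hs] at ht
    rw [hV j hj] at *
    rw [hV x (hW x hw).2] at hle
    exact hP.ahead τ ht j (hA j hj) hne x hx (hW x hw).1 hle

/-- The active process `s` learns about failures and moves its pointer past processes that are not
waiting. -/
theorem Pointers.move (hP : Pointers h k Al Wt V H R) (hWA : ∀ j, Wt j → Al j) (hs : Al s)
    (hsW : ¬Wt s) (hmax : ∀ j, Al j → (V j).round h k ≤ (V s).round h k)
    (hpt : ∀ x : Proc L, groupIdx h x = k → groupIdx h ((V s).point h k) = k)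
    (hRk : ∀ a p, R a p → groupIdx h p = k)
    (hV : ∀ j, j ≠ s → V' j = V j) (hround : (V' s).round h k = (V s).round h k)
    (hF : (V s).faulty ⊆ (V' s).faulty) (hsound : ∀ x, x ∈ (V' s).faulty → ¬Al x)
    (hskip : ∀ x, groupIdx h x = k → cd h ((V s).point h k) x <
      cd h ((V s).point h k) ((V' s).point h k) → x = s ∨ x ∈ (V' s).faulty) :
    Pointers h k Al Wt V' H R := by
  have hr : ∀ j, (V' j).round h k = (V j).round h k := by
    intro j
    by_cases hj : j = s
    · rw [hj, hround]
    · rw [hV j hj]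
  have hskip' : ∀ x, groupIdx h x = k → Wt x → ¬cd h ((V s).point h k) x <
      cd h ((V s).point h k) ((V' s).point h k) := by
    intro x hx hw hlt
    rcases hskip x hx hlt with rfl | h0
    · exact hsW hw
    · exact hsound x h0 (hWA x hw)
  refine ⟨fun ρ => ?_, ?_, ?_, ?_, hP.prefix_closed, ?_, ?_, hP.got⟩
  · obtain ⟨b, hb⟩ := hP.shared ρ
    refine ⟨b, fun j hj hρ x hx hw hlt => ?_⟩
    rw [hr] at hρ
    by_cases hjs : j = s
    · subst hjs
      rcases cd_tri ((V j).point h k) hlt with h0 | h0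
      · exact hb j hj hρ x hx hw h0
      · exact absurd h0 (hskip' x hx hw)
    · rw [hV j hjs] at hlt
      exact hb j hj hρ x hx hw hlt
  · intro j l hj hl hlt x hx hw hle
    rw [hr, hr] at hlt hle
    have hjs : j ≠ s := by
      rintro rfl
      exact absurd (hmax l hl) (by omega)
    rw [hV j hjs]
    intro hc
    by_cases hls : l = s
    · subst hls
      rcases cd_tri ((V l).point h k) hc with h0 | h0
      · exact hP.older j l hj hl hlt x hx hw hle h0
      · exact hskip' x hx hw h0
    · rw [hV l hls] at hc
      exact hP.older j l hj hl hlt x hx hw hle hc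
  · intro j a p hj hra ha
    by_cases hjs : j = s
    · subst hjs
      by_cases hpF : p ∈ (V' j).faulty
      · exact Or.inl hpF
      right
      intro x hx hw hle
      rw [hr, hr] at hle
      rcases hP.missed j a p hj hra ha with h0 | h0
      · exact absurd (hF h0) hpF
      · intro hc
        refine h0 x hx hw hle (cd_extend ?_ hc)
        -- A recipient `p` before the new pointer was skipped: it is `s`, who got the message, or
        -- known to be retired.
        by_contra hlt
        rcases hskip p (hRk a p hra) (not_le.1 hlt) with h1 | h1
        · subst h1
          exact ha (hP.got a p hra hj)
        · exact hpF h1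
    · rw [hV j hjs]
      refine (hP.missed j a p hj hra ha).imp id fun h0 x hx hw hle => ?_
      rw [hr] at hle
      exact h0 x hx hw hle
  · intro j a p hj hra ha x hx hw hlt
    by_cases hjs : j = s
    · subst hjs
      rcases cd_tri_full (b := (V j).point h k) ((hpt x hx).trans (hRk a p hra).symm) hlt
        with h0 | h0
      · exact hP.known j a p hj hra ha x hx hw h0
      · exact absurd h0 (hskip' x hx hw)
    · rw [hV j hjs] at hlt
      exact hP.known j a p hj hra ha x hx hw hlt
  · intro j hj
    rw [hr]
    exact hP.stamp j hj
  · intro j a p hj hra ha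
    rw [hr]
    exact hP.le_stamp j a p hj hra ha

/-- The active process `s` learns about failures. -/
theorem Passed.grow (hP : Passed h k Al Wt V H R s) (h1 : 1 ≤ h) (hL : h ≤ L)
    (hk : groupIdx h s = k) (hok : (V s).PointsOK) (hok' : (V' s).PointsOK)
    (hWA : ∀ j, Wt j → Al j) (hsW : ¬Wt s)
    (hV : ∀ j, j ≠ s → V' j = V j) (hround : (V' s).round h k = (V s).round h k)
    (hpoint : (V' s).point h k = (V s).point h k) (hF : (V s).faulty ⊆ (V' s).faulty)
    (hsound : ∀ x, x ∈ (V' s).faulty → ¬Al x) : Passed h k Al Wt V' H R s where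
  lost a p hra ha := hF (hP.lost a p hra ha)
  ahead τ' ht' j hj hne x hx hw hle := by
    subst hk
    have hr : ∀ j, (V' j).round h (groupIdx h s) = (V j).round h (groupIdx h s) := by
      intro j
      by_cases hj : j = s
      · rw [hj, hround]
      · rw [hV j hj]
    have hp : ∀ j, (V' j).point h (groupIdx h s) = (V j).point h (groupIdx h s) := by
      intro j
      by_cases hj : j = s
      · rw [hj, hpoint]
      · rw [hV j hj]
    rw [hp]
    rw [hr, hr] at hle
    obtain ⟨hg', hs', hF', hbef'⟩ := hok'.target_some h1 hL ht'
    rw [hpoint] at hbef'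
    rcases ht : (V s).target s h with _ | τ
    · rcases hok.target_none h1 hL ht hg' with h0 | h0
      · exact absurd h0 hs'
      · exact absurd (hF h0) hF'
    · obtain ⟨hg, hs, hFτ, hbef⟩ := hok.target_some h1 hL ht
      -- New failures can only move the target forward.
      have hττ : cd h ((V s).point h (groupIdx h s)) τ ≤ cd h ((V s).point h (groupIdx h s)) τ' := by
        by_contra hc
        rcases hbef τ' hg' (not_le.1 hc) with h0 | h0
        · exact hs' h0
        · exact hF' (hF h0)
      -- If the old target is not retired, it has not been skipped, so it is still the target.
      have hjτ : j ≠ τ := by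
        rintro rfl
        rcases lt_or_eq_of_le hττ with h0 | h0
        · rcases hbef' j hg h0 with h0 | h0
          · exact hs h0
          · exact hsound j h0 hj
        · exact hne (cd_inj (hg.trans hg'.symm) h0)
      intro hc
      rcases cd_tri τ hc with h0 | h0
      · exact hP.ahead τ ht j hj hjτ x hx hw hle h0
      · rcases hbef' x hx (cd_extend_lt hττ h0) with h0 | h0
        · exact hsW (h0 ▸ hw)
        · exact hsound x h0 (hWA x hw)

/-- With nobody left to poll, every recipient in the group is `s` itself or known to be retired, and
`ahead` is void. -/
theorem Pointers.passed_of_none (hP : Pointers h k Al Wt V H R) (h1 : 1 ≤ h) (hL : h ≤ L)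
    (hk : groupIdx h s = k) (hok : (V s).PointsOK) (hs : Al s)
    (hRk : ∀ a p, R a p → groupIdx h p = k) (ht : (V s).target s h = none) :
    Passed h k Al Wt V H R s where
  lost a p hra ha := by
    rcases hok.target_none h1 hL ht ((hRk a p hra).trans hk.symm) with h0 | h0
    · subst h0
      exact absurd (hP.got a p hra hs) ha
    · exact h0
  ahead τ hτ := by
    rw [ht] at hτ
    cases hτ

/-- The replying `q` is waiting and, by maximality of `s`, has no newer information. By `missed`, a
recipient of which `s` has not heard and which it does not know to be retired would lie before `q`,
but everything there has been skipped. -/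
theorem Pointers.passed_of_reply (hP : Pointers h k Al Wt V H R) (h1 : 1 ≤ h) (hL : h ≤ L)
    (hk : groupIdx h s = k) (hok : (V s).PointsOK) (hs : Al s) (hWA : ∀ j, Wt j → Al j)
    (hsW : ¬Wt s) (hmax : ∀ j, Al j → (V j).round h k ≤ (V s).round h k)
    (hRk : ∀ a p, R a p → groupIdx h p = k) (hsound : ∀ x, x ∈ (V s).faulty → ¬Al x)
    (ht : (V s).target s h = some q) (hq : Wt q) : Passed h k Al Wt V H R s := by
  subst hk
  obtain ⟨hg, hqs, hqF, hbef⟩ := hok.target_some h1 hL ht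
  have hbef' : ∀ x, groupIdx h x = groupIdx h s → Wt x →
      ¬cd h ((V s).point h (groupIdx h s)) x < cd h ((V s).point h (groupIdx h s)) q := by
    intro x hx hw hlt
    rcases hbef x hx hlt with rfl | h0
    · exact hsW hw
    · exact hsound x h0 (hWA x hw)
  constructor
  · intro a p hra ha
    by_contra hpF
    have hps : p ≠ s := by
      rintro rfl
      exact ha (hP.got a p hra hs)
    rcases hP.missed s a p hs hra ha with h0 | h0
    · exact hpF h0
    · refine h0 q hg hq (hmax q (hWA q hq)) ?_
      by_contra hlt
      rcases hbef p (hRk a p hra) (not_le.1 hlt) with h0 | h0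
      · exact hps h0
      · exact hpF h0
  · intro τ hτ j hj hjτ x hx hw hle hc
    rw [ht] at hτ
    cases hτ
    rcases lt_or_eq_of_le (hmax j hj) with hlt | heq
    · rcases cd_tri ((V s).point h (groupIdx h s)) hc with h0 | h0
      · exact hP.older j s hj hs hlt x hx hw hle h0
      · exact hbef' x hx hw h0
    -- For equal round numbers both pointers are measured from the common place `b`. Nobody waits
    -- between `b` and `q`, and the pointer of `j` is not beyond `q`, for otherwise it would have
    -- passed the waiting process `q`.
    · obtain ⟨b, hb⟩ := hP.shared ((V s).round h (groupIdx h s))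
      have hsb : ∀ y, groupIdx h y = groupIdx h s → Wt y → ¬cd h b y < cd h b q := by
        intro y hy hyw hlt
        rcases cd_tri ((V s).point h (groupIdx h s)) hlt with h0 | h0
        · exact hsW (hb s hs rfl y hy hyw h0 ▸ hyw)
        · exact hbef' y hy hyw h0
      have hbq : cd h b ((V j).point h (groupIdx h s)) ≤ cd h b q := by
        by_contra h0
        exact hjτ (hb j hj heq q hg hq (not_le.1 h0)).symm
      exact hsb x hx hw (cd_extend_lt hbq hc)

/-- The effect of an ordinary message on the pointers into the group to which it is sent. -/
theorem Pointers.report (hP : Pointers h k Al Wt V H R) (hs : Al s)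
    (hWA : ∀ j, Wt j → Al j) (hsW : ¬Wt s)
    (hmaxH : ∀ j, Al j → H j ⊆ H s)
    (hRk : ∀ a p, R a p → groupIdx h p = k) (hsound : ∀ x, x ∈ (V s).faulty → ¬Al x)
    (hbefore : ∀ j, Al j → (V j).round h k < r) (hHr : ∀ j a, Al j → a ∈ H j → a < r)
    (hpt : groupIdx h ((V s).point h k) = k) (hqk : groupIdx h q = k)
    (hpass : Passed h k Al Wt V H R s) (ht : (V s).target s h = some q)
    (hbef : ∀ x, groupIdx h x = k →
      cd h ((V s).point h k) x < cd h ((V s).point h k) q → x = s ∨ x ∈ (V s).faulty)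
    {z : Proc L} (hskip : ∀ x, groupIdx h x = k → cd h q x < cd h q z ∨ z = q →
      x = q ∨ x = s ∨ x ∈ (V s).faulty)
    (hRr : ∀ a p, R a p → a < r)
    (hV : ∀ j, j ≠ s → j ≠ q → V' j = V j) (hH : ∀ j, j ≠ s → j ≠ q → H' j = H j)
    (hVs : ∀ j, Al j → j = s ∨ j = q → (V' j).round h k = r ∧ (V' j).point h k = z ∧
      (V' j).faulty = (V s).faulty ∧ H' j = insert r (H s))
    (hR : ∀ a p, R' a p ↔ R a p ∨ (a = r ∧ p = q)) : Pointers h k Al Wt V' H' R' := by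
  have hsub : ∀ j, Al j → H j ⊆ H' j := by
    intro j hj
    by_cases h0 : j = s ∨ j = q
    · rw [(hVs j hj h0).2.2.2]
      exact (hmaxH j hj).trans (Set.subset_insert _ _)
    · rw [not_or] at h0
      rw [hH j h0.1 h0.2]
  have hnot : ∀ x, Wt x → x = s ∨ x ∈ (V s).faulty → False := by
    rintro x hw (rfl | h0)
    · exact hsW hw
    · exact hsound x h0 (hWA x hw)
  have hcases : ∀ j, Al j → ((j = s ∨ j = q) ∧ (V' j).round h k = r ∧ (V' j).point h k = z ∧
      (V' j).faulty = (V s).faulty ∧ H' j = insert r (H s)) ∨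
      (j ≠ s ∧ j ≠ q ∧ V' j = V j ∧ H' j = H j) := by
    intro j hj
    by_cases h0 : j = s ∨ j = q
    · exact Or.inl ⟨h0, hVs j hj h0⟩
    · rw [not_or] at h0
      exact Or.inr ⟨h0.1, h0.2, hV j h0.1 h0.2, hH j h0.1 h0.2⟩
  -- a waiting process that is up to date with an old view has not changed
  have hold : ∀ x j, Wt x → (V' x).round h k ≤ (V j).round h k → Al j →
      x ≠ q ∧ (V x).round h k ≤ (V j).round h k := by
    intro x j hw hle hj
    rcases hcases x (hWA x hw) with ⟨-, h0, -⟩ | ⟨-, hxq, h0, -⟩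
    · have := hbefore j hj
      omega
    · exact ⟨hxq, h0 ▸ hle⟩
  refine ⟨fun ρ => ?_, ?_, ?_, ?_, ?_, ?_, ?_, ?_⟩
  · by_cases hρ : ρ = r
    -- The age `r` belongs only to sender and recipient, whose pointers both stand at `z`.
    · refine ⟨z, fun j hj hjr x hx hw hlt => ?_⟩
      rcases hcases j hj with ⟨-, -, h0, -⟩ | ⟨-, -, h0, -⟩
      · rw [h0, cd_self] at hlt
        omega
      · rw [h0] at hjr
        have := hbefore j hj
        omega
    · obtain ⟨b, hb⟩ := hP.shared ρ
      refine ⟨b, fun j hj hjr x hx hw hlt => ?_⟩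
      rcases hcases j hj with ⟨-, h0, -⟩ | ⟨-, -, h0, -⟩
      · exact absurd (hjr.symm.trans h0) hρ
      · rw [h0] at hjr hlt
        exact hb j hj hjr x hx hw hlt
  · intro j l hj hl hlt x hx hw hle hc
    rcases hcases j hj with ⟨-, h0, -⟩ | ⟨hjs, hjq, h0, -⟩
    · rcases hcases l hl with ⟨-, h1, -⟩ | ⟨-, -, h1, -⟩
      · omega
      · rw [h1] at hlt
        have := hbefore l hl
        omega
    · rw [h0] at hlt hle hc
      obtain ⟨hxq, hle'⟩ := hold x j hw hle hj
      rcases hcases l hl with ⟨-, -, h1, -⟩ | ⟨-, -, h1, -⟩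
      -- The arc to the new pointer is cut at `q`: the first part is controlled by `ahead`, and on
      -- the second only `q` may be waiting, which is now up to date.
      · rw [h1] at hc
        rcases cd_tri q hc with h2 | h2
        · exact hpass.ahead q ht j hj hjq x hx hw hle' h2
        · rcases hskip x hx (Or.inl h2) with h3 | h3
          · exact hxq h3
          · exact hnot x hw h3
      · rw [h1] at hlt hc
        exact hP.older j l hj hl hlt x hx hw hle' hc
  · intro j a p hj hra ha
    rcases hcases j hj with ⟨-, -, -, hFj, hHj⟩ | ⟨hjs, hjq, h0, hHj⟩
    · left
      rw [hHj, Set.mem_insert_iff, not_or] at ha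
      rw [hFj]
      rcases (hR a p).1 hra with h1 | ⟨h1, -⟩
      · exact hpass.lost a p h1 ha.2
      · exact absurd h1 ha.1
    · rw [hHj] at ha
      rw [h0]
      rcases (hR a p).1 hra with h1 | ⟨rfl, rfl⟩
      · refine (hP.missed j a p hj h1 ha).imp id fun h2 x hx hw hle => ?_
        exact h2 x hx hw (hold x j hw hle hj).2
      · right
        intro x hx hw hle hc
        obtain ⟨hxq, hle'⟩ := hold x j hw hle hj
        rcases lt_or_eq_of_le hc with h2 | h2
        · exact hpass.ahead p ht j hj hjq x hx hw hle' h2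
        · exact hxq (cd_inj (hx.trans hqk.symm) h2)
  · intro j a p hj hra ha x hx hw hlt
    rcases hcases j hj with ⟨-, -, hz, -, hHj⟩ | ⟨hjs, hjq, h0, hHj⟩
    · rw [hz] at hlt
      rw [hHj] at ha
      have hq' : x = q → a ∈ H' x := fun hxq => by
        rw [(hVs x (hWA x hw) (Or.inr hxq)).2.2.2]
        exact ha
      rcases (hR a p).1 hra with h1 | ⟨rfl, rfl⟩
      · rcases Set.mem_insert_iff.1 ha with h2 | h2
        · exact absurd (hRr a p h1) (by omega)
        -- The arc from `p` to `z` is cut at the old pointer and at `q`. On the first part the old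
        -- invariant applies, on the second nobody waits, and on the third only `q` can, which has
        -- just inherited the history of `s`.
        · rcases cd_tri_full (b := (V s).point h k) (hpt.trans (hRk a p h1).symm) hlt with h3 | h3
          · exact hsub x (hWA x hw) (hP.known s a p hs h1 h2 x hx hw h3)
          · rcases cd_tri q h3 with h4 | h4
            · exact (hnot x hw (hbef x hx h4)).elim
            · rcases hskip x hx (Or.inl h4) with h5 | h5
              · exact hq' h5
              · exact (hnot x hw h5).elim
      · rcases hskip x hx hlt with h5 | h5
        · exact hq' h5
        · exact (hnot x hw h5).elim
    · rw [hHj] at ha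
      rw [h0] at hlt
      rcases (hR a p).1 hra with h1 | ⟨rfl, rfl⟩
      · exact hsub x (hWA x hw) (hP.known j a p hj h1 ha x hx hw hlt)
      · exact absurd (hHr j a hj ha) (lt_irrefl _)
  · intro j l ρ a hj hl hρj hρl ha haj
    rcases hcases j hj with ⟨-, -, -, -, hHj⟩ | ⟨-, -, -, hHj⟩ <;>
      rcases hcases l hl with ⟨-, -, -, -, hHl⟩ | ⟨-, -, -, hHl⟩
    · rw [hHl, ← hHj]
      exact haj
    · rw [hHl] at hρl ⊢
      rw [hHj, Set.mem_insert_iff] at hρj haj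
      have := hHr l ρ hl hρl
      exact hP.prefix_closed s l ρ a hs hl (hρj.resolve_left (by omega)) hρl ha
        (haj.resolve_left (by omega))
    · rw [hHl]
      rw [hHj] at haj
      exact Set.mem_insert_of_mem _ (hmaxH j hj haj)
    · rw [hHl] at hρl ⊢
      rw [hHj] at hρj haj
      exact hP.prefix_closed j l ρ a hj hl hρj hρl ha haj
  · intro j hj
    rcases hcases j hj with ⟨-, h0, -, -, hHj⟩ | ⟨-, -, h0, hHj⟩
    · rw [h0, hHj]
      exact Or.inr (Set.mem_insert _ _)
    · rw [h0, hHj]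
      exact hP.stamp j hj
  · intro j a p hj hra ha
    rcases hcases j hj with ⟨-, h0, -, -, hHj⟩ | ⟨-, -, h0, hHj⟩
    · rw [h0]
      rcases (hR a p).1 hra with h1 | ⟨h1, -⟩
      · exact (hRr a p h1).le
      · exact h1.le
    · rw [h0]
      rw [hHj] at ha
      rcases (hR a p).1 hra with h1 | ⟨h1, -⟩
      · exact hP.le_stamp j a p hj h1 ha
      · exact absurd (hHr j a hj ha) (by omega)
  · intro a p hra hp
    rcases (hR a p).1 hra with h1 | ⟨rfl, rfl⟩
    · exact hsub p hp (hP.got a p h1 hp)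
    · rw [(hVs p hp (Or.inr rfl)).2.2.2]
      exact Set.mem_insert _ _

/-- The pointer `z` is directly the next target, so several reports may follow one failure detection
without renewed polling: between `q` and `z` nobody waits but `q`, which has fresh information. -/
theorem Passed.report (hP : Passed h k Al Wt V H R s)
    (hWA : ∀ j, Wt j → Al j)
    (hsound : ∀ x, x ∈ (V s).faulty → ¬Al x)
    (hbefore : ∀ j, Al j → (V j).round h k < r) (hsk : groupIdx h s = k) (hs : Al s)
    (ht : (V s).target s h = some q)
    {z : Proc L} (hz : z ≠ s ∧ z ∉ (V s).faulty)
    (hskip : ∀ x, groupIdx h x = k → cd h q x < cd h q z ∨ z = q →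
      x = q ∨ x = s ∨ x ∈ (V s).faulty)
    (hV : ∀ j, j ≠ s → j ≠ q → V' j = V j)
    (hVs : ∀ j, Al j → j = s ∨ j = q → (V' j).round h k = r ∧ (V' j).point h k = z ∧
      (V' j).faulty = (V s).faulty ∧ H' j = insert r (H s))
    (hR : ∀ a p, R' a p ↔ R a p ∨ (a = r ∧ p = q)) : Passed h k Al Wt V' H' R' s where
  lost a p hra ha := by
    obtain ⟨-, -, h0, h1⟩ := hVs s hs (Or.inl rfl)
    rw [h0]
    rw [h1, Set.mem_insert_iff, not_or] at ha
    rcases (hR a p).1 hra with h2 | ⟨h2, -⟩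
    · exact hP.lost a p h2 ha.2
    · exact absurd h2 ha.1
  ahead τ hτ j hj hne x hx hw hle hc := by
    obtain ⟨-, hzs, hFs, -⟩ := hVs s hs (Or.inl rfl)
    have : τ = z := by
      simp only [View.target] at hτ
      rw [hsk, hzs, hFs, if_pos hz] at hτ
      cases hτ
      rfl
    subst this
    by_cases h0 : j = s ∨ j = q
    · rw [(hVs j hj h0).2.1, cd_self] at hc
      omega
    · have h1 := h0
      rw [not_or] at h1
      rw [hV j h1.1 h1.2] at hle hc
      have hxq : ¬(x = s ∨ x = q) := by
        intro h2
        rw [(hVs x (hWA x hw) h2).1] at hle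
        have := hbefore j hj
        omega
      have h3 := hxq
      rw [not_or] at h3
      rw [hV x h3.1 h3.2] at hle
      rcases cd_tri q hc with h2 | h2
      · exact hP.ahead q ht j hj h1.2 x hx hw hle h2
      · rcases hskip x hx (Or.inl h2) with h4 | h4 | h4
        · exact h3.2 h4
        · exact h3.1 h4
        · exact hsound x h4 (hWA x hw)

/-- The effect of an ordinary message on the pointers into other groups. -/
theorem Pointers.report_other (hP : Pointers h k Al Wt V H R) (hs : Al s) (hqs : q ≠ s)
    (hWA : ∀ j, Wt j → Al j) (hsW : ¬Wt s)
    (hmax : ∀ j, Al j → (V j).round h k ≤ (V s).round h k) (hmaxH : ∀ j, Al j → H j ⊆ H s)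
    (hHr : ∀ j a, Al j → a ∈ H j → a < r) (hRr : ∀ a p, R a p → a < r)
    (hRpos : ∀ a p, R a p → 1 ≤ a) (hqF : Al q → (V q).faulty ⊆ (V s).faulty)
    (hV : ∀ j, j ≠ s → j ≠ q → V' j = V j) (hH : ∀ j, j ≠ s → j ≠ q → H' j = H j)
    (hVs : (V' s).round h k = (V s).round h k ∧ (V' s).point h k = (V s).point h k ∧
      (V' s).faulty = (V s).faulty ∧ H' s = insert r (H s))
    (hVq : Al q → (V' q).round h k = (V s).round h k ∧ (V' q).point h k =
      (if (V q).round h k < (V s).round h k then (V s).point h k else (V q).point h k) ∧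
      (V' q).faulty = (V s).faulty ∧ H' q = insert r (H s)) :
    Pointers h k Al Wt V' H' R := by
  have hstale : ∀ a p, R a p → a ≠ r := fun a p hra => (hRr a p hra).ne
  have hH' : ∀ j, Al j → ((j = s ∨ j = q) ∧ H' j = insert r (H s) ∧
      (V' j).faulty = (V s).faulty ∧ (V' j).round h k = (V s).round h k) ∨
      (j ≠ s ∧ j ≠ q ∧ V' j = V j ∧ H' j = H j) := by
    intro j hj
    by_cases h1 : j = s
    · subst h1
      exact Or.inl ⟨Or.inl rfl, hVs.2.2.2, hVs.2.2.1, hVs.1⟩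
    · by_cases h2 : j = q
      · subst h2
        obtain ⟨a1, -, a2, a3⟩ := hVq hj
        exact Or.inl ⟨Or.inr rfl, a3, a2, a1⟩
      · exact Or.inr ⟨h1, h2, hV j h1 h2, hH j h1 h2⟩
  -- `j` has its pointer from a process `i` of the same knowledge about the group
  have hsrc : ∀ j, Al j → ∃ i, Al i ∧ (V' j).round h k = (V i).round h k ∧
      (V' j).point h k = (V i).point h k ∧ (V i).faulty ⊆ (V' j).faulty ∧ H i ⊆ H' j ∧
      (i = j ∨ i = s) := by
    intro j hj
    by_cases h1 : j = s
    · subst h1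
      obtain ⟨a1, a2, a3, a4⟩ := hVs
      exact ⟨j, hs, a1, a2, a3.ge, a4 ▸ Set.subset_insert _ _, Or.inl rfl⟩
    · by_cases h2 : j = q
      · subst h2
        obtain ⟨a1, a2, a3, a4⟩ := hVq hj
        split_ifs at a2 with hlt
        · exact ⟨s, hs, a1, a2, a3.ge, a4 ▸ Set.subset_insert _ _, Or.inr rfl⟩
        · refine ⟨j, hj, ?_, a2, ?_, ?_, Or.inl rfl⟩
          · have := hmax j hj
            omega
          · rw [a3]
            exact hqF hj
          · rw [a4]
            exact (hmaxH j hj).trans (Set.subset_insert _ _)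
      · rw [hV j h1 h2, hH j h1 h2]
        exact ⟨j, hj, rfl, rfl, Finset.Subset.refl _, Set.Subset.rfl, Or.inl rfl⟩
  have hgrow : ∀ x, Al x → (V x).round h k ≤ (V' x).round h k := by
    intro x hx
    rcases hH' x hx with ⟨-, -, -, h0⟩ | ⟨-, -, h0, -⟩
    · rw [h0]
      exact hmax x hx
    · rw [h0]
  have hsub : ∀ x, Al x → H x ⊆ H' x := by
    intro x hx
    rcases hH' x hx with ⟨-, h0, -⟩ | ⟨-, -, -, h0⟩
    · rw [h0]
      exact (hmaxH x hx).trans (Set.subset_insert _ _)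
    · rw [h0]
  have hclosed : ∀ j l ρ a, Al j → Al l → ρ ∈ H' j → ρ ∈ H' l → a ≤ ρ → a ∈ H' j → a ∈ H' l := by
    intro j l ρ a hj hl hρj hρl ha haj
    rcases hH' j hj with ⟨-, hHj, -⟩ | ⟨-, -, -, hHj⟩ <;>
      rcases hH' l hl with ⟨-, hHl, -⟩ | ⟨-, -, -, hHl⟩
    · rw [hHl, ← hHj]
      exact haj
    · rw [hHl] at hρl ⊢
      rw [hHj, Set.mem_insert_iff] at hρj haj
      have := hHr l ρ hl hρl
      exact hP.prefix_closed s l ρ a hs hl (hρj.resolve_left (by omega)) hρl ha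
        (haj.resolve_left (by omega))
    · rw [hHl]
      rw [hHj] at haj
      exact Set.mem_insert_of_mem _ (hmaxH j hj haj)
    · rw [hHl] at hρl ⊢
      rw [hHj] at hρj haj
      exact hP.prefix_closed j l ρ a hj hl hρj hρl ha haj
  refine ⟨fun ρ => ?_, ?_, ?_, ?_, hclosed, ?_, ?_, ?_⟩
  · obtain ⟨b, hb⟩ := hP.shared ρ
    refine ⟨b, fun j hj hρ x hx hw hlt => ?_⟩
    obtain ⟨i, hi, h1, h2, -, -, h3⟩ := hsrc j hj
    rw [h1] at hρ
    rw [h2] at hlt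
    have := hb i hi hρ x hx hw hlt
    rcases h3 with rfl | rfl
    · exact this
    · exact absurd (this ▸ hw) hsW
  · intro j l hj hl hlt x hx hw hle
    obtain ⟨i, hi, h1, h2, -⟩ := hsrc j hj
    obtain ⟨m, hm, g1, g2, -⟩ := hsrc l hl
    rw [h1, g1] at hlt
    rw [h1] at hle
    rw [h2, g2]
    exact hP.older i m hi hm hlt x hx hw ((hgrow x (hWA x hw)).trans hle)
  · intro j a p hj hra ha
    obtain ⟨i, hi, h1, h2, h3, h4, -⟩ := hsrc j hj
    refine (hP.missed i a p hi hra fun h0 => ha (h4 h0)).imp (fun h0 => h3 h0)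
      fun h0 x hx hw hle => ?_
    rw [h1] at hle
    rw [h2]
    exact h0 x hx hw ((hgrow x (hWA x hw)).trans hle)
  · intro j a p hj hra ha x hx hw hlt
    obtain ⟨i, hi, h1, h2, -, -, h5⟩ := hsrc j hj
    rw [h2] at hlt
    refine hsub x (hWA x hw) (hP.known i a p hi hra ?_ x hx hw hlt)
    rcases hH' j hj with ⟨hjj, hHj, -, hrd⟩ | ⟨hjs, hjq, -, hHj⟩
    · rw [hHj, Set.mem_insert_iff] at ha
      have ha' := ha.resolve_left (hstale a p hra)
      -- if `i` has the same round number as `s`, it has the same history up to this round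
      have hle := hP.le_stamp s a p hs hra ha'
      have hpos := hRpos a p hra
      have hrs : (V i).round h k = (V s).round h k := h1.symm.trans hrd
      have hi0 := (hP.stamp i hi).resolve_left (by omega)
      have hs0 := (hP.stamp s hs).resolve_left (by omega)
      rw [hrs] at hi0
      exact hP.prefix_closed s i _ a hs hi hs0 hi0 hle ha'
    · rcases h5 with rfl | rfl
      · rwa [hHj] at ha
      · rw [hHj] at ha
        exact hmaxH j hj ha
  · intro j hj
    rcases hH' j hj with ⟨-, hHj, -, hrd⟩ | ⟨-, -, h0, hHj⟩
    · rw [hrd, hHj]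
      exact (hP.stamp s hs).imp id fun h0 => Set.mem_insert_of_mem _ h0
    · rw [h0, hHj]
      exact hP.stamp j hj
  · intro j a p hj hra ha
    rcases hH' j hj with ⟨-, hHj, -, hrd⟩ | ⟨-, -, h0, hHj⟩
    · rw [hHj, Set.mem_insert_iff] at ha
      rw [hrd]
      exact hP.le_stamp s a p hs hra (ha.resolve_left (hstale a p hra))
    · rw [hHj] at ha
      rw [h0]
      exact hP.le_stamp j a p hj hra ha
  · exact fun a p hra hp => hsub p hp (hP.got a p hra hp)

/-- The message changes no pointer of `s` into its other groups, hence none of these targets. If `q`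
takes over the pointer of `s`, everything between it and the target is known by `s` to be retired,
or is `s` itself. -/
theorem Passed.report_other (hP : Passed h k Al Wt V H R s) (h1 : 1 ≤ h) (hL : h ≤ L) (hs : Al s)
    (hok : (V s).PointsOK) (hWA : ∀ j, Wt j → Al j) (hsW : ¬Wt s) (hsk : groupIdx h s = k)
    (hmax : ∀ j, Al j → (V j).round h k ≤ (V s).round h k)
    (hsound : ∀ x, x ∈ (V s).faulty → ¬Al x)
    (hV : ∀ j, j ≠ s → j ≠ q → V' j = V j) (hqs : q ≠ s)
    (hVs : (V' s).round h k = (V s).round h k ∧ (V' s).point h k = (V s).point h k ∧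
      (V' s).faulty = (V s).faulty ∧ H' s = insert r (H s))
    (hVq : Al q → (V' q).round h k = (V s).round h k ∧ (V' q).point h k =
      (if (V q).round h k < (V s).round h k then (V s).point h k else (V q).point h k) ∧
      (V' q).faulty = (V s).faulty ∧ H' q = insert r (H s)) :
    Passed h k Al Wt V' H' R s where
  lost a p hra ha := by
    rw [hVs.2.2.1]
    rw [hVs.2.2.2, Set.mem_insert_iff, not_or] at ha
    exact hP.lost a p hra ha.2
  ahead τ hτ j hj hne x hx hw hle hc := by
    subst hsk
    have hτ' : (V s).target s h = some τ := by
      rw [← hτ]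
      simp only [View.target, hVs.2.1, hVs.2.2.1]
    obtain ⟨-, -, -, hbef⟩ := hok.target_some h1 hL hτ'
    have hgrow : (V x).round h (groupIdx h s) ≤ (V' x).round h (groupIdx h s) := by
      by_cases h2 : x = s
      · rw [h2, hVs.1]
      · by_cases h3 : x = q
        · subst h3
          rw [(hVq (hWA x hw)).1]
          exact hmax x (hWA x hw)
        · rw [hV x h2 h3]
    have hbase := hP.ahead τ hτ' j hj hne x hx hw
    by_cases h2 : j = s
    · subst h2
      rw [hVs.1] at hle
      rw [hVs.2.1] at hc
      exact hbase (hgrow.trans hle) hc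
    · by_cases h3 : j = q
      · subst h3
        obtain ⟨a1, a2, -⟩ := hVq hj
        rw [a1] at hle
        rw [a2] at hc
        split_ifs at hc with hlt
        · rcases hbef x hx hc with h0 | h0
          · exact hsW (h0 ▸ hw)
          · exact hsound x h0 (hWA x hw)
        · have := hmax j hj
          exact hbase (by omega) hc
      · rw [hV j h2 h3] at hle hc
        exact hbase (hgrow.trans hle) hc

end

/-! ### Pointers in an execution -/

/-- Process `i` moves its pointers, in its view `w`, past processes that it does not have to poll,
and leaves only those levels at which there is nobody to poll or a process has replied. -/
structure MoveSpec (i : Proc L) (w : View L) (l : ℕ) (rep : ℕ → Proc L → Prop)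
    (x : View L × Ctrl L) : Prop where
  round : x.1.round = w.round
  faulty : w.faulty ⊆ x.1.faulty
  skip : ∀ h, 1 ≤ h → h ≤ L → ∀ k y, groupIdx h y = k →
    cd h (w.point h k) y < cd h (w.point h k) (x.1.point h k) → y = i ∨ y ∈ x.1.faulty
  -- A level above the present one has nobody left to poll, or was finished before with its pointer
  -- unchanged, or was finished by a reply.
  levels : ∀ h, x.2.level < h → h ≤ L → x.1.target i h = none ∨
    (l < h ∧ x.1.point h (groupIdx h i) = w.point h (groupIdx h i)) ∨
    ∃ q, rep h q ∧ x.1 = w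

theorem moveSpec_of_eq {i : Proc L} {w : View L} {l : ℕ} {rep : ℕ → Proc L → Prop}
    {x : View L × Ctrl L} (hr : x.1.round = w.round) (hF : w.faulty ⊆ x.1.faulty)
    (hp : x.1.point = w.point)
    (hl : ∀ h, x.2.level < h → h ≤ L → x.1.target i h = none ∨ l < h ∨ ∃ q, rep h q ∧ x.1 = w) :
    MoveSpec i w l rep x := by
  refine ⟨hr, hF, fun h _ _ k y _ hlt => ?_, fun h h1 h2 => ?_⟩
  · rw [hp] at hlt
    rw [cd_self] at hlt
    omega
  · exact (hl h h1 h2).imp id (Or.imp (fun h0 => ⟨h0, by rw [hp]⟩) id)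

theorem resume_moveSpec {n : ℕ} {i : Proc L} {w v : View L} {h : ℕ} {rep : ℕ → Proc L → Prop}
    (hok : v.PointsOK) (hround : v.round = w.round) (hpoint : v.point = w.point)
    (hF : w.faulty ⊆ v.faulty) (h1 : 1 ≤ h) (hL : h ≤ L)
    (hp : v.point h (groupIdx h i) = i ∨ v.point h (groupIdx h i) ∈ v.faulty) :
    MoveSpec i w h rep (resume n i v h) := by
  refine ⟨hround, hF, fun g g1 gL k y hy hlt => ?_, fun g hg hgL => ?_⟩
  · by_cases hc : g = h ∧ k = groupIdx h i
    · obtain ⟨rfl, rfl⟩ := hc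
      rw [← hpoint] at hlt
      exact hok.advance_skip g1 gL hp hy hlt
    · have : (resume n i v h).1.point g k = w.point g k := by
        rw [← hpoint]
        exact View.advance_point_of_ne _ _ _ _ hc
      rw [this, cd_self] at hlt
      omega
  · rcases Nat.lt_or_ge h g with hlt | hge
    · refine Or.inr (Or.inl ⟨hlt, ?_⟩)
      rw [← hpoint]
      exact View.advance_point_of_ne _ _ _ _ fun hc => by omega
    · exact Or.inl (enter_skipped hg hge)

theorem execute_moveSpec {n r : ℕ} {i : Proc L} {replied : Proc L → Bool} {v : View L} {a : Ctrl L}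
    (hv : v.Good n r i) (ha : a.IsActive) (hok : a.OK n i v) (hnr : ∀ h q, a ≠ .report h q) :
    MoveSpec i v a.level (fun h q => a = .await h q ∧ replied q = true)
      (execute n r i replied v a) := by
  cases a with
  | inactive d => exact absurd ha id
  | halted => exact absurd ha id
  | report h q => exact absurd rfl (hnr h q)
  | poll h q =>
    exact moveSpec_of_eq rfl (Finset.Subset.refl _) rfl fun g hg _ => Or.inr (Or.inl hg)
  | work u =>
    have key : ∀ (rep : ℕ → Proc L → Prop) (x : View L × Ctrl L), x.1 = v.workDone r u →
        MoveSpec i v (Ctrl.work u : Ctrl L).level rep x := by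
      intro rep x hx
      refine moveSpec_of_eq (by rw [hx]; rfl) (by rw [hx]; exact Finset.Subset.refl _)
        (by rw [hx]; rfl) fun g hg _ => Or.inr (Or.inl ?_)
      simp only [Ctrl.level]
      omega
    simp only [execute]
    split_ifs
    · split
      · exact key _ (_, _) rfl
      · exact key _ (_, _) rfl
    · exact key _ (_, _) rfl
  | await h q =>
    obtain ⟨h1, hL, ht⟩ := hok
    -- As before, the pointer stands at the failed process or at one that was skipped.
    have hpt : (v.addFaulty q).point h (groupIdx h i) = i ∨
        (v.addFaulty q).point h (groupIdx h i) ∈ (v.addFaulty q).faulty := by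
      simp only [View.target] at ht
      split_ifs at ht with hc
      · right
        cases ht
        exact Finset.mem_insert_self _ _
      · simp only [View.addFaulty, Finset.mem_insert]
        tauto
    have key : MoveSpec i v (Ctrl.await h q).level
        (fun g p => Ctrl.await h q = .await g p ∧ replied p = true)
        (resume n i (v.addFaulty q) h) :=
      resume_moveSpec hv.points rfl rfl (Finset.subset_insert _ _) h1 hL hpt
    simp only [execute]
    split_ifs with hr h0
    · refine moveSpec_of_eq rfl (Finset.Subset.refl _) rfl fun g hg hgL => ?_
      rcases Nat.lt_trichotomy g h with hlt | rfl | hgt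
      · exact Or.inl (enter_skipped hg (by omega))
      · exact Or.inr (Or.inr ⟨q, ⟨rfl, hr⟩, rfl⟩)
      · exact Or.inr (Or.inl hgt)
    · exact key
    · split
      · refine moveSpec_of_eq rfl (Finset.subset_insert _ _) rfl fun g hg hgL => ?_
        simp only [Ctrl.level] at hg ⊢
        exact Or.inr (Or.inl (by omega))
      · exact key

theorem execute_report_moveSpec {n r : ℕ} {i : Proc L} {replied : Proc L → Bool} {v : View L}
    (hv : v.Good n r i) {h : ℕ} {q : Proc L} (hok : (Ctrl.report h q).OK n i v) :
    MoveSpec i (afterReport r i v h q) (h - 1) (fun _ _ => False)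
      (execute n r i replied v (.report h q)) := by
  obtain ⟨h1, hL, ht, -, hpt⟩ := hok
  have hg := (hv.afterReport (r := r) (hv.points.target_some h1 hL ht).1).points
  simp only [execute]
  split_ifs with h0
  · subst h0
    exact moveSpec_of_eq rfl (Finset.Subset.refl _) rfl fun g hg _ => Or.inr (Or.inl (by omega))
  · refine resume_moveSpec hg rfl rfl (Finset.Subset.refl _) (by omega) (by omega) ?_
    have : (afterReport r i v h q).point (h - 1) (groupIdx (h - 1) i) =
        v.point (h - 1) (groupIdx (h - 1) i) :=
      View.advance_point_of_ne (v.setRound i h r) _ _ _ fun hc => by omega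
    rw [this]
    exact hpt (by omega)

/-- Process `i` is inactive, and not retired. -/
def Waiting (A : Crashes L) (r : ℕ) (c : Config L) (i : Proc L) : Prop := ∃ d, Waits A r c i d

/-- In round `a < r` an ordinary message was sent to `p`, a member of group `k` of level `h`, by
another member of this group. -/
def ReportTo (n : ℕ) (A : Crashes L) (r h k a : ℕ) (p : Proc L) : Prop :=
  1 ≤ a ∧ a < r ∧ groupIdx h p = k ∧ ∃ s, Reports A a (config n A a) h s p

/-- The invariant on pointers. -/
structure PointerInv (n : ℕ) (A : Crashes L) (r : ℕ) (c : Config L) (H : Proc L → Set ℕ) :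
    Prop where
  pointers : ∀ h k, 1 ≤ h → h ≤ L → Pointers h k (Alive A r c) (Waiting A r c)
    (fun i => (c i).view) H (ReportTo n A r h k)
  passed : ∀ s, Active A r c s → ∀ h, (c s).ctrl.level < h → h ≤ L →
    Passed h (groupIdx h s) (Alive A r c) (Waiting A r c) (fun i => (c i).view) H
      (ReportTo n A r h (groupIdx h s)) s

theorem Active.not_waiting {A : Crashes L} {r : ℕ} {c : Config L} {i : Proc L}
    (h : Active A r c i) : ¬Waiting A r c i := fun ⟨_, h0⟩ => h0.not_active h

section

variable {n r : ℕ} {A : Crashes L} {c : Config L} {H : Proc L → Set ℕ}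

theorem PointerInv.wake (hP : PointerInv n A r c H) (hc : Core n A r c H) :
    PointerInv n A r (wakeAll n r c) H := by
  have hA : ∀ j, Alive A r (wakeAll n r c) j → Alive A r c j := fun j hj => hj.of_wakeAll
  have hW : ∀ j, Waiting A r (wakeAll n r c) j → Waiting A r c j ∧ Alive A r (wakeAll n r c) j :=
    fun j ⟨d, hj⟩ => ⟨⟨d, hj.of_wakeAll⟩, hj.alive⟩
  have hp : ∀ h k, 1 ≤ h → h ≤ L → Pointers h k (Alive A r (wakeAll n r c))
      (Waiting A r (wakeAll n r c)) (fun i => (wakeAll n r c i).view) H (ReportTo n A r h k) :=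
    fun h k h1 hL => (hP.pointers h k h1 hL).shrink hA hW (fun j _ => wakeAll_view j)
      (fun j _ => rfl) fun a p => Iff.rfl
  refine ⟨hp, fun s hs h hl hL => ?_⟩
  rcases hc.active_wakeAll hs with ⟨h1, h2⟩ | ⟨h1, h2⟩
  · rw [h2] at hl
    exact (hP.passed s h1 h hl hL).shrink hA hW (fun j _ => wakeAll_view j)
      (fun j _ => rfl) (fun a p => Iff.rfl) hs.alive
  · rw [h2] at hl
    have ht := enter_skipped hl hL
    have h1' : 1 ≤ h := by omega
    refine (hp h _ h1' hL).passed_of_none h1' hL rfl (hc.wake.good s hs.alive).points hs.alive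
      (fun a p hra => hra.2.2.1) ?_
    simp only [wakeAll_view]
    exact ht

end

section

variable {n r : ℕ} {A : Crashes L}

theorem reportTo_succ (hr : 1 ≤ r) (h k a : ℕ) (p : Proc L) : ReportTo n A (r + 1) h k a p ↔
    ReportTo n A r h k a p ∨
      (a = r ∧ groupIdx h p = k ∧ ∃ s, Reports A r (config n A r) h s p) := by
  constructor
  · rintro ⟨h1, h2, h3, h4⟩
    rcases Nat.lt_succ_iff_lt_or_eq.1 h2 with h0 | rfl
    · exact Or.inl ⟨h1, h0, h3, h4⟩
    · exact Or.inr ⟨rfl, h3, h4⟩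
  · rintro (⟨h1, h2, h3, h4⟩ | ⟨rfl, h3, h4⟩)
    · exact ⟨h1, h2.trans (Nat.lt_succ_self r), h3, h4⟩
    · exact ⟨hr, Nat.lt_succ_self a, h3, h4⟩

theorem waiting_of_step (hr : 1 ≤ r) {j : Proc L}
    (hj : Waiting A (r + 1) (execution n A (r + 1)) j) : Waiting A r (config n A r) j := by
  obtain ⟨d, hj⟩ := hj
  rw [execution_succ hr] at hj
  obtain ⟨e, he, -⟩ := (core_config n A hr).waits_of_step hj
  exact ⟨e, he⟩

theorem alive_of_step (hr : 1 ≤ r) {j : Proc L}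
    (hj : Alive A (r + 1) (execution n A (r + 1)) j) : Alive A r (config n A r) j := by
  rw [execution_succ hr] at hj
  exact hj.of_step

theorem config_view (i : Proc L) : (config n A r i).view = (execution n A r i).view :=
  wakeAll_view i

/-- The last part of a round: the active process goes on, with the view `w`. -/
theorem PointerInv.of_move (hr : 1 ≤ r) {s : Proc L} (hs : Active A r (config n A r) s)
    {V : Proc L → View L} {l : ℕ} {rep : ℕ → Proc L → Prop}
    (hP : ∀ h k, 1 ≤ h → h ≤ L → Pointers h k (Alive A r (config n A r))
      (Waiting A r (config n A r)) V (history n A (r + 1)) (ReportTo n A (r + 1) h k))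
    (hpass : ∀ h, l < h → h ≤ L → Passed h (groupIdx h s) (Alive A r (config n A r))
      (Waiting A r (config n A r)) V (history n A (r + 1)) (ReportTo n A (r + 1) h (groupIdx h s))
      s)
    (hV : ∀ j, j ≠ s → Alive A (r + 1) (execution n A (r + 1)) j →
      (execution n A (r + 1) j).view = V j)
    (hok : (V s).PointsOK)
    (hmax : ∀ j, Alive A r (config n A r) j → ∀ h k, (V j).round h k ≤ (V s).round h k)
    (hmove : MoveSpec s (V s) l rep
      ((execution n A (r + 1) s).view, (execution n A (r + 1) s).ctrl))
    (hrep : ∀ h q, rep h q → 1 ≤ h → h ≤ L → Passed h (groupIdx h s) (Alive A r (config n A r))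
      (Waiting A r (config n A r)) V (history n A (r + 1)) (ReportTo n A (r + 1) h (groupIdx h s))
      s) :
    PointerInv n A (r + 1) (execution n A (r + 1)) (history n A (r + 1)) := by
  have hc' := core_execution n A (r := r + 1) (by omega)
  have hA : ∀ j, Alive A (r + 1) (execution n A (r + 1)) j → Alive A r (config n A r) j :=
    fun j => alive_of_step hr
  have hW : ∀ j, Waiting A (r + 1) (execution n A (r + 1)) j → Waiting A r (config n A r) j ∧
      Alive A (r + 1) (execution n A (r + 1)) j :=
    fun j hj => ⟨waiting_of_step hr hj, hj.elim fun d h => h.alive⟩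
  have hWA : ∀ j, Waiting A (r + 1) (execution n A (r + 1)) j →
      Alive A (r + 1) (execution n A (r + 1)) j := fun j hj => (hW j hj).2
  have hsW : ¬Waiting A (r + 1) (execution n A (r + 1)) s := fun h0 =>
    hs.not_waiting (waiting_of_step hr h0)
  have hRk : ∀ {h k}, ∀ a p, ReportTo n A (r + 1) h k a p → groupIdx h p = k :=
    fun a p hra => hra.2.2.1
  by_cases hsA : Alive A (r + 1) (execution n A (r + 1)) s
  · -- the new views
    -- Retired processes keep their old views in `W`, so that only the view of `s` changes, as
    -- `Pointers.move` and `Passed.grow` require.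
    set W : Proc L → View L := fun j => if j = s then (execution n A (r + 1) s).view else V j
      with hWdef
    have hWs : W s = (execution n A (r + 1) s).view := if_pos rfl
    have hWj : ∀ j, j ≠ s → W j = V j := fun j hj => if_neg hj
    have hWV : ∀ j, Alive A (r + 1) (execution n A (r + 1)) j →
        (execution n A (r + 1) j).view = W j := by
      intro j hj
      by_cases hjs : j = s
      · rw [hjs, hWs]
      · rw [hWj j hjs, hV j hjs hj]
    have hsound : ∀ x, x ∈ (W s).faulty → ¬Alive A (r + 1) (execution n A (r + 1)) x := by
      intro x hx
      rw [hWs] at hx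
      exact hc'.sound s x hsA hx
    have hround : ∀ h k, (W s).round h k = (V s).round h k := fun h k => by
      rw [hWs]
      exact congrFun (congrFun hmove.round h) k
    have hF : (V s).faulty ⊆ (W s).faulty := by
      rw [hWs]
      exact hmove.faulty
    have hokW : (W s).PointsOK := by
      rw [hWs]
      exact (hc'.good s hsA).points
    have hPmove : ∀ h k, 1 ≤ h → h ≤ L → Pointers h k (Alive A (r + 1) (execution n A (r + 1)))
        (Waiting A (r + 1) (execution n A (r + 1))) W (history n A (r + 1))
        (ReportTo n A (r + 1) h k) := by
      intro h k h1 hL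
      refine ((hP h k h1 hL).shrink hA hW (fun j _ => rfl) (fun j _ => rfl)
        fun a p => Iff.rfl).move hWA hsA hsW (fun j hj => hmax j (hA j hj) h k)
        (fun x hx => hx ▸ hok h h1 hL x) hRk hWj (hround h k) hF hsound fun x hx hlt => ?_
      rw [hWs] at hlt ⊢
      exact hmove.skip h h1 hL k x hx hlt
    have hPfin : ∀ h k, 1 ≤ h → h ≤ L → Pointers h k (Alive A (r + 1) (execution n A (r + 1)))
        (Waiting A (r + 1) (execution n A (r + 1))) (fun i => (execution n A (r + 1) i).view)
        (history n A (r + 1)) (ReportTo n A (r + 1) h k) :=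
      fun h k h1 hL => (hPmove h k h1 hL).shrink (fun j hj => hj) (fun j hj => ⟨hj, hWA j hj⟩) hWV
        (fun j _ => rfl) fun a p => Iff.rfl
    refine ⟨hPfin, fun s' hs' h hl hL => ?_⟩
    have hs'S : Active A r (config n A r) s' := by
      rw [execution_succ hr] at hs'
      exact Active.of_step hs'
    obtain rfl := (core_config n A hr).single s s' hs hs'S
    have h1 : 1 ≤ h := by omega
    rcases hmove.levels h hl hL with ht | ⟨hlh, hpt⟩ | ⟨q, hq, heq⟩
    · exact (hPfin h _ h1 hL).passed_of_none h1 hL rfl (hc'.good s hsA).points hsA hRk ht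
    · have hp1 := (hpass h hlh hL).shrink hA hW (fun j _ => rfl) (fun j _ => rfl)
        (fun a p => Iff.rfl) hsA
      refine (hp1.grow (V' := W) h1 hL rfl hok hokW hWA hsW hWj (hround h _) ?_ hF hsound).shrink
        (fun j hj => hj) (fun j hj => ⟨hj, hWA j hj⟩) hWV (fun j _ => rfl) (fun a p => Iff.rfl) hsA
      rw [hWs]
      exact hpt
    · refine (hrep h q hq h1 hL).shrink hA hW (fun j hj => ?_) (fun j _ => rfl)
        (fun a p => Iff.rfl) hsA
      by_cases hjs : j = s
      · rw [hjs]
        exact heq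
      · exact hV j hjs hj
  · refine ⟨fun h k h1 hL => (hP h k h1 hL).shrink hA hW (fun j hj => hV j ?_ hj)
      (fun j _ => rfl) fun a p => Iff.rfl, fun s' hs' => ?_⟩
    · rintro rfl
      exact hsA hj
    · have hs'S : Active A r (config n A r) s' := by
        have h2 := hs'
        rw [execution_succ hr] at h2
        exact Active.of_step h2
      obtain rfl := (core_config n A hr).single s s' hs hs'S
      exact absurd hs'.alive hsA

/-! ### Rounds with and without an ordinary message -/

theorem afterReport_round_self (r : ℕ) (i : Proc L) (v : View L) (h : ℕ) (q : Proc L) :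
    (afterReport r i v h q).round h (groupIdx h i) = r := by
  simp [afterReport, View.advance, View.setRound]

theorem afterReport_round_other (r : ℕ) (i : Proc L) (v : View L) {h g k : ℕ} (q : Proc L)
    (hne : ¬(g = h ∧ k = groupIdx h i)) : (afterReport r i v h q).round g k = v.round g k := by
  simp only [afterReport, View.advance, View.setRound, if_neg hne]

theorem afterReport_point_other (r : ℕ) (i : Proc L) (v : View L) {h g k : ℕ} (q : Proc L)
    (hne : ¬(g = h ∧ k = groupIdx h i)) : (afterReport r i v h q).point g k = v.point g k :=
  View.advance_point_of_ne (v.setRound i h r) _ _ _ hne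

theorem history_succ_of_no_report (hr : 1 ≤ r) (hn : ∀ h s q, ¬Reports A r (config n A r) h s q)
    {j : Proc L} (hj : Alive A (r + 1) (execution n A (r + 1)) j) :
    history n A (r + 1) j = history n A r j := by
  rw [history_succ hr]
  refine nextHist_no_message (fun g s => hn g s j) fun g q hg => hn g j q ⟨hg, Or.inl ?_⟩
  exact lt_crash_of_alive_succ hj

theorem PointerInv.step_silent (hr : 1 ≤ r)
    (hP : PointerInv n A r (config n A r) (history n A r))
    (hn : ∀ h s q, ¬Reports A r (config n A r) h s q) :
    PointerInv n A (r + 1) (execution n A (r + 1)) (history n A (r + 1)) := by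
  have hc := core_config n A hr
  have hR : ∀ {h k}, ∀ a p, ReportTo n A (r + 1) h k a p ↔ ReportTo n A r h k a p := by
    intro h k a p
    rw [reportTo_succ hr]
    exact or_iff_left fun ⟨_, _, s, h0⟩ => hn h s p h0
  have hA : ∀ j, Alive A (r + 1) (execution n A (r + 1)) j → Alive A r (config n A r) j :=
    fun j => alive_of_step hr
  have hW : ∀ j, Waiting A (r + 1) (execution n A (r + 1)) j → Waiting A r (config n A r) j ∧
      Alive A (r + 1) (execution n A (r + 1)) j :=
    fun j hj => ⟨waiting_of_step hr hj, hj.elim fun d h => h.alive⟩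
  have hV : ∀ j, ¬Active A r (config n A r) j → Alive A (r + 1) (execution n A (r + 1)) j →
      (execution n A (r + 1) j).view = (config n A r j).view := by
    intro j hj hj'
    rcases (hA j hj').active_or_waits with h0 | ⟨d, h0⟩
    · exact absurd h0 hj
    · rw [execution_succ hr, config_view]
      exact (step_waits h0 fun g s => hn g s j).1
  by_cases hs : ∃ s, Active A r (config n A r) s
  · obtain ⟨s, hs⟩ := hs
    have hjs : ∀ j, j ≠ s → ¬Active A r (config n A r) j := fun j hj h0 => hj (hc.single j s h0 hs)
    by_cases hsA : Alive A (r + 1) (execution n A (r + 1)) s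
    · have hnr : ∀ h q, (config n A r s).ctrl ≠ .report h q := fun h q h0 =>
        hn h s q ⟨h0, Or.inl (lt_crash_of_alive_succ hsA)⟩
      have hgood := hc.good s hs.alive
      have hmove := execute_moveSpec (replied := replied n A r (execution n A r) s) hgood hs.2
        (hc.ok s hs) hnr
      rw [config_view, show (config n A r s).ctrl = (wakeAll n r (execution n A r) s).ctrl from rfl,
        ← (hc.step_active hs).1, ← execution_succ hr, ← config_view] at hmove
      -- histories of processes that crash in this round do not matter
      have hshrink : ∀ j, Alive A (r + 1) (execution n A (r + 1)) j →
        history n A (r + 1) j = history n A r j := fun j => history_succ_of_no_report hr hn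
      have hH' : ∀ j, ¬Active A r (config n A r) j → Alive A r (config n A r) j →
          history n A (r + 1) j = history n A r j := by
        intro j hj hj'
        rw [history_succ hr]
        refine nextHist_no_message (fun g s => hn g s j) fun g q hg => hj ⟨hj'.1, ?_⟩
        rw [hg]
        trivial
      have hHall : ∀ j, Alive A r (config n A r) j → history n A (r + 1) j = history n A r j := by
        intro j hj
        by_cases h0 : Active A r (config n A r) j
        · obtain rfl := hc.single j s h0 hs
          exact hshrink j hsA
        · exact hH' j h0 hj
      have hWA : ∀ j, Waiting A r (config n A r) j →
          Waiting A r (config n A r) j ∧ Alive A r (config n A r) j :=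
        fun j hj => ⟨hj, hj.elim fun d h0 => h0.alive⟩
      refine PointerInv.of_move hr hs (V := fun j => (config n A r j).view)
        (fun h k h1 hL => (hP.pointers h k h1 hL).shrink (fun j hj => hj) hWA (fun j _ => rfl) hHall
          hR)
        (fun h hl hL => (hP.passed s hs h hl hL).shrink (fun j hj => hj) hWA (fun j _ => rfl) hHall
          hR hs.alive)
        (fun j hj => hV j (hjs j hj)) hgood.points
        (fun j hj h k => (hc.below s j hs hj).1.2.2.2.2 h k) hmove ?_
      rintro h q ⟨hq, hrep⟩ h1 hL
      have hok := hc.ok s hs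
      rw [show (config n A r s).ctrl = .await h q from hq] at hok
      obtain ⟨-, hqs, -⟩ := hgood.points.target_some h1 hL hok.2.2
      have hq1 := replied_iff.1 hrep
      -- The replying process is not retired, and only `s` is active.
      have hqw : Waiting A r (config n A r) q := by
        rcases Alive.active_or_waits (A := A) (r := r) (c := config n A r) (i := q)
          ⟨hq1.1.le, hq1.2.1⟩ with h0 | h0
        · exact absurd (hc.single q s h0 hs) hqs
        · exact h0
      exact ((hP.pointers h _ h1 hL).passed_of_reply h1 hL rfl hgood.points hs.alive
        (fun j hj => (hWA j hj).2) hs.not_waiting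
        (fun j hj => (hc.below s j hs hj).1.2.2.2.2 h _) (fun a p hra => hra.2.2.1)
        (fun x hx => hc.sound s x hs.alive hx) hok.2.2 hqw).shrink (fun j hj => hj) hWA
          (fun j _ => rfl) hHall hR hs.alive
    · refine ⟨fun h k h1 hL => (hP.pointers h k h1 hL).shrink hA hW (fun j hj => hV j ?_ hj)
        (fun j => history_succ_of_no_report hr hn) hR, fun s' hs' => ?_⟩
      · refine hjs j ?_
        rintro rfl
        exact hsA hj
      · have h2 := hs'
        rw [execution_succ hr] at h2
        obtain rfl := hc.single s s' hs (Active.of_step h2)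
        exact absurd hs'.alive hsA
  · have hna : ∀ j, ¬Active A r (config n A r) j := fun j hj => hs ⟨j, hj⟩
    refine ⟨fun h k h1 hL => (hP.pointers h k h1 hL).shrink hA hW (fun j => hV j (hna j))
      (fun j => history_succ_of_no_report hr hn) hR, fun s' hs' => ?_⟩
    rw [execution_succ hr] at hs'
    exact absurd (Active.of_step hs') (hna s')

/-- The round is split: first the message takes effect at both ends, giving the views `V`, and then
the code of the sender moves its pointers on. Only the group to which the message is sent gets a new
round number; for all other groups the message merely spreads pointers. -/
theorem PointerInv.step_report (hr : 1 ≤ r)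
    (hP : PointerInv n A r (config n A r) (history n A r)) {h₀ : ℕ} {s q : Proc L}
    (hrep : Reports A r (config n A r) h₀ s q) :
    PointerInv n A (r + 1) (execution n A (r + 1)) (history n A (r + 1)) := by
  have hc := core_config n A hr
  have hs := hrep.active
  have hgood := hc.good s hs.alive
  have hok := hc.ok s hs
  rw [hrep.1] at hok
  have hmove := execute_report_moveSpec (r := r)
    (replied := replied n A r (execution n A r) s) hgood hok
  obtain ⟨h1₀, hL₀, ht, -, -⟩ := hok
  obtain ⟨hqg, hqs, hqF, hbef⟩ := hgood.points.target_some h1₀ hL₀ ht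
  have hexec := (hc.step_active hs).1
  rw [show (wakeAll n r (execution n A r) s).ctrl = .report h₀ q from hrep.1,
    ← execution_succ hr] at hexec
  rw [config_view, ← hexec, ← config_view] at hmove
  set w := afterReport r s (config n A r s).view h₀ q with hw
  have hlew : (config n A r s).view.Le w := View.le_afterReport hgood.before s h₀ q
  obtain ⟨hzg, hzs, hzF, hskip⟩ := View.advance_past (v := (config n A r s).view.setRound s h₀ r)
    h1₀ hL₀ hqg ⟨hqs, hqF⟩
  have hunique : ∀ g i p, Reports A r (config n A r) g i p → g = h₀ ∧ i = s ∧ p = q := by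
    intro g i p h0
    obtain rfl := hc.single i s h0.active hs
    have := h0.1.symm.trans hrep.1
    cases this
    exact ⟨rfl, rfl, rfl⟩
  have hle : ∀ j, Alive A r (config n A r) j → (config n A r j).view.Le w :=
    fun j hj => (hc.below s j hs hj).1.trans hlew
  have hmaxH : ∀ j, Alive A r (config n A r) j → history n A r j ⊆ history n A r s :=
    fun j hj => (hc.below s j hs hj).2
  have hmax : ∀ j, Alive A r (config n A r) j → ∀ h k,
      (config n A r j).view.round h k ≤ (config n A r s).view.round h k :=
    fun j hj => (hc.below s j hs hj).1.2.2.2.2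
  have hWA : ∀ j, Waiting A r (config n A r) j → Alive A r (config n A r) j :=
    fun j hj => hj.elim fun d h0 => h0.alive
  have hsound : ∀ x, x ∈ (config n A r s).view.faulty → ¬Alive A r (config n A r) x :=
    fun x => hc.sound s x hs.alive
  -- the views after the message has been sent and received
  set V : Proc L → View L := fun j => if j = s then w else if j = q then
    (config n A r q).view.merge w else (config n A r j).view with hVdef
  have hVs : V s = w := if_pos rfl
  have hVq : V q = (config n A r q).view.merge w := by
    rw [hVdef]; exact (if_neg hqs).trans (if_pos rfl)
  have hVj : ∀ j, j ≠ s → j ≠ q → V j = (config n A r j).view := fun j h1 h2 => by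
    rw [hVdef]; simp only; rw [if_neg h1, if_neg h2]
  have hHj : ∀ j, j ≠ s → j ≠ q → Alive A r (config n A r) j →
      history n A (r + 1) j = history n A r j := by
    intro j h1 h2 hj
    rw [history_succ hr]
    refine nextHist_no_message (fun g i h0 => h2 (hunique g i j h0).2.2) fun g p h0 => h1 ?_
    exact hc.single j s ⟨hj.1, by rw [h0]; trivial⟩ hs
  have hHs : history n A (r + 1) s = insert r (history n A r s) := by
    rw [history_succ hr]
    ext a
    constructor
    · rintro (h0 | ⟨rfl, -⟩ | ⟨i, g, h0, -⟩)
      · exact Or.inr h0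
      · exact Or.inl rfl
      · exact absurd (hunique g i s h0).2.2.symm hqs
    · rintro (rfl | h0)
      · exact mem_nextHist_of_report hrep.1
      · exact subset_nextHist s h0
  have hHq : Alive A r (config n A r) q →
      history n A (r + 1) q = insert r (history n A r s) := by
    intro hq
    rw [history_succ hr]
    ext a
    constructor
    · rintro (h0 | ⟨rfl, -⟩ | ⟨i, g, h0, h2⟩)
      · exact Or.inr (hmaxH q hq h0)
      · exact Or.inl rfl
      · obtain ⟨-, rfl, -⟩ := hunique g i q h0
        exact h2.symm
    · exact fun h0 => Or.inr (Or.inr ⟨s, h₀, hrep, h0.symm⟩)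
  -- all that concerns processes that have retired is irrelevant
  set Hn : Proc L → Set ℕ := fun j => if j = s ∨ j = q then insert r (history n A r s) else
    history n A r j with hHn
  have hHnj : ∀ j, j ≠ s → j ≠ q → Hn j = history n A r j := fun j h1 h2 => by
    rw [hHn]; simp only; rw [if_neg (not_or.2 ⟨h1, h2⟩)]
  have hHns : Hn s = insert r (history n A r s) := if_pos (Or.inl rfl)
  have hHnq : Hn q = insert r (history n A r s) := if_pos (Or.inr rfl)
  have hHfin : ∀ j, Alive A r (config n A r) j → history n A (r + 1) j = Hn j := by
    intro j hj
    by_cases h1 : j = s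
    · rw [h1, hHs, hHns]
    · by_cases h2 : j = q
      · subst h2
        rw [hHq hj, hHnq]
      · rw [hHj j h1 h2 hj, hHnj j h1 h2]
  have hWA' : ∀ j, Waiting A r (config n A r) j →
      Waiting A r (config n A r) j ∧ Alive A r (config n A r) j := fun j hj => ⟨hj, hWA j hj⟩
  have hRsame : ∀ a p, ReportTo n A (r + 1) h₀ (groupIdx h₀ s) a p ↔
      ReportTo n A r h₀ (groupIdx h₀ s) a p ∨ (a = r ∧ p = q) := by
    intro a p
    rw [reportTo_succ hr]
    refine or_congr Iff.rfl ⟨?_, ?_⟩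
    · rintro ⟨rfl, -, i, h0⟩
      exact ⟨rfl, (hunique _ _ _ h0).2.2⟩
    · rintro ⟨rfl, rfl⟩
      exact ⟨rfl, hqg, s, hrep⟩
  have hRother : ∀ h k, ¬(h = h₀ ∧ k = groupIdx h₀ s) → ∀ a p,
      ReportTo n A (r + 1) h k a p ↔ ReportTo n A r h k a p := by
    intro h k hne a p
    rw [reportTo_succ hr]
    refine or_iff_left ?_
    rintro ⟨rfl, hk, i, h0⟩
    obtain ⟨rfl, rfl, rfl⟩ := hunique _ _ _ h0
    exact hne ⟨rfl, hk.symm.trans hqg⟩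
  have hown : ∀ j, Alive A r (config n A r) j → j = s ∨ j = q →
      (V j).round h₀ (groupIdx h₀ s) = r ∧ (V j).point h₀ (groupIdx h₀ s) =
        w.point h₀ (groupIdx h₀ s) ∧ (V j).faulty = (config n A r s).view.faulty ∧
        Hn j = insert r (history n A r s) := by
    rintro j hj (rfl | rfl)
    · rw [hVs]
      exact ⟨afterReport_round_self _ _ _ _ _, rfl, rfl, hHns⟩
    · rw [hVq]
      refine ⟨(hle j hj).merge_round _ _ |>.trans (afterReport_round_self _ _ _ _ _), ?_,
        (hle j hj).merge_faulty, hHnq⟩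
      simp only [View.merge]
      rw [if_pos]
      rw [hw, afterReport_round_self]
      exact (hc.good j hj).before.2 _ _
  have hother : ∀ h k, ¬(h = h₀ ∧ k = groupIdx h₀ s) →
      ((V s).round h k = (config n A r s).view.round h k ∧
        (V s).point h k = (config n A r s).view.point h k ∧
        (V s).faulty = (config n A r s).view.faulty ∧ Hn s = insert r (history n A r s)) ∧
      (Alive A r (config n A r) q → (V q).round h k = (config n A r s).view.round h k ∧
        (V q).point h k = (if (config n A r q).view.round h k < (config n A r s).view.round h k then
          (config n A r s).view.point h k else (config n A r q).view.point h k) ∧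
        (V q).faulty = (config n A r s).view.faulty ∧ Hn q = insert r (history n A r s)) := by
    intro h k hne
    have e1 : w.round h k = (config n A r s).view.round h k := afterReport_round_other _ _ _ _ hne
    have e2 : w.point h k = (config n A r s).view.point h k := afterReport_point_other _ _ _ _ hne
    refine ⟨?_, fun hq => ?_⟩
    · rw [hVs]
      exact ⟨e1, e2, rfl, hHns⟩
    · rw [hVq]
      refine ⟨(hle q hq).merge_round _ _ |>.trans e1, ?_, (hle q hq).merge_faulty, hHnq⟩
      simp only [View.merge, e1, e2]
  have hbefore : ∀ h k j, Alive A r (config n A r) j → (config n A r j).view.round h k < r :=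
    fun h k j hj => (hc.good j hj).before.2 h k
  have hpassed : ∀ h, h₀ - 1 < h → h ≤ L → Passed h (groupIdx h s) (Alive A r (config n A r))
      (Waiting A r (config n A r)) (fun i => (config n A r i).view) (history n A r)
      (ReportTo n A r h (groupIdx h s)) s := fun h hl hL => hP.passed s hs h
        (by rw [hrep.1]; exact hl) hL
  have hPV : ∀ h k, 1 ≤ h → h ≤ L → Pointers h k (Alive A r (config n A r))
      (Waiting A r (config n A r)) V Hn (ReportTo n A (r + 1) h k) := by
    intro h k h1 hL
    by_cases hk : h = h₀ ∧ k = groupIdx h₀ s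
    · obtain ⟨rfl, rfl⟩ := hk
      exact (hP.pointers h _ h1 hL).report (s := s) (q := q) (r := r) hs.alive hWA hs.not_waiting
        hmaxH (fun a p hra => hra.2.2.1) hsound (hbefore _ _) (fun j a hj => hc.hist j a hj)
        (hgood.points h h1 hL s) hqg (hpassed h (by omega) hL) ht hbef hskip
        (fun a p hra => hra.2.1) hVj hHnj hown hRsame
    · obtain ⟨o1, o2⟩ := hother h k hk
      refine ((hP.pointers h k h1 hL).report_other (s := s) (q := q) (r := r) hs.alive hqs hWA
        hs.not_waiting (fun j hj => hmax j hj h k) hmaxH (fun j a hj => hc.hist j a hj)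
        (fun a p hra => hra.2.1) (fun a p hra => hra.1) (fun hq => (hc.below s q hs hq).1.1) hVj
        hHnj o1 o2).shrink (fun j hj => hj) hWA' (fun j _ => rfl) (fun j _ => rfl) (hRother h k hk)
  refine PointerInv.of_move hr hs (V := V) (l := h₀ - 1) (rep := fun _ _ => False)
    (fun h k h1 hL => (hPV h k h1 hL).shrink (fun j hj => hj) hWA' (fun j _ => rfl) hHfin
      fun a p => Iff.rfl) (fun h hl hL => ?_) (fun j hj hj' => ?_) ?_ (fun j hj h k => ?_) ?_
    fun h q h0 => h0.elim
  · refine Passed.shrink (V := V) (H := Hn) (R := ReportTo n A (r + 1) h (groupIdx h s)) ?_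
      (fun j hj => hj) hWA' (fun j _ => rfl) hHfin (fun a p => Iff.rfl) hs.alive
    have h1 : 1 ≤ h := by omega
    by_cases hk : h = h₀
    · subst hk
      exact (hpassed h hl hL).report (q := q) (r := r) hWA hsound (hbefore _ _) rfl hs.alive ht
        ⟨hzs, hzF⟩ hskip hVj hown hRsame
    · have hk' : ¬(h = h₀ ∧ groupIdx h s = groupIdx h₀ s) := fun h0 => hk h0.1
      obtain ⟨o1, o2⟩ := hother h _ hk'
      exact ((hpassed h hl hL).report_other (q := q) (r := r) h1 hL hs.alive hgood.points hWA
        hs.not_waiting rfl (fun j hj => hmax j hj h _) hsound hVj hqs o1 o2).shrink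
          (fun j hj => hj) hWA' (fun j _ => rfl) (fun j _ => rfl) (hRother h _ hk') hs.alive
  · rcases (alive_of_step hr hj').active_or_waits with h0 | ⟨d, h0⟩
    · exact absurd (hc.single j s h0 hs) hj
    · rw [execution_succ hr]
      by_cases h2 : j = q
      · subst h2
        rw [hVq]
        rw [(step_receives h0 hrep fun g i hi => (hunique g i j hi).2.1).1, ← config_view,
          ← config_view]
      · rw [hVj j hj h2, config_view]
        exact (step_waits h0 fun g i hi => h2 (hunique g i j hi).2.2).1
  · rw [hVs]
    exact (hgood.afterReport hqg).points
  · by_cases h1 : j = s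
    · rw [h1]
    · rw [hVs]
      by_cases h2 : j = q
      · subst h2
        rw [hVq, (hle j hj).merge_round]
      · rw [hVj j h1 h2]
        exact (hle j hj).2.2.2.2 h k
  · rw [hVs]
    exact hmove

/-! ### The pointer invariant in all rounds -/

theorem pointerInv_init (n : ℕ) (A : Crashes L) :
    PointerInv n A 1 (initConfig L n) fun _ => ∅ := by
  have hR : ∀ {h k a p}, ¬ReportTo n A 1 h k a p := fun ⟨h1, h2, _⟩ => by omega
  have hP : ∀ h k, 1 ≤ h → h ≤ L → Pointers h k (Alive A 1 (initConfig L n))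
      (Waiting A 1 (initConfig L n)) (fun i => (initConfig L n i).view) (fun _ => ∅)
      (ReportTo n A 1 h k) := by
    intro h k h1 hL
    -- The common place is the first process of the group; only that process itself starts one place
    -- further, having skipped itself.
    refine ⟨fun ρ => ⟨Fin.ofNat (2 ^ L) (groupSize L h * k), fun j _ _ x hx _ hlt => ?_⟩,
      fun j l _ _ h0 => absurd h0 (lt_irrefl 0), fun j a p _ h0 => absurd h0 hR,
      fun j a p _ h0 => absurd h0 hR, fun j l ρ a _ _ h0 => absurd h0 (Set.notMem_empty _),
      fun j _ => Or.inl rfl, fun j a p _ h0 => absurd h0 hR, fun a p h0 => absurd h0 hR⟩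
    obtain ⟨c, hc⟩ := groupSize_dvd (L := L) h1 hL
    have hkc : k < c := by
      rw [← hx]
      exact Nat.div_lt_of_lt_mul (hc ▸ x.isLt)
    have hs := groupSize_pos L h
    have h2 : 2 ≤ groupSize L h := by
      unfold groupSize
      calc 2 = 2 ^ 1 := rfl
        _ ≤ _ := Nat.pow_le_pow_right (by norm_num) (by omega)
    have hmul := Nat.mul_le_mul_left (groupSize L h) (Nat.succ_le_of_lt hkc)
    rw [Nat.mul_succ, ← hc] at hmul
    have hval : ∀ m, m < groupSize L h →
        ((Fin.ofNat (2 ^ L) (groupSize L h * k + m) : Proc L) : ℕ) = groupSize L h * k + m :=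
      fun m hm => Nat.mod_eq_of_lt (by omega)
    have hb : groupIdx h (Fin.ofNat (2 ^ L) (groupSize L h * k) : Proc L) = k :=
      groupIdx_of_val (hval 0 hs) hs
    simp only [initConfig, initView] at hlt
    split_ifs at hlt with h0
    · have hpos : ∀ m, m < groupSize L h →
          pos h (Fin.ofNat (2 ^ L) (groupSize L h * k + m) : Proc L) = m := fun m hm => by
        unfold pos
        rw [hval m hm, Nat.mul_add_mod, Nat.mod_eq_of_lt hm]
      have h3 : cd h (Fin.ofNat (2 ^ L) (groupSize L h * k))
          (Fin.ofNat (2 ^ L) (groupSize L h * k + 1) : Proc L) = 1 := by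
        unfold cd
        rw [hpos 1 h2, show pos h (Fin.ofNat (2 ^ L) (groupSize L h * k) : Proc L) = 0 from hpos 0 hs]
        rfl
      rw [h3, Nat.lt_one_iff] at hlt
      have h4 := cd_inj (hx.trans hb.symm) (hlt.trans (cd_self h _).symm)
      rw [h4]
      exact Fin.ext ((hval 0 hs).trans h0.symm)
    · rw [cd_self] at hlt
      omega
  refine ⟨hP, fun s hs h hl hL => ?_⟩
  rw [(initConfig_active hs).2] at hl
  have h1 : 1 ≤ h := by omega
  exact (hP h _ h1 hL).passed_of_none h1 hL rfl (initView_pointsOK s) hs.alive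
    (fun a p h0 => absurd h0 hR) (enter_skipped hl hL)

theorem pointerInv_execution (n : ℕ) (A : Crashes L) {r : ℕ} (hr : 1 ≤ r) :
    PointerInv n A r (execution n A r) (history n A r) := by
  induction r, hr using Nat.le_induction with
  | base => exact pointerInv_init n A
  | succ r hr ih =>
    have h1 : PointerInv n A r (config n A r) (history n A r) := ih.wake (core_execution n A hr)
    by_cases hn : ∃ h s q, Reports A r (config n A r) h s q
    · obtain ⟨h, s, q, hrep⟩ := hn
      exact h1.step_report hr hrep
    · exact h1.step_silent hr fun h s q h0 => hn ⟨h, s, q, h0⟩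

theorem pointerInv_config (n : ℕ) (A : Crashes L) {r : ℕ} (hr : 1 ≤ r) :
    PointerInv n A r (config n A r) (history n A r) :=
  (pointerInv_execution n A hr).wake (core_execution n A hr)

/-! ### The course of time -/

theorem config_ctrl_of_active {i : Proc L} (h : (execution n A r i).ctrl.IsActive) :
    (config n A r i).ctrl = (execution n A r i).ctrl := by
  rcases wakeAll_ctrl (n := n) (r := r) (c := execution n A r) i with ⟨h1, -⟩ | ⟨d, -, h2, -⟩
  · exact h1
  · rw [h2] at h
    exact absurd h id

theorem alive_of_succ (hr : 1 ≤ r) {j : Proc L} (hj : Alive A (r + 1) (config n A (r + 1)) j) :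
    Alive A r (config n A r) j := alive_of_step hr hj.of_wakeAll

theorem alive_of_le {a b : ℕ} (ha : 1 ≤ a) (hab : a ≤ b) {j : Proc L}
    (hj : Alive A b (config n A b) j) : Alive A a (config n A a) j := by
  induction b, hab using Nat.le_induction with
  | base => exact hj
  | succ b hb ih => exact ih (alive_of_succ (ha.trans hb) hj)

/-- The course of one round for the active process. -/
theorem active_succ (hr : 1 ≤ r) {i : Proc L} (hi : Active A r (config n A r) i) :
    ((execution n A (r + 1) i).view, (execution n A (r + 1) i).ctrl) =
      execute n r i (replied n A r (execution n A r) i) (config n A r i).view (config n A r i).ctrl ∧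
    ExecSpec n r i (replied n A r (execution n A r) i) (config n A r i).view (config n A r i).ctrl
      ((execution n A (r + 1) i).view, (execution n A (r + 1) i).ctrl) := by
  rw [execution_succ hr, config_view]
  exact (core_config n A hr).step_active hi

theorem active_of_succ (hr : 1 ≤ r) {i : Proc L} (hi : Active A r (config n A r) i)
    (hi' : Alive A (r + 1) (config n A (r + 1)) i) :
    Active A (r + 1) (config n A (r + 1)) i ∧
      (config n A (r + 1) i).ctrl = (execution n A (r + 1) i).ctrl ∧
      (config n A (r + 1) i).ctrl.level ≤ (config n A r i).ctrl.level := by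
  have h1 := (active_succ hr hi).2
  rcases h1.active with h2 | h2
  · have h3 := config_ctrl_of_active h2
    refine ⟨⟨hi'.1, ?_⟩, h3, ?_⟩
    · rw [h3]
      exact h2
    · rw [h3]
      exact h1.level_le
  · exact absurd h2 hi'.of_wakeAll.2

theorem active_of_le {a b : ℕ} (ha : 1 ≤ a) (hab : a ≤ b) {j : Proc L}
    (hj : Active A a (config n A a) j) (hj' : Alive A b (config n A b) j) :
    Active A b (config n A b) j ∧ (config n A b j).ctrl.level ≤ (config n A a j).ctrl.level := by
  induction b, hab using Nat.le_induction with
  | base => exact ⟨hj, le_rfl⟩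
  | succ b hb ih =>
    obtain ⟨h1, h2⟩ := ih (alive_of_succ (ha.trans hb) hj')
    obtain ⟨h3, -, h4⟩ := active_of_succ (ha.trans hb) h1 hj'
    exact ⟨h3, h4.trans h2⟩

theorem view_le_succ (hr : 1 ≤ r) {j : Proc L} (hj : Alive A (r + 1) (config n A (r + 1)) j) :
    (config n A r j).view.Le (config n A (r + 1) j).view := by
  rcases (alive_of_succ hr hj).active_or_waits with h | ⟨d, h⟩
  · rw [config_view (r := r + 1)]
    exact (active_succ hr h).2.le
  · rw [config_view, config_view, execution_succ hr]
    by_cases hn : ∃ g s, Reports A r (config n A r) g s j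
    · obtain ⟨g, s, hs⟩ := hn
      have hc := core_config n A hr
      rw [(step_receives h hs fun g' i hi => hc.single i s hi.active hs.active).1]
      have h1 := (hc.below s j hs.active h.alive).1
      rw [config_view, config_view] at h1
      have h2 := hc.good s hs.active.alive
      rw [config_view] at h2
      have h3 := h1.trans (View.le_afterReport h2.before s g j)
      exact h3.trans h3.le_merge
    · rw [(step_waits h fun g s hs => hn ⟨g, s, hs⟩).1]
      exact View.Le.refl _

theorem view_le_of_le {a b : ℕ} (ha : 1 ≤ a) (hab : a ≤ b) {j : Proc L}
    (hj : Alive A b (config n A b) j) : (config n A a j).view.Le (config n A b j).view := by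
  induction b, hab using Nat.le_induction with
  | base => exact View.Le.refl _
  | succ b hb ih =>
    exact (ih (alive_of_succ (ha.trans hb) hj)).trans (view_le_succ (ha.trans hb) hj)

theorem history_subset_of_le {a b : ℕ} (ha : 1 ≤ a) (hab : a ≤ b) (j : Proc L) :
    history n A a j ⊆ history n A b j := by
  induction b, hab using Nat.le_induction with
  | base => exact Set.Subset.refl _
  | succ b hb ih =>
    refine ih.trans ?_
    rw [history_succ (ha.trans hb)]
    exact subset_nextHist j

theorem view_le_of_receive (hr : 1 ≤ r) {g : ℕ} {s j : Proc L}
    (hs : Reports A r (config n A r) g s j) (hj : Alive A (r + 1) (config n A (r + 1)) j) :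
    (config n A r s).view.Le (config n A (r + 1) j).view := by
  have hc := core_config n A hr
  rcases (alive_of_succ hr hj).active_or_waits with h | ⟨d, h⟩
  · obtain rfl := hc.single j s h hs.active
    exact view_le_succ hr hj
  · rw [config_view, config_view, execution_succ hr,
      (step_receives h hs fun g' i hi => hc.single i s hi.active hs.active).1]
    have h1 := (hc.below s j hs.active h.alive).1
    rw [config_view, config_view] at h1
    have h2 := hc.good s hs.active.alive
    rw [config_view] at h2
    have h3 := View.le_afterReport h2.before s g j
    exact h3.trans (h1.trans h3).le_merge

/-- A process with a message in its causal history knows what the sender knew. -/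
theorem view_le_of_mem_history {a h : ℕ} {s p : Proc L} (ha : 1 ≤ a)
    (hs : Reports A a (config n A a) h s p) (har : a < r) {j : Proc L}
    (hj : Alive A r (config n A r) j) (haj : a ∈ history n A r j) :
    (config n A a s).view.Le (config n A r j).view := by
  obtain ⟨r, rfl⟩ : ∃ k, r = k + 1 := ⟨r - 1, by omega⟩
  rw [Nat.lt_succ_iff] at har
  induction r, har using Nat.le_induction generalizing j with
  | base =>
    have hc := core_config n A ha
    have hja := alive_of_succ ha hj
    rw [history_succ ha] at haj
    rcases haj with h0 | ⟨-, g, q, h0⟩ | ⟨i, g, h0, -⟩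
    · exact absurd (hc.hist j a hja h0) (lt_irrefl a)
    · obtain rfl := hc.single j s ⟨hja.1, by rw [h0]; trivial⟩ hs.active
      exact view_le_succ ha hj
    · obtain rfl := hc.single i s h0.active hs.active
      exact view_le_of_receive ha h0 hj
  | succ r hr ih =>
    have h1 : 1 ≤ r + 1 := by omega
    rw [history_succ h1] at haj
    rcases haj with h0 | ⟨h0, -⟩ | ⟨i, g, h0, h2 | h2⟩
    · exact (ih (alive_of_succ h1 hj) h0).trans (view_le_succ h1 hj)
    · omega
    · exact (ih h0.active.alive h2).trans (view_le_of_receive h1 h0 hj)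
    · omega

/-- What none of the processes knows, nobody will know. -/
theorem notMem_history_of_le {a b c : ℕ} (hb : 1 ≤ b) (hbc : b ≤ c) (hab : a < b)
    (hn : ∀ j, Alive A b (config n A b) j → a ∉ history n A b j) {j : Proc L}
    (hj : Alive A c (config n A c) j) : a ∉ history n A c j := by
  induction c, hbc using Nat.le_induction generalizing j with
  | base => exact hn j hj
  | succ c hc ih =>
    have h1 := hb.trans hc
    rw [history_succ h1]
    rintro (h0 | ⟨h0, -⟩ | ⟨i, g, h0, h2 | h2⟩)
    · exact ih (alive_of_succ h1 hj) h0
    · omega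
    · exact ih h0.active.alive h2
    · omega

/-- If two ordinary messages of level `h` are sent to `p` then whoever is active in the group after
the first one knows of it. -/
theorem mem_history_of_report_twice {a b h : ℕ} {s s' p : Proc L} (ha : 1 ≤ a) (hab : a < b)
    (hs : Reports A a (config n A a) h s p) (hs' : Reports A b (config n A b) h s' p) (har : a < r)
    {j : Proc L} (hj : Active A r (config n A r) j) (hg : groupIdx h j = groupIdx h p) :
    a ∈ history n A r j := by
  have hb : 1 ≤ b := by omega
  have hc := core_config n A hb
  have hP := pointerInv_config n A hb
  have hok := hc.ok s' hs'.active
  have hgood := hc.good s' hs'.active.alive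
  rw [hs'.1] at hok
  obtain ⟨h1, hL, ht, -⟩ := hok
  obtain ⟨hpg, -, hpF, hskip⟩ := hgood.points.target_some h1 hL ht
  have hR : ReportTo n A b h (groupIdx h s') a p := ⟨ha, hab, hpg, s, hs⟩
  have hmem : a ∈ history n A b s' := by
    -- By `lost`, an unheard message to `p` would mean that `p` is known to be retired, but `p` is
    -- the present target.
    by_contra h0
    refine hpF ((hP.passed s' hs'.active h ?_ hL).lost a p hR h0)
    rw [hs'.1]
    simp only [Ctrl.level]
    omega
  -- Up to round `b`: if the active `j` does not know of the message, nobody does, and then nobody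
  -- ever will, contrary to the knowledge of `s'`. After round `b`: at that round `j` was `s'` or
  -- was waiting in the group, and `known` applies.
  rcases le_or_gt r b with hrb | hrb
  · by_contra h0
    have hcr := core_config n A (r := r) (by omega)
    exact notMem_history_of_le (by omega) hrb har
      (fun i hi h2 => h0 ((hcr.below j i hj hi).2 h2)) hs'.active.alive hmem
  · refine history_subset_of_le hb hrb.le j ?_
    have hjb := alive_of_le hb hrb.le hj.alive
    rcases hjb.active_or_waits with h0 | h0
    · rw [hc.single j s' h0 hs'.active]
      exact hmem
    · refine (hP.pointers h _ h1 hL).known s' a p hs'.active.alive hR hmem j (hg.trans hpg) h0 ?_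
      -- The waiting `j` lies on the arc from `p` to the pointer: the complementary arc, from the
      -- pointer to its target `p`, contains nobody waiting.
      refine (cd_cover j ((hgood.points h h1 hL s').trans hpg.symm)).resolve_right fun h2 => ?_
      rcases hskip j (hg.trans hpg) h2 with rfl | h3
      · exact h0.elim fun d h4 => h4.not_active hs'.active
      · exact hc.sound s' j hs'.active.alive h3 hjb

end

/-! ### Performances of units of real and of fault-detection work -/

/-- The view `v` shows that a unit has been performed: a unit of real work, or the detection of the
failure of a process. -/
def Done (v : View L) : ℕ ⊕ Proc L → Prop
  | .inl u => u < v.workPoint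
  | .inr q => q ∈ v.faulty

/-- Process `i` performs in round `r` a unit of work, at level `0`, or detects a failure at level
`l`. -/
def Performed (n : ℕ) (A : Crashes L) (r : ℕ) (i : Proc L) (l : ℕ) : ℕ ⊕ Proc L → Prop
  | .inl u => l = 0 ∧ Performs n A r (execution n A r) i u
  | .inr q => (config n A r i).ctrl = .await l q ∧ (r : ℕ∞) < A.crashRound i ∧
      replied n A r (execution n A r) i q = false

/-- A unit performed by `i` in round `r` is performed again, by a process of the group to which `i`
reports it. -/
def Redone (n : ℕ) (A : Crashes L) (r : ℕ) (i : Proc L) (l : ℕ) (x : ℕ ⊕ Proc L) : Prop :=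
  ∃ r' j, r < r' ∧ groupIdx (l + 1) j = groupIdx (l + 1) i ∧ Performed n A r' j l x

/-- The crash of process `i` prevents the report of the unit that `i` performs in round `r`. -/
def Interrupted (n : ℕ) (A : Crashes L) (r : ℕ) (i : Proc L) : Prop :=
  A.crashRound i = (r : ℕ∞) ∨
    A.crashRound i = ((r + 1 : ℕ) : ℕ∞) ∧ ∃ h p, (config n A (r + 1) i).ctrl = .report h p

theorem Done.mono {v w : View L} (h : v.Le w) {x : ℕ ⊕ Proc L} (hx : Done v x) : Done w x := by
  cases x with
  | inl u => exact lt_of_lt_of_le hx h.2.1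
  | inr q => exact h.1 hx

section

variable {n r l : ℕ} {A : Crashes L} {i : Proc L} {x : ℕ ⊕ Proc L}

theorem Performed.ctrl (h : Performed n A r i l x) :
    (∃ u, x = .inl u ∧ l = 0 ∧ (config n A r i).ctrl = .work u) ∨
    ∃ q, x = .inr q ∧ (config n A r i).ctrl = .await l q := by
  cases x with
  | inl u => exact Or.inl ⟨u, rfl, h.1, h.2.1⟩
  | inr q => exact Or.inr ⟨q, rfl, h.1⟩

theorem Performed.active (h : Performed n A r i l x) : Active A r (config n A r) i := by
  cases x with
  | inl u =>
    refine ⟨h.2.2.elim le_of_lt fun h0 => h0.1.le, ?_⟩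
    rw [show (config n A r i).ctrl = .work u from h.2.1]
    trivial
  | inr q =>
    refine ⟨h.2.1.le, ?_⟩
    rw [h.1]
    trivial

theorem Performed.not_report (h : Performed n A r i l x) (g : ℕ) (p : Proc L) :
    (config n A r i).ctrl ≠ .report g p := by
  rcases h.ctrl with ⟨u, -, -, h0⟩ | ⟨q, -, h0⟩ <;>
    · rw [h0]
      exact fun h1 => by cases h1

theorem Performed.not_done (hr : 1 ≤ r) (h : Performed n A r i l x) :
    ¬Done (config n A r i).view x := by
  have hc := core_config n A hr
  have hok := hc.ok i h.active
  rcases h.ctrl with ⟨u, rfl, -, h0⟩ | ⟨q, rfl, h0⟩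
  · rw [h0] at hok
    exact fun h1 => absurd hok.1 (ne_of_lt h1)
  · rw [h0] at hok
    exact ((hc.good i h.active.alive).points.target_some hok.1 hok.2.1 hok.2.2).2.2.1

theorem Performed.done_succ (hr : 1 ≤ r) (h : Performed n A r i l x) :
    Done (execution n A (r + 1) i).view x := by
  have h1 := (active_succ hr h.active).1
  rw [Prod.ext_iff] at h1
  rw [show (execution n A (r + 1) i).view = _ from h1.1]
  cases x with
  | inl u =>
    rw [show (config n A r i).ctrl = .work u from h.2.1]
    simp only [execute]
    split_ifs
    · split <;> exact Nat.lt_succ_self u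
    · exact Nat.lt_succ_self u
  | inr q =>
    rw [h.1]
    simp only [execute, h.2.2]
    rw [if_neg Bool.false_ne_true]
    split_ifs
    · exact Finset.mem_insert_self _ _
    · split <;> exact Finset.mem_insert_self _ _

/-- If no report follows, there is nobody in the group to whom the performer could report; then only
the performer could repeat the unit, and it knows better. -/
theorem Performed.next (hr : 1 ≤ r) (h : Performed n A r i l x) (hl : l < L ∨ l = 0) :
    (∃ p, (execution n A (r + 1) i).ctrl = .report (l + 1) p) ∨
    ∀ y, groupIdx (l + 1) y = groupIdx (l + 1) i →
      y = i ∨ y ∈ (execution n A (r + 1) i).view.faulty := by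
  have h1 := (active_succ hr h.active).1
  rw [Prod.ext_iff] at h1
  rw [show (execution n A (r + 1) i).view = _ from h1.1,
    show (execution n A (r + 1) i).ctrl = _ from h1.2]
  have hgood := (core_config n A hr).good i h.active.alive
  cases x with
  | inl u =>
    obtain rfl := h.1
    rw [show (config n A r i).ctrl = .work u from h.2.1]
    simp only [execute]
    split_ifs with hL
    · split
      · rename_i p _
        exact Or.inl ⟨p, rfl⟩
      · rename_i ht
        exact Or.inr fun y hy => View.PointsOK.target_none
          (v := (config n A r i).view.workDone r u) hgood.points le_rfl hL ht hy
    · refine Or.inr fun y _ => Or.inl (Fin.ext ?_)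
      have h2 := y.isLt
      have h3 := i.isLt
      obtain rfl : L = 0 := by omega
      omega
  | inr q =>
    have hok := (core_config n A hr).ok i h.active
    rw [h.1] at hok ⊢
    have hlL : l < L := hl.elim id fun h0 => by have := hok.1; omega
    simp only [execute, h.2.2]
    rw [if_neg Bool.false_ne_true, if_neg hlL.ne]
    split
    · rename_i p _
      exact Or.inl ⟨p, rfl⟩
    · rename_i ht
      exact Or.inr fun y hy => View.PointsOK.target_none
        (v := (config n A r i).view.addFaulty q) hgood.points (Nat.succ_pos l) hlL ht hy

/-- Soundness at the end of the round also for the failure detected in this round: the polled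
process would have replied. -/
theorem not_alive_succ_of_mem_faulty (hr : 1 ≤ r) (hi : Active A r (config n A r) i) {y : Proc L}
    (hy : y ∈ (execution n A (r + 1) i).view.faulty) :
    ¬Alive A (r + 1) (config n A (r + 1)) y := by
  intro hya
  have hc := core_config n A hr
  have hyr := alive_of_succ hr hya
  rcases (active_succ hr hi).2.new_faulty y hy with h0 | ⟨h, h1, h2⟩
  · exact hc.sound i y hi.alive h0 hyr
  · have h3 := hc.polled i h y hi.alive h1
    rw [show (config n A r y).polledBy = _ from wakeAll_polledBy y] at h3
    have h4 : replied n A r (execution n A r) i y = true :=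
      replied_iff.2 ⟨Or.inl (lt_crash_of_alive_succ hya), hyr.2, h3⟩
    rw [h4] at h2
    cases h2

theorem Performed.interrupted_or_report (hr : 1 ≤ r) (h : Performed n A r i l x)
    (hl : l < L ∨ l = 0) (hre : Redone n A r i l x) :
    Interrupted n A r i ∨ ∃ p, Reports A (r + 1) (config n A (r + 1)) (l + 1) i p := by
  obtain ⟨r', j, hlt, hg, hj⟩ := hre
  rcases h.active.1.eq_or_lt with h0 | h0
  · exact Or.inl (Or.inl h0.symm)
  have hle : ((r + 1 : ℕ) : ℕ∞) ≤ A.crashRound i := by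
    push_cast
    exact Order.add_one_le_of_lt h0
  have hj1 : Alive A (r + 1) (config n A (r + 1)) j := alive_of_le (by omega) hlt hj.active.alive
  rcases h.next hr hl with ⟨p, hp⟩ | hnone
  · have hp' : (config n A (r + 1) i).ctrl = .report (l + 1) p := by
      rw [config_ctrl_of_active (by rw [hp]; trivial), hp]
    rcases hle.eq_or_lt with h1 | h1
    · exact Or.inl (Or.inr ⟨h1.symm, _, _, hp'⟩)
    · exact Or.inr ⟨p, hp', Or.inl h1⟩
  · rcases hnone j hg with rfl | h1
    · have h2 := h.done_succ hr
      rw [← config_view] at h2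
      exact absurd (h2.mono (view_le_of_le (by omega) hlt hj.active.alive))
        (hj.not_done (by omega))
    · exact absurd hj1 (not_alive_succ_of_mem_faulty hr h.active h1)

/-- The reports of units that are performed again have different recipients. -/
theorem Performed.report_recipient_ne (hr : 1 ≤ r) (h : Performed n A r i l x)
    (hre : Redone n A r i l x) {p : Proc L}
    (hp : Reports A (r + 1) (config n A (r + 1)) (l + 1) i p) {b : ℕ} {s : Proc L} (hb : r + 1 < b)
    (hs : Reports A b (config n A b) (l + 1) s p) : False := by
  obtain ⟨r', j, hlt, hg, hj⟩ := hre
  have hc := core_config n A (r := r + 1) (by omega)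
  have hok := hc.ok i hp.active
  rw [hp.1] at hok
  have hpg := ((hc.good i hp.active.alive).points.target_some hok.1 hok.2.1 hok.2.2.1).1
  rcases Nat.eq_or_lt_of_le (Nat.succ_le_of_lt hlt) with rfl | hlt'
  · obtain rfl := hc.single j i hj.active hp.active
    exact hj.not_report _ _ hp.1
  · have h1 := mem_history_of_report_twice (by omega) hb hp hs hlt' hj.active (hg.trans hpg.symm)
    have h2 := h.done_succ hr
    rw [← config_view] at h2
    exact hj.not_done (by omega) (h2.mono
      (view_le_of_mem_history (by omega) hp hlt' hj.active.alive h1))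

/-- The performer is crashed by round `r + 1`, which at most remains for a report, so each process
is interrupted at most once. -/
theorem Interrupted.not_performed (h : Interrupted n A r i) {r' l' : ℕ} {x' : ℕ ⊕ Proc L}
    (hlt : r < r') (h' : Performed n A r' i l' x') : False := by
  have h1 := h'.active.1
  rcases h with h2 | ⟨h2, g, p, h3⟩
  · rw [h2, Nat.cast_le] at h1
    omega
  · rw [h2, Nat.cast_le] at h1
    obtain rfl : r' = r + 1 := by omega
    exact h'.not_report _ _ h3

/-- Both detectors lie in the level-`l` group of `q`, which has two halves of level `l + 1`; equal
parity means the same half. -/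
theorem Performed.groupIdx_eq {r' : ℕ} {j q : Proc L} (hr : 1 ≤ r) (hr' : 1 ≤ r') (hl : l < L)
    (h : Performed n A r i l (.inr q)) (h' : Performed n A r' j l (.inr q))
    (hmod : groupIdx (l + 1) i % 2 = groupIdx (l + 1) j % 2) :
    groupIdx (l + 1) j = groupIdx (l + 1) i := by
  have key : ∀ {r i}, 1 ≤ r → Performed n A r i l (.inr q) → groupIdx l q = groupIdx l i := by
    intro r i hr h
    have hc := core_config n A hr
    have hok := hc.ok i h.active
    rw [h.1] at hok
    exact ((hc.good i h.active.alive).points.target_some hok.1 hok.2.1 hok.2.2).1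
  have h1 := groupIdx_succ_div hl i
  have h2 := groupIdx_succ_div hl j
  have h3 := key hr h
  have h4 := key hr' h'
  omega

theorem Performed.pos_level {q : Proc L} (hr : 1 ≤ r) (h : Performed n A r i l (.inr q)) :
    1 ≤ l ∧ l ≤ L := by
  have hok := (core_config n A hr).ok i h.active
  rw [h.1] at hok
  exact ⟨hok.1, hok.2.1⟩

theorem Performed.unit_le {u : ℕ} (hr : 1 ≤ r) (h : Performed n A r i l (.inl u)) :
    1 ≤ u ∧ u ≤ n := by
  have hc := core_config n A hr
  have hok := hc.ok i h.active
  rw [show (config n A r i).ctrl = .work u from h.2.1] at hok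
  have h1 := (hc.good i h.active.alive).work
  exact ⟨hok.1 ▸ h1.1, hok.2⟩

theorem groupIdx_one_eq (i j : Proc L) : groupIdx 1 i = groupIdx 1 j := by
  rcases Nat.eq_zero_or_pos L with rfl | hL
  · congr 1
    apply Fin.ext
    have h2 := j.isLt
    have h3 := i.isLt
    omega
  · rw [groupIdx_level_one hL, groupIdx_level_one hL]

/-- Whoever sends an ordinary message has just performed a unit of work. -/
theorem Reports.performed (hr : 1 ≤ r) {h : ℕ} {p : Proc L}
    (hs : Reports A r (config n A r) h i p) :
    ∃ r' l x, r = r' + 1 ∧ h = l + 1 ∧ 1 ≤ r' ∧ l < L ∧ Performed n A r' i l x := by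
  have hexec : (execution n A r i).ctrl = .report h p := by
    rcases wakeAll_ctrl (n := n) (r := r) (c := execution n A r) i with ⟨h1, -⟩ | ⟨d, -, -, h2⟩
    · exact h1.symm.trans hs.1
    · have h3 := h2.symm.trans hs.1
      rcases enter_cases (n := n) (i := i) (v := (execution n A r i).view) L with
        ⟨_, _, h4⟩ | ⟨_, h4⟩ | h4 <;>
        · rw [h4] at h3
          cases h3
  have hok := (core_config n A hr).ok i hs.active
  rw [hs.1] at hok
  have hent : ∀ (v : View L) g, enter n i v g ≠ .report h p := by
    intro v g h3
    rcases enter_cases (n := n) (i := i) (v := v) g with ⟨_, _, h4⟩ | ⟨_, h4⟩ | h4 <;>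
      · rw [h4] at h3
        cases h3
  rcases Nat.eq_or_lt_of_le hr with rfl | hr1
  · exfalso
    have h1 : Active A 1 (initConfig L n) i := ⟨hs.2.le, by
      rw [show (initConfig L n i).ctrl = .report h p from hexec]; trivial⟩
    have h2 := (initConfig_active h1).2
    rw [show (initConfig L n i).ctrl = .report h p from hexec] at h2
    exact hent _ _ h2.symm
  · obtain ⟨r, rfl⟩ : ∃ k, r = k + 1 := ⟨r - 1, by omega⟩
    have hr0 : 1 ≤ r := by omega
    have hact : Active A r (config n A r) i := by
      refine Active.of_step (n := n) (c := execution n A r) ⟨hs.2.le, ?_⟩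
      rw [← execution_succ hr0, hexec]
      trivial
    have hlt : (r : ℕ∞) < A.crashRound i :=
      lt_of_lt_of_le (by exact_mod_cast Nat.lt_succ_self r) hs.2.le
    have hstep := (active_succ hr0 hact).1
    rw [Prod.ext_iff] at hstep
    have hctrl := hstep.2.symm.trans hexec
    have hg := hok.2.1
    cases hcr : (config n A r i).ctrl with
    | inactive d => rw [hcr] at hctrl; cases hctrl
    | halted => rw [hcr] at hctrl; cases hctrl
    | poll g q => rw [hcr] at hctrl; cases hctrl
    | report g q =>
      rw [hcr] at hctrl
      simp only [execute] at hctrl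
      split_ifs at hctrl
      · exact absurd hctrl (hent _ _)
      · exact absurd hctrl (hent _ _)
    | work u =>
      refine ⟨r, 0, .inl u, rfl, ?_, hr0, ?_, rfl, hcr, Or.inl hlt⟩
      · rw [hcr] at hctrl
        simp only [execute] at hctrl
        split_ifs at hctrl
        · split at hctrl
          · cases hctrl
            rfl
          · exact absurd hctrl (hent _ _)
        · exact absurd hctrl (hent _ _)
      · exact lt_of_lt_of_le hok.1 hok.2.1
    | await g q =>
      rw [hcr] at hctrl
      simp only [execute] at hctrl
      split_ifs at hctrl with h1 h2
      · exact absurd hctrl (hent _ _)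
      · exact absurd hctrl (hent _ _)
      · split at hctrl
        · cases hctrl
          exact ⟨r, g, .inr q, rfl, rfl, hr0, hg, hcr, hlt, Bool.eq_false_iff.2 h1⟩
        · exact absurd hctrl (hent _ _)

end

/-! ### Counting -/

/-- Counting by codes: events are determined by their rounds, and no code serves two rounds, so any
choice of codes is injective. -/
theorem encard_le_card_of_code {α β : Type*} [Fintype β] {S : Set (ℕ × α)} (R : ℕ × α → β → Prop)
    (huniq : ∀ e ∈ S, ∀ e' ∈ S, e.1 = e'.1 → e = e') (hex : ∀ e ∈ S, ∃ b, R e b)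
    (hlt : ∀ e ∈ S, ∀ e' ∈ S, ∀ b, e.1 < e'.1 → R e b → R e' b → False) :
    S.encard ≤ (Fintype.card β : ℕ∞) := by
  choose f hf using fun e : S => hex e.1 e.2
  have hinj : Function.Injective f := by
    intro e e' h
    have h1 := hf e
    have h2 := hf e'
    rw [← h] at h2
    rcases Nat.lt_trichotomy e.1.1 e'.1.1 with h0 | h0 | h0
    · exact (hlt _ e.2 _ e'.2 _ h0 h1 h2).elim
    · exact Subtype.ext (huniq _ e.2 _ e'.2 h0)
    · exact (hlt _ e'.2 _ e.2 _ h0 h2 h1).elim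
  rw [← ENat.card_eq_coe_fintype_card]
  exact ENat.card_le_card_of_injective hinj

/-- In round `r`, process `i` sends to `q` an "Are you alive?" message of level `h`. -/
def Polls (n : ℕ) (A : Crashes L) (r h : ℕ) (i q : Proc L) : Prop :=
  (config n A r i).ctrl = .poll h q ∧ Sends A r i q

section

variable {n r : ℕ} {A : Crashes L}

/-! ### Messages and performances by round and level -/

theorem Polls.active {h : ℕ} {i q : Proc L} (hp : Polls n A r h i q) :
    Active A r (config n A r) i := ⟨hp.2.le, by rw [hp.1]; trivial⟩

theorem Polls.unique (hr : 1 ≤ r) {h h' : ℕ} {i q i' q' : Proc L} (hp : Polls n A r h i q)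
    (hp' : Polls n A r h' i' q') : h = h' ∧ i = i' ∧ q = q' := by
  obtain rfl := (core_config n A hr).single i i' hp.active hp'.active
  have := hp.1.symm.trans hp'.1
  cases this
  exact ⟨rfl, rfl, rfl⟩

theorem Polls.level (hr : 1 ≤ r) {h : ℕ} {i q : Proc L} (hp : Polls n A r h i q) :
    1 ≤ h ∧ h ≤ L ∧ groupIdx h q = groupIdx h i ∧ q ≠ i ∧ q ∉ (config n A r i).view.faulty := by
  have hc := core_config n A hr
  have hok := hc.ok i hp.active
  rw [hp.1] at hok
  obtain ⟨h1, h2, h3, -⟩ :=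
    (hc.good i hp.active.alive).points.target_some hok.1 hok.2.1 hok.2.2
  exact ⟨hok.1, hok.2.1, h1, h2, h3⟩

/-- A process polls at most once at level `log t`; at any level, polls that do not lead to the
detection of a failure are the last ones of their process. -/
theorem Polls.not_twice (hr : 1 ≤ r) {h b : ℕ} {i q q' : Proc L} (hp : Polls n A r h i q)
    (hb : r < b) (hp' : Polls n A b h i q')
    (hfin : h = L ∨ ¬Performed n A (r + 1) i h (.inr q)) : False := by
  obtain ⟨h1, hL, hqg, hqi, -⟩ := hp.level hr
  obtain ⟨-, -, hqg', hqi', hqF'⟩ := hp'.level (by omega)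
  have hal : ∀ {a}, 1 ≤ a → a ≤ b → Alive A a (config n A a) i :=
    fun h1 h2 => alive_of_le h1 h2 hp'.active.alive
  obtain ⟨hact, hctrl, -⟩ := active_of_succ hr hp.active (hal (by omega) hb)
  have hexec := (active_succ hr hp.active).1
  rw [Prod.ext_iff, hp.1] at hexec
  rw [show (execution n A (r + 1) i).ctrl = .await h q from hexec.2] at hctrl
  rcases Nat.eq_or_lt_of_le (Nat.succ_le_of_lt hb) with rfl | hb2
  · have := hctrl.symm.trans hp'.1
    cases this
  have h2 := hal (a := r + 2) (by omega) hb2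
  have hlt := lt_crash_of_alive_succ h2
  cases hrep : replied n A (r + 1) (execution n A (r + 1)) i q with
  | false =>
    have hper : Performed n A (r + 1) i h (.inr q) := ⟨hctrl, hlt, hrep⟩
    obtain rfl := hfin.resolve_right (not_not.2 hper)
    -- At level `log t` there is only one other process, already known to be retired at the second
    -- poll.
    obtain rfl := eq_of_groupIdx_top hqg hqg' hqi hqi'
    have h3 := hper.done_succ (by omega)
    rw [← config_view] at h3
    exact hqF' (h3.mono (view_le_of_le (by omega) hb2 hp'.active.alive))
  | true =>
    obtain ⟨hact2, hctrl2, -⟩ := active_of_succ (by omega) hact h2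
    have hexec2 := (active_succ (by omega) hact).1
    rw [Prod.ext_iff, hctrl] at hexec2
    -- After a reply the process goes to a lower level and never rises again.
    have h3 : (execution n A (r + 2) i).ctrl = enter n i (config n A (r + 1) i).view (h - 1) := by
      refine hexec2.2.trans ?_
      simp only [execute, hrep, if_true]
    have h4 := (active_of_le (by omega) hb2 hact2 hp'.active.alive).2
    rw [hctrl2, h3, hp'.1] at h4
    have h5 : h ≤ h - 1 := h4.trans (enter_level_le (h - 1))
    omega

/-- A reply is the answer to a poll of the round before. -/
theorem polls_of_polledBy (hr : 1 ≤ r) {i j : Proc L} (hj : i ∈ (execution n A r j).polledBy) :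
    ∃ r' h, r = r' + 1 ∧ 1 ≤ r' ∧ Polls n A r' h i j := by
  rcases Nat.eq_or_lt_of_le hr with rfl | hr1
  · exact absurd hj (Finset.notMem_empty i)
  · obtain ⟨r, rfl⟩ : ∃ k, r = k + 1 := ⟨r - 1, by omega⟩
    have hr0 : 1 ≤ r := by omega
    rw [execution_succ hr0] at hj
    obtain ⟨h1, h, h2⟩ := isPoll_any_sent.1 (Finset.mem_filter.1 hj).2
    exact ⟨r, h, rfl, hr0, h2, h1⟩

theorem Performed.unique (hr : 1 ≤ r) {l l' : ℕ} {i i' : Proc L} {x x' : ℕ ⊕ Proc L}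
    (h : Performed n A r i l x) (h' : Performed n A r i' l' x') : l = l' ∧ i = i' ∧ x = x' := by
  obtain rfl := (core_config n A hr).single i i' h.active h'.active
  rcases h.ctrl with ⟨u, rfl, rfl, h0⟩ | ⟨q, rfl, h0⟩ <;>
    rcases h'.ctrl with ⟨u', rfl, rfl, h1⟩ | ⟨q', rfl, h1⟩ <;>
    · have := h0.symm.trans h1
      cases this <;> exact ⟨rfl, rfl, rfl⟩

theorem Reports.unique (hr : 1 ≤ r) {h h' : ℕ} {s s' p p' : Proc L}
    (hs : Reports A r (config n A r) h s p) (hs' : Reports A r (config n A r) h' s' p') :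
    h = h' ∧ s = s' ∧ p = p' := by
  obtain rfl := (core_config n A hr).single s s' hs.active hs'.active
  have := hs.1.symm.trans hs'.1
  cases this
  exact ⟨rfl, rfl, rfl⟩

/-! ### Real work -/

theorem workDone_unique : ∀ e ∈ workDone n A, ∀ e' ∈ workDone n A, e.1 = e'.1 → e = e' := by
  rintro ⟨r, i, u⟩ ⟨hr, h⟩ ⟨r', i', u'⟩ ⟨-, h'⟩ (rfl : r = r')
  obtain ⟨-, rfl, h2⟩ := Performed.unique (x := .inl u) (x' := .inl u') hr ⟨rfl, h⟩ ⟨rfl, h'⟩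
  cases h2
  rfl

/-- The three sets are the performances that are not repeated, those whose report is prevented by a
crash, and those repeated in spite of a report. Their codes are the unit, the performer and the
recipient. -/
theorem encard_workDone_le (n : ℕ) (A : Crashes L) :
    (workDone n A).encard ≤ ((n + 2 * 2 ^ L : ℕ) : ℕ∞) := by
  have hperf : ∀ e ∈ workDone n A, Performed n A e.1 e.2.1 0 (.inl e.2.2) := fun e he => ⟨rfl, he.2⟩
  set S1 := {e ∈ workDone n A | ¬Redone n A e.1 e.2.1 0 (.inl e.2.2)} with hS1
  set S2 := {e ∈ workDone n A | Interrupted n A e.1 e.2.1} with hS2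
  set S3 := {e ∈ workDone n A | Redone n A e.1 e.2.1 0 (.inl e.2.2) ∧
    ∃ p, Reports A (e.1 + 1) (config n A (e.1 + 1)) 1 e.2.1 p} with hS3
  have hsub : workDone n A ⊆ S1 ∪ (S2 ∪ S3) := by
    intro e he
    by_cases h1 : Redone n A e.1 e.2.1 0 (.inl e.2.2)
    · rcases (hperf e he).interrupted_or_report he.1 (Or.inr rfl) h1 with h2 | h2
      · exact Or.inr (Or.inl ⟨he, h2⟩)
      · exact Or.inr (Or.inr ⟨he, h1, h2⟩)
    · exact Or.inl ⟨he, h1⟩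
  have b1 : S1.encard ≤ (Fintype.card (Fin n) : ℕ∞) := by
    refine encard_le_card_of_code (fun e b => e.2.2 = (b : ℕ) + 1)
      (fun e he e' he' => workDone_unique e he.1 e' he'.1) (fun e he => ?_) ?_
    · obtain ⟨h1, h2⟩ := (hperf e he.1).unit_le he.1.1
      exact ⟨⟨e.2.2 - 1, by omega⟩, (Nat.sub_add_cancel h1).symm⟩
    · intro e he e' he' b hlt hb hb'
      refine he.2 ⟨e'.1, e'.2.1, hlt, groupIdx_one_eq _ _, ?_⟩
      rw [hb, ← hb']
      exact hperf e' he'.1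
  have b2 : S2.encard ≤ (Fintype.card (Proc L) : ℕ∞) := by
    refine encard_le_card_of_code (fun e b => e.2.1 = b)
      (fun e he e' he' => workDone_unique e he.1 e' he'.1) (fun e he => ⟨_, rfl⟩) ?_
    rintro e he e' he' b hlt rfl hb'
    have h1 := hperf e' he'.1
    rw [hb'] at h1
    exact he.2.not_performed hlt h1
  have b3 : S3.encard ≤ (Fintype.card (Proc L) : ℕ∞) := by
    refine encard_le_card_of_code
      (fun e b => Reports A (e.1 + 1) (config n A (e.1 + 1)) 1 e.2.1 b)
      (fun e he e' he' => workDone_unique e he.1 e' he'.1) (fun e he => he.2.2) ?_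
    intro e he e' he' b hlt hb hb'
    exact (hperf e he.1).report_recipient_ne he.1.1 he.2.1 hb (Nat.succ_lt_succ hlt) hb'
  calc (workDone n A).encard ≤ S1.encard + (S2.encard + S3.encard) :=
        (Set.encard_le_encard hsub).trans ((Set.encard_union_le _ _).trans
          (add_le_add le_rfl (Set.encard_union_le _ _)))
    _ ≤ _ := add_le_add b1 (add_le_add b2 b3)
    _ = _ := by
        simp only [Fintype.card_fin]
        norm_cast
        ring

/-! ### Messages -/

/-- The "Are you alive?" messages. -/
def pollsSent (n : ℕ) (A : Crashes L) : Set (ℕ × Proc L × Proc L × Msg L) :=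
  {e | 1 ≤ e.1 ∧ e.2.2.2 = .areYouAlive ∧ ∃ h, Polls n A e.1 h e.2.1 e.2.2.1}

/-- The replies. -/
def repliesSent (n : ℕ) (A : Crashes L) : Set (ℕ × Proc L × Proc L × Msg L) :=
  {e | 1 ≤ e.1 ∧ e.2.2.2 = .reply ∧ Sends A e.1 e.2.1 e.2.2.1 ∧
    (config n A e.1 e.2.1).ctrl ≠ .halted ∧ e.2.2.1 ∈ (execution n A e.1 e.2.1).polledBy}

/-- The ordinary messages. -/
def reportsSent (n : ℕ) (A : Crashes L) : Set (ℕ × Proc L × Proc L × Msg L) :=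
  {e | 1 ≤ e.1 ∧ ∃ h, Reports A e.1 (config n A e.1) h e.2.1 e.2.2.1 ∧
    e.2.2.2 = .ordinary (afterReport e.1 e.2.1 (execution n A e.1 e.2.1).view h e.2.2.1)}

theorem messagesSent_subset :
    messagesSent n A ⊆ pollsSent n A ∪ (repliesSent n A ∪ reportsSent n A) := by
  rintro ⟨r, i, q, m⟩ ⟨hr, hm⟩
  obtain ⟨h1, ⟨h2, h3, h4⟩ | ⟨h2, h, h3⟩ | ⟨h, h2, h3⟩⟩ := mem_sent.1 hm
  · exact Or.inr (Or.inl ⟨hr, h2, h1, h3, h4⟩)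
  · exact Or.inl ⟨hr, h2, h, h3, h1⟩
  · exact Or.inr (Or.inr ⟨hr, h, ⟨h2, h1⟩, h3⟩)

theorem pollsSent_unique : ∀ e ∈ pollsSent n A, ∀ e' ∈ pollsSent n A, e.1 = e'.1 → e = e' := by
  rintro ⟨r, i, q, m⟩ ⟨hr, h1, h, h2⟩ ⟨r', i', q', m'⟩ ⟨-, h1', h', h2'⟩ (rfl : r = r')
  obtain ⟨-, rfl, rfl⟩ := Polls.unique hr h2 h2'
  obtain rfl : m = .areYouAlive := h1
  obtain rfl : m' = .areYouAlive := h1'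
  rfl

theorem repliesSent_unique :
    ∀ e ∈ repliesSent n A, ∀ e' ∈ repliesSent n A, e.1 = e'.1 → e = e' := by
  rintro ⟨r, i, q, m⟩ ⟨hr, h1, -, -, h2⟩ ⟨r', i', q', m'⟩ ⟨-, h1', -, -, h2'⟩ (rfl : r = r')
  obtain ⟨a, h, ha, ha1, h3⟩ := polls_of_polledBy hr h2
  obtain ⟨a', h', ha', -, h3'⟩ := polls_of_polledBy hr h2'
  obtain rfl : a = a' := by omega
  obtain ⟨-, rfl, rfl⟩ := Polls.unique ha1 h3 h3'
  obtain rfl : m = .reply := h1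
  obtain rfl : m' = .reply := h1'
  rfl

theorem reportsSent_unique :
    ∀ e ∈ reportsSent n A, ∀ e' ∈ reportsSent n A, e.1 = e'.1 → e = e' := by
  rintro ⟨r, i, q, m⟩ ⟨hr, h, h1, h2⟩ ⟨r', i', q', m'⟩ ⟨-, h', h1', h2'⟩ (rfl : r = r')
  obtain ⟨rfl, rfl, rfl⟩ := Reports.unique hr h1 h1'
  obtain rfl := Eq.trans h2 h2'.symm
  rfl

/-- The code is the level together with the polling process: a poll that gets a reply is the last
one of its process at that level. -/
theorem encard_repliesSent_le :
    (repliesSent n A).encard ≤ (Fintype.card (Fin L × Proc L) : ℕ∞) := by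
  refine encard_le_card_of_code
    (fun e b => ∃ r, e.1 = r + 1 ∧ 1 ≤ r ∧ Polls n A r ((b.1 : ℕ) + 1) b.2 e.2.1 ∧ e.2.2.1 = b.2)
    repliesSent_unique ?_ ?_
  · rintro e ⟨hr, -, -, -, h1⟩
    obtain ⟨a, h, ha, ha1, h2⟩ := polls_of_polledBy hr h1
    obtain ⟨h3, h4, -⟩ := h2.level ha1
    refine ⟨(⟨h - 1, by omega⟩, e.2.2.1), a, ha, ha1, ?_, rfl⟩
    simp only [Nat.sub_add_cancel h3]
    exact h2
  · rintro e ⟨-, -, he, he1, he2⟩ e' - b hlt ⟨a, ha, ha1, h1, h2⟩ ⟨a', ha', -, h1', -⟩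
    refine h1.not_twice ha1 (by omega) h1' (Or.inr fun h3 => ?_)
    have h4 := h3.2.2
    rw [← ha, ← h2, replied_iff.2 ⟨he, he1, he2⟩] at h4
    cases h4

/-- A set of messages is mapped to performances at levels `≥ 1` that are not repeated. -/
theorem encard_le_of_not_redone {S : Set (ℕ × Proc L × Proc L × Msg L)} (d : ℕ × ℕ)
    (huniq : ∀ e ∈ S, ∀ e' ∈ S, e.1 = e'.1 → e = e')
    (hS : ∀ e ∈ S, ∃ r l q, e.1 + d.1 = r + d.2 ∧ 1 ≤ r ∧ l < L ∧
      Performed n A r e.2.1 l (.inr q) ∧ ¬Redone n A r e.2.1 l (.inr q)) :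
    S.encard ≤ (Fintype.card (Fin L × Proc L × Bool) : ℕ∞) := by
  -- A failed process can have one final detection in each half of its level-`l` group; the Boolean
  -- records the half. The pair `d` is the fixed shift between the rounds of the message and of the
  -- performance.
  refine encard_le_card_of_code (fun e b => ∃ r, e.1 + d.1 = r + d.2 ∧ 1 ≤ r ∧
      Performed n A r e.2.1 b.1 (.inr b.2.1) ∧ ¬Redone n A r e.2.1 b.1 (.inr b.2.1) ∧
      b.2.2 = decide (groupIdx ((b.1 : ℕ) + 1) e.2.1 % 2 = 0)) huniq ?_ ?_
  · intro e he
    obtain ⟨r, l, q, h1, h2, h3, h4, h5⟩ := hS e he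
    exact ⟨(⟨l, h3⟩, q, decide (groupIdx (l + 1) e.2.1 % 2 = 0)), r, h1, h2, h4, h5, rfl⟩
  · rintro e - e' - b hlt ⟨r, h1, h2, h3, h4, h5⟩ ⟨r', h1', h2', h3', -, h5'⟩
    refine h4 ⟨r', e'.2.1, by omega, h3.groupIdx_eq h2 h2' b.1.2 h3' ?_, h3'⟩
    rw [h5, decide_eq_decide] at h5'
    omega

/-- Last polls of a process at a level contribute `t log t`. Below level `log t`, the other polls
lead to detections: those not repeated contribute `2 t log t`, and the repeated ones, interrupted or
reported, another `t log t`. -/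
theorem encard_pollsSent_le (n : ℕ) (A : Crashes L) :
    (pollsSent n A).encard ≤ ((4 * 2 ^ L * L : ℕ) : ℕ∞) := by
  set S1 := {e ∈ pollsSent n A | ∃ h, Polls n A e.1 h e.2.1 e.2.2.1 ∧
    (h = L ∨ ¬Performed n A (e.1 + 1) e.2.1 h (.inr e.2.2.1))} with hS1
  set S2 := {e ∈ pollsSent n A | ∃ h, h < L ∧ Performed n A (e.1 + 1) e.2.1 h (.inr e.2.2.1) ∧
    ¬Redone n A (e.1 + 1) e.2.1 h (.inr e.2.2.1)} with hS2
  set S3 := {e ∈ pollsSent n A | ∃ h, h < L ∧ Performed n A (e.1 + 1) e.2.1 h (.inr e.2.2.1) ∧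
    Redone n A (e.1 + 1) e.2.1 h (.inr e.2.2.1)} with hS3
  have hsub : pollsSent n A ⊆ S1 ∪ (S2 ∪ S3) := by
    intro e he
    obtain ⟨hr, -, h, hp⟩ := id he
    have hL := (hp.level hr).2.1
    by_cases h1 : h = L ∨ ¬Performed n A (e.1 + 1) e.2.1 h (.inr e.2.2.1)
    · exact Or.inl ⟨he, h, hp, h1⟩
    · rw [not_or, not_not] at h1
      have hlt := lt_of_le_of_ne hL h1.1
      by_cases h2 : Redone n A (e.1 + 1) e.2.1 h (.inr e.2.2.1)
      · exact Or.inr (Or.inr ⟨he, h, hlt, h1.2, h2⟩)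
      · exact Or.inr (Or.inl ⟨he, h, hlt, h1.2, h2⟩)
  have b1 : S1.encard ≤ (Fintype.card (Fin L × Proc L) : ℕ∞) := by
    refine encard_le_card_of_code (fun e b => e.2.1 = b.2 ∧
      Polls n A e.1 ((b.1 : ℕ) + 1) b.2 e.2.2.1)
      (fun e he e' he' => pollsSent_unique e he.1 e' he'.1) (fun e he => ?_) ?_
    · obtain ⟨⟨hr, -⟩, h, hp, -⟩ := he
      obtain ⟨h1, hL, -⟩ := hp.level hr
      refine ⟨(⟨h - 1, by omega⟩, e.2.1), rfl, ?_⟩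
      simp only [Nat.sub_add_cancel h1]
      exact hp
    · rintro e ⟨⟨hr, -⟩, h, hp, hfin⟩ e' - b hlt ⟨h1, h2⟩ ⟨-, h2'⟩
      obtain ⟨rfl, h3, -⟩ := Polls.unique hr hp h2
      rw [h3] at hfin
      exact h2.not_twice hr hlt h2' hfin
  have b2 : S2.encard ≤ (Fintype.card (Fin L × Proc L × Bool) : ℕ∞) := by
    refine encard_le_of_not_redone (n := n) (A := A) (1, 0)
      (fun e he e' he' => pollsSent_unique e he.1 e' he'.1) ?_
    rintro e ⟨-, h, hlt, hp, hre⟩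
    exact ⟨e.1 + 1, h, e.2.2.1, rfl, by omega, hlt, hp, hre⟩
  have b3 : S3.encard ≤ (Fintype.card (Fin L × Proc L) : ℕ∞) := by
    -- Failures are detected at levels `≥ 1`, so the codes of level `0` are free and are given to
    -- the interrupted performers.
    refine encard_le_card_of_code (fun e b =>
      ((b.1 : ℕ) = 0 ∧ Interrupted n A (e.1 + 1) e.2.1 ∧ e.2.1 = b.2) ∨
      (1 ≤ (b.1 : ℕ) ∧ Performed n A (e.1 + 1) e.2.1 b.1 (.inr e.2.2.1) ∧
        Redone n A (e.1 + 1) e.2.1 b.1 (.inr e.2.2.1) ∧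
        Reports A (e.1 + 2) (config n A (e.1 + 2)) ((b.1 : ℕ) + 1) e.2.1 b.2))
      (fun e he e' he' => pollsSent_unique e he.1 e' he'.1) (fun e he => ?_) ?_
    · obtain ⟨-, h, hlt, hp, hre⟩ := he
      rcases hp.interrupted_or_report (by omega) (Or.inl hlt) hre with h1 | ⟨p, h1⟩
      · exact ⟨(⟨0, by omega⟩, e.2.1), Or.inl ⟨rfl, h1, rfl⟩⟩
      · exact ⟨(⟨h, hlt⟩, p), Or.inr ⟨(hp.pos_level (by omega)).1, hp, hre, h1⟩⟩
    · rintro e - e' ⟨-, h, -, hp', -⟩ b hlt (⟨h1, h2, h3⟩ | ⟨h1, h2, h3, h4⟩)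
        (⟨h1', h2', h3'⟩ | ⟨h1', h2', h3', h4'⟩)
      · rw [h3', ← h3] at hp'
        exact h2.not_performed (Nat.succ_lt_succ hlt) hp'
      · omega
      · omega
      · exact h2.report_recipient_ne (by omega) h3 h4 (Nat.add_lt_add_right hlt 2) h4'
  calc (pollsSent n A).encard ≤ S1.encard + (S2.encard + S3.encard) :=
        (Set.encard_le_encard hsub).trans ((Set.encard_union_le _ _).trans
          (add_le_add le_rfl (Set.encard_union_le _ _)))
    _ ≤ _ := add_le_add b1 (add_le_add b2 b3)
    _ = _ := by
        simp only [Fintype.card_prod, Fintype.card_fin, Fintype.card_bool]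
        norm_cast
        ring

/-- Every report follows a performance. Performances of real work that are not repeated give `n` and
such detections `2 t log t`; reports of repeated units of all levels `0, …, log t - 1` have
different pairs of level and recipient, which gives `t log t`. -/
theorem encard_reportsSent_le (n : ℕ) (A : Crashes L) :
    (reportsSent n A).encard ≤ ((n + 3 * 2 ^ L * L : ℕ) : ℕ∞) := by
  set S1 := {e ∈ reportsSent n A | ∃ r u, e.1 = r + 1 ∧ 1 ≤ r ∧ Performed n A r e.2.1 0 (.inl u) ∧
    ¬Redone n A r e.2.1 0 (.inl u)} with hS1
  set S2 := {e ∈ reportsSent n A | ∃ r l q, e.1 = r + 1 ∧ 1 ≤ r ∧ l < L ∧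
    Performed n A r e.2.1 l (.inr q) ∧ ¬Redone n A r e.2.1 l (.inr q)} with hS2
  set S3 := {e ∈ reportsSent n A | ∃ r l x, e.1 = r + 1 ∧ 1 ≤ r ∧ l < L ∧
    Performed n A r e.2.1 l x ∧ Redone n A r e.2.1 l x ∧
    Reports A e.1 (config n A e.1) (l + 1) e.2.1 e.2.2.1} with hS3
  have hsub : reportsSent n A ⊆ S1 ∪ (S2 ∪ S3) := by
    intro e he
    obtain ⟨hr, h, hs, -⟩ := id he
    obtain ⟨r, l, x, h1, rfl, h3, h4, h5⟩ := hs.performed hr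
    by_cases h6 : Redone n A r e.2.1 l x
    · exact Or.inr (Or.inr ⟨he, r, l, x, h1, h3, h4, h5, h6, hs⟩)
    · cases x with
      | inl u =>
        obtain rfl := h5.1
        exact Or.inl ⟨he, r, u, h1, h3, h5, h6⟩
      | inr q => exact Or.inr (Or.inl ⟨he, r, l, q, h1, h3, h4, h5, h6⟩)
  have b1 : S1.encard ≤ (Fintype.card (Fin n) : ℕ∞) := by
    refine encard_le_card_of_code (fun e b => ∃ r, e.1 = r + 1 ∧
      Performed n A r e.2.1 0 (.inl ((b : ℕ) + 1)) ∧ ¬Redone n A r e.2.1 0 (.inl ((b : ℕ) + 1)))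
      (fun e he e' he' => reportsSent_unique e he.1 e' he'.1) (fun e he => ?_) ?_
    · obtain ⟨-, r, u, h1, h2, h3, h4⟩ := he
      obtain ⟨h5, h6⟩ := h3.unit_le h2
      refine ⟨⟨u - 1, by omega⟩, r, h1, ?_⟩
      simp only [Nat.sub_add_cancel h5]
      exact ⟨h3, h4⟩
    · rintro e - e' - b hlt ⟨r, h1, -, h3⟩ ⟨r', h1', h2', -⟩
      exact h3 ⟨r', e'.2.1, by omega, groupIdx_one_eq _ _, h2'⟩
  have b2 : S2.encard ≤ (Fintype.card (Fin L × Proc L × Bool) : ℕ∞) := by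
    refine encard_le_of_not_redone (n := n) (A := A) (0, 1)
      (fun e he e' he' => reportsSent_unique e he.1 e' he'.1) ?_
    rintro e ⟨-, r, l, q, h⟩
    exact ⟨r, l, q, h⟩
  have b3 : S3.encard ≤ (Fintype.card (Fin L × Proc L) : ℕ∞) := by
    refine encard_le_card_of_code (fun e b => ∃ r x, e.1 = r + 1 ∧ 1 ≤ r ∧
      Performed n A r e.2.1 b.1 x ∧ Redone n A r e.2.1 b.1 x ∧
      Reports A (r + 1) (config n A (r + 1)) ((b.1 : ℕ) + 1) e.2.1 b.2)
      (fun e he e' he' => reportsSent_unique e he.1 e' he'.1) (fun e he => ?_) ?_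
    · obtain ⟨-, r, l, x, h1, h2, h3, h4, h5, h6⟩ := he
      rw [h1] at h6
      exact ⟨(⟨l, h3⟩, e.2.2.1), r, x, h1, h2, h4, h5, h6⟩
    · rintro e - e' - b hlt ⟨r, x, h1, h2, h3, h4, h5⟩ ⟨r', x', h1', -, -, -, h5'⟩
      exact h3.report_recipient_ne h2 h4 h5 (by omega) h5'
  calc (reportsSent n A).encard ≤ S1.encard + (S2.encard + S3.encard) :=
        (Set.encard_le_encard hsub).trans ((Set.encard_union_le _ _).trans
          (add_le_add le_rfl (Set.encard_union_le _ _)))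
    _ ≤ _ := add_le_add b1 (add_le_add b2 b3)
    _ = _ := by
        simp only [Fintype.card_prod, Fintype.card_fin, Fintype.card_bool]
        norm_cast
        ring

theorem encard_messagesSent_le (n : ℕ) (A : Crashes L) :
    (messagesSent n A).encard ≤ ((n + 8 * 2 ^ L * L : ℕ) : ℕ∞) :=
  calc (messagesSent n A).encard ≤
      (pollsSent n A).encard + ((repliesSent n A).encard + (reportsSent n A).encard) :=
        (Set.encard_le_encard messagesSent_subset).trans ((Set.encard_union_le _ _).trans
          (add_le_add le_rfl (Set.encard_union_le _ _)))
    _ ≤ _ := add_le_add (encard_pollsSent_le n A)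
        (add_le_add encard_repliesSent_le (encard_reportsSent_le n A))
    _ = _ := by
        simp only [Fintype.card_prod, Fintype.card_fin]
        norm_cast
        ring

/-! ### The final time bound -/

theorem horizon_lt (L n : ℕ) :
    horizon L n < 2 ^ L * (5 * 2 ^ L + 2 * L) * (n + 2 ^ L) * 2 ^ (n + 2 ^ L) := by
  have hp : 0 < 2 ^ L := Nat.two_pow_pos L
  -- The horizon contains the power with exponent `n + 2 ^ L - 1`, so the stated bound is exactly
  -- twice the horizon.
  have h1 : 2 ^ (n + 2 ^ L) = 2 * 2 ^ (n + 2 ^ L - 1) := by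
    rw [← pow_succ', Nat.sub_add_cancel (by omega)]
  have h2 : horizon L n = 2 ^ L * (5 * 2 ^ L + 2 * L) * (n + 2 ^ L) * 2 ^ (n + 2 ^ L - 1) := by
    simp only [horizon, span, waitBound, Nat.sub_zero]
    ring
  have h3 : 0 < 2 ^ L * (5 * 2 ^ L + 2 * L) * (n + 2 ^ L) * 2 ^ (n + 2 ^ L - 1) := by positivity
  rw [h1, h2, mul_left_comm]
  omega

end

end ProtocolC

theorem theorem3p8 (L t n : ℕ) (ht : t = 2 ^ L) (A : ProtocolC.Crashes L) :
    (ProtocolC.workDone n A).encard ≤ ((n + 2 * t : ℕ) : ℕ∞) ∧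
    (ProtocolC.messagesSent n A).encard ≤ ((n + 8 * t * L : ℕ) : ℕ∞) ∧
    ∀ r : ℕ, t * (5 * t + 2 * L) * (n + t) * 2 ^ (n + t) ≤ r →
      ∀ i : ProtocolC.Proc L, ProtocolC.Retired n A r i := by
  subst ht
  refine ⟨ProtocolC.encard_workDone_le n A, ProtocolC.encard_messagesSent_le n A, fun r hr i => ?_⟩
  have h1 := ProtocolC.horizon_lt L n
  refine ProtocolC.retired_of_horizon_lt (by omega) i ?_
  have h2 : 0 < ProtocolC.horizon L n := by
    unfold ProtocolC.horizon ProtocolC.span ProtocolC.waitBound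
    simp only [Nat.sub_zero]
    positivity
  omega
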